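/- Let $C$ be an elliptic curve over $\mathbb{C}$, i.e. a proper, smooth, geometrically integral group scheme of relative dimension $1$ over $\operatorname{Spec}\mathbb{C}$, with unit $e$, and let $\chi = C\times_{\mathbb{C}} C$. Put $G=\mathbb{T}^2$, where $\mathbb{T}$ is the circle group. A pair of integers $(a,b)$ is identified with the character $z_1^a z_2^b$ of $G$, and it induces the homomorphism $\pi_{a,b}\colon\chi\to C$, $(x,y)\mapsto ax+by$. For a closed subgroup $H\le G$ with character group $H^*$, let $\mathfrak{X}(H)=\operatorname{Hom}(H^*,C)\subseteq\operatorname{Hom}(G^*,C)=\chi$ be the closed subset given by the intersection of the $\pi_{a,b}^{-1}(e)$ over all $(a,b)$ such that $z_1^az_2^b$ is trivial on $H$, and put $$\overline{\mathfrak{X}}(H)=\mathfrak{X}(H)\setminus\bigcup_K\mathfrak{X}(K),$$ where $K$ runs over the proper closed subgroups of $H$ of finite index in $H$. Let $\{H_i\}_{i\ge 1}$ be the connected closed subgroups of $G$ of codimension $1$. For $i,j\geq 1$ let $H_i^j$ be the closed subgroup of $G$ with identity component $H_i$ and exactly $j$ connected components, and let $D_{ij}=\overline{\mathfrak{X}}(H_i^j)$.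 Let $\chi_{\mathrm{Zar}}$ be the set of points of the scheme $\chi$ with the Zariski topology, and let $\chi_{\mathrm{TP}}$ be the same set with the torsion point topology, i.e. the coarsest topology in which all the $D_{ij}$ are closed. Then the identity map $\phi\colon\chi_{\mathrm{Zar}}\to\chi_{\mathrm{TP}}$ is continuous, and the following hold. 1. The pushforward $\phi_*$ is exact on quasi-coherent sheaves: if $0\to\mathcal F_1\to\mathcal F_2\to\mathcal F_3\to 0$ is a short exact sequence of $\mathcal{O}_\chi$-modules with all $\mathcal F_k$ quasi-coherent, then $0\to\phi_*\mathcal F_1\to\phi_*\mathcal F_2\to\phi_*\mathcal F_3\to 0$ is a short exact sequence of sheaves of abelian groups on $\chi_{\mathrm{TP}}$. 2. For every $n\ge 0$ and every quasi-coherent $\mathcal{O}_\chi$-module $\mathcal F$ there is an isomorphism of sheaf cohomology groups, natural in $\mathcal F$ with respect to $\mathcal{O}_\chi$-linear maps (in particular, it is $\mathbb{C}$-linear), $$H^n(\chi_{\mathrm{Zar}},\mathcal F)\;\cong\; H^n(\chi_{\mathrm{TP}},\phi_*\mathcal F).$$ -/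

import Mathlib

open CategoryTheory AlgebraicGeometry MonoidalCategory CartesianMonoidalCategory MonObj

noncomputable section

namespace TPTopology

/-! ### Closed subgroups of the 2-torus -/

/-- The compact Lie group `G = 𝕋²`. -/
abbrev Torus : Type := Circle × Circle

/-- The connected closed subgroups of `𝕋²` of codimension `1`: among the connected closed subgroups,
the trivial one is the only one of dimension `0` and `𝕋²` is the only one of dimension `2`. -/
structure IsDirection (L : Subgroup Torus) : Prop where
  isClosed : IsClosed (L : Set Torus)
  isConnected : IsConnected (L : Set Torus)
  ne_bot : L ≠ ⊥
  ne_top : L ≠ ⊤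

/-- `H` is the closed subgroup of `𝕋²` with identity component `L` and with exactly `j` connected
components. -/
structure IsAlong (L : Subgroup Torus) (j : ℕ) (H : Subgroup Torus) : Prop where
  isClosed : IsClosed (H : Set Torus)
  identityComponent : (Subgroup.connectedComponentOfOne H).map H.subtype = L
  card_components : Nat.card (ConnectedComponents H) = j

/-! ### The subvarieties of `χ = C × C` attached to closed subgroups -/

section Varieties

variable (E : Over (Spec (.of ℂ))) [GrpObj E]

/-- The abelian surface `χ = 𝔛(𝕋²) = Hom(ℤ², E) = E × E`, as a scheme. -/
abbrev chi : Scheme.{0} := (E ⊗ E).left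

/-- The homomorphism `𝔛(z) : χ ⟶ E`, `(x, y) ↦ a x + b y`, induced by the character
`z = z₁ ^ a * z₂ ^ b` of `𝕋²` (the group law of `E` is written multiplicatively). -/
def proj (a b : ℤ) : E ⊗ E ⟶ E := fst E E ^ a * snd E E ^ b

/-- The underlying closed set of the kernel of `𝔛(z₁ ^ a * z₂ ^ b) : χ ⟶ E`, i.e. the preimage of
the (one point) image of the unit section of `E`. -/
def kerProj (a b : ℤ) : Set (chi E) :=
  {x | (proj E a b).left x ∈ Set.range (η[E] : 𝟙_ _ ⟶ E).left}

/-- The subvariety `𝔛(H) = Hom(H^*, E)` of `χ = Hom((𝕋²)^*, E)`: it consists of the homomorphisms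
`(𝕋²)^* = ℤ² → E` that factor through the restriction of characters `(𝕋²)^* → H^*`, i.e. that are
trivial on every character `z₁ ^ a * z₂ ^ b` whose restriction to `H` is trivial. -/
def var (H : Subgroup Torus) : Set (chi E) :=
  {x | ∀ a b : ℤ, (∀ g ∈ H, g.1 ^ a * g.2 ^ b = 1) → x ∈ kerProj E a b}

/-- `𝔛(H)` minus the union of the `𝔛(K)`, where `K` runs over the proper closed subgroups of `H`
of finite index in `H`. -/
def bvar (H : Subgroup Torus) : Set (chi E) :=
  var E H \ ⋃ K ∈ {K : Subgroup Torus | IsClosed (K : Set Torus) ∧ K < H ∧ K.relIndex H ≠ 0},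
    var E K

/-- The collection of all the `D_{ij}`: the sets `bvar H`, where `H` is the closed subgroup of
`𝕋²` with `j ≥ 1` connected components and identity component `L`, for `L` a connected closed
subgroup of codimension `1`. -/
def generatingClosed : Set (Set (chi E)) :=
  {D | ∃ (L : Subgroup Torus) (j : ℕ) (H : Subgroup Torus),
    IsDirection L ∧ 1 ≤ j ∧ IsAlong L j H ∧ D = bvar E H}

/-- The set of points of the scheme `χ`, as a carrier for the torsion point topology. -/
def ChiTP : Type := chi E

/-- The torsion point topology on the set of points of the scheme `χ`: the topology with
generating closed subsets the `D_{ij}`. -/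
instance tpTopology : TopologicalSpace (ChiTP E) :=
  TopologicalSpace.generateFrom {U | Uᶜ ∈ generatingClosed E}

/-- The topological space `χ_TP`. -/
abbrev chiTP : TopCat.{0} := TopCat.of (ChiTP E)

/-- The topological space underlying the scheme `χ` (with the Zariski topology). -/
abbrev chiZar : TopCat.{0} := TopCat.of (chi E)

/-- The identity of the set of points of `χ`, from the Zariski to the torsion point topology. -/
def idFun : chi E → ChiTP E := fun x => x

/-- The change of topology map `φ : χ_Zar ⟶ χ_TP`. -/
def changeTop (h : Continuous (idFun E)) : chiZar E ⟶ chiTP E := TopCat.ofHom ⟨idFun E, h⟩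

end Varieties

/-! ### Sheaves -/

section Sheaves

variable (X : Scheme.{0})

/-- The functor sending an `𝒪_X`-module to its underlying sheaf of abelian groups. -/
def toAbSheaf : X.Modules ⥤ TopCat.Sheaf AddCommGrpCat.{0} (TopCat.of X) where
  obj M := ⟨M.presheaf, M.isSheaf⟩
  map f := ⟨f.mapPresheaf⟩

instance : (toAbSheaf X).Additive where

/-- The property of being a quasi-coherent `𝒪_X`-module. -/
def isQCoh : ObjectProperty X.Modules := fun M => SheafOfModules.IsQuasicoherent.{0} M

/-- Sheaf cohomology `H^n(Y, -)` of sheaves of abelian groups on a topological space `Y`. -/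
def cohomology (Y : TopCat.{0}) (n : ℕ) :
    TopCat.Sheaf AddCommGrpCat.{0} Y ⥤ AddCommGrpCat.{0} :=
  Sheaf.functorH (Opens.grothendieckTopology Y) n

end Sheaves

end TPTopology

end

/-!
The torsion point topology has a basis of open sets that are affine open subschemes of `χ`
(`exists_isAffineOpen_of_isOpen`), and the theorem holds for every continuous map `φ : X ⟶ Y` from a
scheme to a space with arbitrarily small open sets whose inverse images are affine: by Serre's
vanishing theorem (`ext_eq_zero_of_isAffineOpen`), the higher direct images of a quasi-coherent
module along such a map vanish.

For the formal part, `H^n(U, F)` is `Ext^n(ℤ_U, F)`. Serre's theorem is proved with the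
Mayer-Vietoris sequence for two basic open subsets. The vanishing of the first direct image makes
`φ_*` exact (`IsLocallyAcyclic.shortExact_map_pushforward`). The comparison map
`H^n(Y, φ_* F) → H^n(X, F)` is the map on `Ext` coming from the adjunction of the exact functor
`φ⁻¹` and `φ_*`, and dimension shifting along injective sheaves shows that it is bijective if `F`
has no higher direct images (`extComparison_bijective`).

For the basis of affine open sets, let `L` be the identity component of `H`. The characters trivial
on `L` are the multiples of one of them, `α`, so that `D = bvar E H` is the inverse image under
`π_α : χ ⟶ E` of a set `S` of torsion points of bounded order
(`exists_eq_preimage_of_mem_generatingClosed`). As multiplication by `n ≠ 0` is not constant on `E`,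
by its effect on tangent vectors, `S` is finite. The complement of a nonempty finite set of closed
points of a smooth proper curve is affine (`isAffineOpen_of_finite_compl`), and so is the
intersection of its inverse image with an affine open subset of `χ`. It remains to cover `χ` by
affine open sets of the torsion point topology: these are the products of the complements of two
sets of torsion points of exact order `1` or `k`, where `k` is the order of some nontrivial torsion
point.

The two facts on curves are proved with the function field and its valuations.
* A nonconstant rational function is a finite morphism from its regular locus to the affine line,
  by the valuative criterion and quasi-finiteness (`isFinite_toLine`), so that its regular locus is
  affine. A finiteness argument replaces the Riemann-Roch theorem in the construction of a rational
  function with prescribed poles (`exists_forall_one_lt_val_iff_eq`).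
* A nontrivial torsion point exists (`exists_torsion`). Otherwise the unit `e` is the only point
  with `2 x = e`, and pulling back along the multiplication by `2` acts on the functions whose only
  pole is `e`. As it multiplies a parameter at `e` by `2` up to higher order, it has a nonconstant
  eigenfunction (`exists_eigenfunction`). The zeros of this function form a nonempty finite set
  stable under the multiplication by `2`, and they are nontrivial torsion points.
-/

noncomputable section

namespace TPTopology

/-! ### Cohomology of open subsets -/

section OpenCohomology

open TopologicalSpace Opposite Abelian Limits

universe u

variable {X : TopCat.{u}}

/-- The free abelian sheaf `ℤ_U` on an open subset `U`, as a functor of `U`.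
The groups `Ext^n(ℤ_U, F)` are the cohomology groups `H^n(U, F)`. -/
abbrev freeAb (X : TopCat.{u}) : Opens X ⥤ TopCat.Sheaf AddCommGrpCat.{u} X :=
  yoneda ⋙ (Functor.whiskeringRight _ _ _).obj AddCommGrpCat.free ⋙
    presheafToSheaf (Opens.grothendieckTopology X) _

/-- Restriction of cohomology classes to a smaller open subset. -/
def resCoh {F : TopCat.Sheaf AddCommGrpCat.{u} X} {n : ℕ} {U V : Opens X} (h : V ≤ U)
    (ξ : Ext.{u} ((freeAb X).obj U) F n) : Ext.{u} ((freeAb X).obj V) F n :=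
  (Ext.mk₀ ((freeAb X).map (homOfLE h))).comp ξ (zero_add n)

/-- The adjunction between the free abelian sheaf on a presheaf of sets and the underlying
presheaf of sets of an abelian sheaf. -/
def freeAbAdj (X : TopCat.{u}) :
    (Functor.whiskeringRight (Opens X)ᵒᵖ _ _).obj AddCommGrpCat.free ⋙
        presheafToSheaf (Opens.grothendieckTopology X) AddCommGrpCat.{u} ⊣
      sheafToPresheaf (Opens.grothendieckTopology X) AddCommGrpCat.{u} ⋙
        (Functor.whiskeringRight (Opens X)ᵒᵖ _ _).obj (forget AddCommGrpCat.{u}) :=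
  (AddCommGrpCat.adj.whiskerRight (Opens X)ᵒᵖ).comp (sheafificationAdjunction _ _)

/-- The universal property of `ℤ_U`: morphisms to `F` are sections of `F` over `U`. -/
def freeAbHomEquiv (U : Opens X) (F : TopCat.Sheaf AddCommGrpCat.{u} X) :
    ((freeAb X).obj U ⟶ F) ≃ F.obj.obj (op U) :=
  ((freeAbAdj X).homEquiv (yoneda.obj U) F).trans yonedaEquiv

lemma freeAbHomEquiv_comp {U : Opens X} {F G : TopCat.Sheaf AddCommGrpCat.{u} X}
    (f : (freeAb X).obj U ⟶ F) (g : F ⟶ G) :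
    freeAbHomEquiv U G (f ≫ g) = g.hom.app (op U) (freeAbHomEquiv U F f) :=
  (congrArg yonedaEquiv ((freeAbAdj X).homEquiv_naturality_right (X := yoneda.obj U) f g)).trans
    (yonedaEquiv_comp _ _)

lemma freeAbHomEquiv_map {U V : Opens X} (h : V ≤ U) {F : TopCat.Sheaf AddCommGrpCat.{u} X}
    (f : (freeAb X).obj U ⟶ F) :
    freeAbHomEquiv V F ((freeAb X).map (homOfLE h) ≫ f) =
      F.obj.map (homOfLE h).op (freeAbHomEquiv U F f) :=
  (congrArg yonedaEquiv ((freeAbAdj X).homEquiv_naturality_left (Y := F)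
    (yoneda.map (homOfLE h)) f)).trans (yonedaEquiv_naturality _ _).symm

lemma freeAbHomEquiv_sub {U : Opens X} {F : TopCat.Sheaf AddCommGrpCat.{u} X}
    (f g : (freeAb X).obj U ⟶ F) :
    freeAbHomEquiv U F (f - g) = freeAbHomEquiv U F f - freeAbHomEquiv U F g := by
  rw [← Category.id_comp f, ← Category.id_comp g, ← Preadditive.comp_sub]
  simp only [freeAbHomEquiv_comp]
  rfl

lemma resCoh_resCoh {F : TopCat.Sheaf AddCommGrpCat.{u} X} {n : ℕ} {U V W : Opens X}
    (h : V ≤ U) (h' : W ≤ V) (ξ : Ext.{u} ((freeAb X).obj U) F n) :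
    resCoh h' (resCoh h ξ) = resCoh (h'.trans h) ξ := by
  simp only [resCoh, Ext.mk₀_comp_mk₀_assoc, ← Functor.map_comp]
  rfl

@[simp]
lemma resCoh_zero {F : TopCat.Sheaf AddCommGrpCat.{u} X} {n : ℕ} {U V : Opens X} (h : V ≤ U) :
    resCoh h (0 : Ext.{u} ((freeAb X).obj U) F n) = 0 := by
  simp [resCoh]

lemma resCoh_refl {F : TopCat.Sheaf AddCommGrpCat.{u} X} {n : ℕ} {U : Opens X}
    (ξ : Ext.{u} ((freeAb X).obj U) F n) : resCoh le_rfl ξ = ξ := by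
  have : homOfLE (le_refl U) = 𝟙 U := rfl
  rw [resCoh, this, CategoryTheory.Functor.map_id, Ext.mk₀_id_comp]

/-- An epimorphism of sheaves is surjective on sections up to shrinking the open subset. -/
lemma exists_lift_of_epi {F G : TopCat.Sheaf AddCommGrpCat.{u} X} (g : F ⟶ G) [Epi g]
    {U : Opens X} (f : (freeAb X).obj U ⟶ G) {x : X} (hx : x ∈ U) :
    ∃ (V : Opens X) (h : V ≤ U) (_ : x ∈ V) (f' : (freeAb X).obj V ⟶ F),
      f' ≫ g = (freeAb X).map (homOfLE h) ≫ f := by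
  have := (TopCat.Sheaf.isLocallySurjective_iff_epi g).2 inferInstance
  obtain ⟨V, h, ⟨s, hs⟩, hxV⟩ :=
    (TopCat.Presheaf.isLocallySurjective_iff _).1 this U (freeAbHomEquiv U G f) x hx
  refine ⟨V, h, hxV, (freeAbHomEquiv V F).symm s, (freeAbHomEquiv V G).injective ?_⟩
  rw [freeAbHomEquiv_comp, Equiv.apply_symm_apply, freeAbHomEquiv_map]
  exact hs

/-- Cohomology classes of positive degree vanish locally. -/
theorem exists_resCoh_eq_zero (n : ℕ) {F : TopCat.Sheaf AddCommGrpCat.{u} X} {U : Opens X}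
    (ξ : Ext.{u} ((freeAb X).obj U) F (n + 1)) {x : X} (hx : x ∈ U) :
    ∃ (V : Opens X) (h : V ≤ U), x ∈ V ∧ resCoh h ξ = 0 := by
  induction n generalizing F U with
  | zero =>
    let S := ShortComplex.mk (Injective.ι F) (cokernel.π (Injective.ι F)) (by simp)
    have hS : S.ShortExact := { exact := ShortComplex.exact_cokernel _ }
    obtain ⟨ζ, hζ⟩ := Ext.covariant_sequence_exact₁ _ hS ξ (Ext.eq_zero_of_injective _) (zero_add 1)
    obtain ⟨f, rfl⟩ := (Ext.mk₀_bijective _ _).2 ζ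
    obtain ⟨V, h, hxV, f', hf'⟩ := exists_lift_of_epi S.g f hx
    refine ⟨V, h, hxV, ?_⟩
    rw [resCoh, ← hζ, Ext.mk₀_comp_mk₀_assoc, ← hf', ← Ext.mk₀_comp_mk₀,
      Ext.comp_assoc_of_second_deg_zero, hS.comp_extClass, Ext.comp_zero]
  | succ n ih =>
    let S := ShortComplex.mk (Injective.ι F) (cokernel.π (Injective.ι F)) (by simp)
    have hS : S.ShortExact := { exact := ShortComplex.exact_cokernel _ }
    obtain ⟨ζ, hζ⟩ := Ext.covariant_sequence_exact₁ _ hS ξ (Ext.eq_zero_of_injective _) rfl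
    obtain ⟨V, h, hxV, hV⟩ := ih ζ hx
    refine ⟨V, h, hxV, ?_⟩
    rw [resCoh] at hV ⊢
    rw [← hζ, ← Ext.comp_assoc (h₁₂ := zero_add _) (h₂₃ := rfl) (h := by omega), hV, Ext.zero_comp]

lemma _root_.CategoryTheory.GrothendieckTopology.MayerVietorisSquare.eq_zero_of_map_eq_zero
    {C : Type u} [Category.{u} C] {J : GrothendieckTopology C} [HasWeakSheafify J (Type u)]
    [HasSheafify J AddCommGrpCat.{u}] [HasExt.{u} (Sheaf J AddCommGrpCat.{u})]
    (S : J.MayerVietorisSquare) {F : Sheaf J AddCommGrpCat.{u}} {n : ℕ}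
    (H : ∀ z : F.H' n S.X₁, ∃ a b, z = (F.cohomologyPresheaf n).map S.f₁₂.op a -
      (F.cohomologyPresheaf n).map S.f₁₃.op b)
    (x : F.H' (n + 1) S.X₄) (h₂ : (F.cohomologyPresheaf (n + 1)).map S.f₂₄.op x = 0)
    (h₃ : (F.cohomologyPresheaf (n + 1)).map S.f₃₄.op x = 0) : x = 0 := by
  have h₁ : S.toBiprod F (n + 1) x = 0 := by
    rw [S.toBiprod_apply, h₂, h₃]
    exact map_zero _
  obtain ⟨z, hz⟩ := (ShortComplex.ab_exact_iff _).1
    ((S.sequence_exact F n (n + 1) rfl).exact 2) x h₁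
  obtain ⟨a, b, hab⟩ := H z
  have h₅ := (S.fromBiprod_biprodIsoProd_inv_apply F a b).trans hab.symm
  have h₄ := ConcreteCategory.congr_hom (S.fromBiprod_δ F n (n + 1) rfl)
    ((AddCommGrpCat.biprodIsoProd _ _).inv ⟨a, b⟩)
  exact hz.symm.trans ((congrArg (S.δ F n (n + 1) rfl) h₅).symm.trans h₄)

/-- A cohomology class of degree `n + 1` on `U ∪ V` that vanishes on `U` and on `V` is zero, as
soon as each class of degree `n` on `U ∩ V` is a difference of classes on `U` and `V`. -/
theorem eq_zero_of_resCoh_sup {F : TopCat.Sheaf AddCommGrpCat.{u} X} {n : ℕ} {U V W : Opens X}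
    (hW : W = U ⊔ V) (hUW : U ≤ W) (hVW : V ≤ W)
    (H : ∀ z : Ext.{u} ((freeAb X).obj (U ⊓ V)) F n, ∃ a b,
      z = resCoh inf_le_left a - resCoh inf_le_right b)
    (ξ : Ext.{u} ((freeAb X).obj W) F (n + 1)) (hU : resCoh hUW ξ = 0) (hV : resCoh hVW ξ = 0) :
    ξ = 0 := by
  subst hW
  exact (Opens.mayerVietorisSquare U V).eq_zero_of_map_eq_zero (F := F) H ξ hU hV

end OpenCohomology

/-! ### Vanishing of the cohomology of quasi-coherent modules on affine open subsets -/

section Affine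

open TopologicalSpace Opposite Abelian Limits

variable {X : Scheme.{0}}

lemma appIso_fromSpec_inv {V : X.Opens} (hV : IsAffineOpen V) (U : (Spec Γ(X, V)).Opens)
    (h : hV.fromSpec ''ᵁ U ≤ V) (r : Γ(X, V)) :
    (hV.fromSpec.appIso U).inv
        ((Spec Γ(X, V)).presheaf.map U.leTop.op ((Scheme.ΓSpecIso Γ(X, V)).inv r)) =
      X.presheaf.map (homOfLE h).op r := by
  apply ((ConcreteCategory.isIso_iff_bijective (hV.fromSpec.appIso U).hom).1 inferInstance).1
  rw [Iso.inv_hom_id_apply, Scheme.Hom.appIso_hom]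
  have h₁ := hV.fromSpec.naturality (homOfLE h).op
  rw [hV.fromSpec_app_self] at h₁
  simp only [← ConcreteCategory.comp_apply]
  rw [reassoc_of% h₁]
  simp only [← Functor.map_comp]
  rfl

/-- A section of a quasi-coherent module over the locus `D(f)` of an affine open subset `V`
extends to `V` after multiplication by a power of `f`. -/
lemma exists_section_extends {M : X.Modules} (hM : isQCoh X M) {V : X.Opens}
    (hV : IsAffineOpen V) (f : Γ(X, V)) (s : Γ(M, X.basicOpen f)) :
    ∃ (n : ℕ) (t : Γ(M, V)), M.presheaf.map (homOfLE (X.basicOpen_le f)).op t =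
      X.presheaf.map (homOfLE (X.basicOpen_le f)).op (f ^ n) • s := by
  let j := hV.fromSpec
  have : M.IsQuasicoherent := hM
  let N : (Spec Γ(X, V)).Modules := (Scheme.Modules.restrictFunctor j).obj M
  have hN : N.IsQuasicoherent := inferInstance
  have hloc : IsLocalizing (modulesSpecToSheaf.obj N) :=
    (isIso_fromTildeΓ_iff_isLocalizing N).1 inferInstance
  have h₁ : j ''ᵁ PrimeSpectrum.basicOpen f ≤ X.basicOpen f :=
    (hV.fromSpec_image_basicOpen f).le
  have h₁' : X.basicOpen f ≤ j ''ᵁ PrimeSpectrum.basicOpen f :=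
    (hV.fromSpec_image_basicOpen f).ge
  have h₂ : V ≤ j ''ᵁ ⊤ := (j.image_top_eq_opensRange.trans hV.opensRange_fromSpec).ge
  let s' : Γ(N, PrimeSpectrum.basicOpen f) := M.presheaf.map (homOfLE h₁).op s
  obtain ⟨⟨m, ⟨_, n, rfl⟩⟩, hm⟩ := (hloc f).surj s'
  refine ⟨n, M.presheaf.map (homOfLE h₂).op m, ?_⟩
  have hm' : M.presheaf.map (homOfLE h₁).op (X.presheaf.map (homOfLE (X.basicOpen_le f)).op
      (f ^ n) • s) = M.presheaf.map (homOfLE (j.image_mono le_top)).op m := by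
    rw [Scheme.Modules.map_smul]
    refine Eq.trans ?_ hm
    have h₃ := appIso_fromSpec_inv hV (PrimeSpectrum.basicOpen f)
      (h₁.trans (X.basicOpen_le f)) (f ^ n)
    have h₄ : X.presheaf.map (homOfLE h₁).op
      (X.presheaf.map (homOfLE (X.basicOpen_le f)).op (f ^ n)) =
        X.presheaf.map (homOfLE (h₁.trans (X.basicOpen_le f))).op (f ^ n) := by
      rw [← ConcreteCategory.comp_apply, ← Functor.map_comp]; rfl
    rw [h₄, ← h₃]
    rfl
  have h₅ := congrArg (M.presheaf.map (homOfLE h₁').op) hm'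
  have h₆ : M.presheaf.map (homOfLE h₁).op ≫ M.presheaf.map (homOfLE h₁').op = 𝟙 _ :=
    (M.presheaf.map_comp _ _).symm.trans (M.presheaf.map_id _)
  have h₇ : M.presheaf.map (homOfLE h₂).op ≫ M.presheaf.map (homOfLE (X.basicOpen_le f)).op =
      M.presheaf.map (homOfLE (j.image_mono le_top)).op ≫ M.presheaf.map (homOfLE h₁').op := by
    rw [← Functor.map_comp, ← Functor.map_comp]
    rfl
  exact (ConcreteCategory.congr_hom h₇ m).trans
    (h₅.symm.trans (ConcreteCategory.congr_hom h₆ _))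

/-- The Čech cohomology of a quasi-coherent module vanishes in degree `1` for a cover of an affine
open subset by two basic open subsets. -/
lemma exists_section_sub {M : X.Modules} (hM : isQCoh X M) {V : X.Opens}
    (hV : IsAffineOpen V) (f g : Γ(X, V)) (hfg : V = X.basicOpen f ⊔ X.basicOpen g)
    (m : Γ(M, X.basicOpen f ⊓ X.basicOpen g)) :
    ∃ (a : Γ(M, X.basicOpen f)) (b : Γ(M, X.basicOpen g)),
      m = M.presheaf.map (homOfLE inf_le_left).op a -
        M.presheaf.map (homOfLE inf_le_right).op b := by
  have key : ∀ f g : Γ(X, V), ∀ m : Γ(M, X.basicOpen f ⊓ X.basicOpen g),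
      ∃ (k : ℕ) (t : Γ(M, X.basicOpen f)), M.presheaf.map (homOfLE inf_le_left).op t =
        X.presheaf.map (homOfLE (inf_le_left.trans (X.basicOpen_le f)) :
          X.basicOpen f ⊓ X.basicOpen g ⟶ V).op (g ^ k) • m := by
    intro f g m
    let g' := X.presheaf.map (homOfLE (X.basicOpen_le f)).op g
    have hg' : X.basicOpen g' = X.basicOpen f ⊓ X.basicOpen g := X.basicOpen_res _ _
    obtain ⟨k, t, ht⟩ := exists_section_extends hM (hV.basicOpen f) g'
      (M.presheaf.map (homOfLE hg'.le).op m)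
    refine ⟨k, t, ?_⟩
    have h := congrArg (M.presheaf.map (homOfLE hg'.ge).op) ht
    rw [Scheme.Modules.map_smul] at h
    simp only [g', ← map_pow, ← ConcreteCategory.comp_apply, ← Functor.map_comp] at h
    refine h.trans ?_
    congr 1
    exact ConcreteCategory.congr_hom (M.presheaf.map_id _) m
  obtain ⟨k, t, ht⟩ := key f g m
  have hsw : X.basicOpen g ⊓ X.basicOpen f ≤ X.basicOpen f ⊓ X.basicOpen g := inf_comm _ _ |>.le
  have hsw' : X.basicOpen f ⊓ X.basicOpen g ≤ X.basicOpen g ⊓ X.basicOpen f := inf_comm _ _ |>.le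
  obtain ⟨l, u, hu⟩ := key g f (M.presheaf.map (homOfLE hsw).op m)
  replace hu := congrArg (M.presheaf.map (homOfLE hsw').op) hu
  rw [Scheme.Modules.map_smul] at hu
  simp only [← ConcreteCategory.comp_apply, ← Functor.map_comp] at hu
  have hid : M.presheaf.map ((homOfLE hsw).op ≫ (homOfLE hsw').op) m = m :=
    ConcreteCategory.congr_hom (M.presheaf.map_id _) m
  rw [hid] at hu
  have hcop : IsCoprime (f ^ l) (g ^ k) := by
    refine IsCoprime.pow ?_
    have h : Ideal.span {f, g} = ⊤ := by
      rw [← hV.self_le_iSup_basicOpen_iff, iSup_subtype, iSup_pair]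
      exact hfg.le
    rw [Ideal.eq_top_iff_one, Ideal.mem_span_pair] at h
    exact h
  obtain ⟨a, b, hab⟩ := hcop
  refine ⟨X.presheaf.map (homOfLE (X.basicOpen_le f)).op b • t,
    -(X.presheaf.map (homOfLE (X.basicOpen_le g)).op a • u), ?_⟩
  rw [map_neg, sub_neg_eq_add, Scheme.Modules.map_smul, Scheme.Modules.map_smul, ht]
  have hu' : M.presheaf.map (homOfLE inf_le_right).op u = _ := hu
  rw [hu']
  simp only [← ConcreteCategory.comp_apply, ← Functor.map_comp, smul_smul]
  have := congrArg (X.presheaf.map (homOfLE (inf_le_left.trans (X.basicOpen_le f)) :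
    X.basicOpen f ⊓ X.basicOpen g ⟶ V).op) hab
  rw [map_add, map_mul, map_mul, map_one] at this
  conv_lhs => rw [← one_smul Γ(X, X.basicOpen f ⊓ X.basicOpen g) m, ← this, add_comm, add_smul]
  rfl

lemma ext_bot_eq_zero {Y : TopCat.{0}} {F : TopCat.Sheaf AddCommGrpCat.{0} Y} {n : ℕ}
    (ξ : Ext.{0} ((freeAb Y).obj ⊥) F n) : ξ = 0 := by
  have h : (𝟙 ((freeAb Y).obj ⊥) : _) = 0 := by
    apply (freeAbHomEquiv _ _).injective
    have := AddCommGrpCat.subsingleton_of_isZero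
      (((freeAb Y).obj ⊥).isTerminalOfEmpty.isZero)
    exact Subsingleton.elim _ _
  rw [← Ext.mk₀_id_comp ξ, h, Ext.mk₀_zero, Ext.zero_comp]

/-- The cohomology `H^n(U, M)` of an `𝒪_X`-module on an open subset. -/
abbrev modCoh (M : X.Modules) (n : ℕ) (U : X.Opens) : Type :=
  Ext.{0} ((freeAb (TopCat.of X)).obj U) ((toAbSheaf X).obj M) n

/-- Restriction of cohomology classes with coefficients in an `𝒪_X`-module. -/
def modRes {M : X.Modules} {n : ℕ} {U V : X.Opens} (h : V ≤ U) (ξ : modCoh M n U) :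
    modCoh M n V :=
  resCoh (X := TopCat.of X) h ξ

lemma modRes_modRes {M : X.Modules} {n : ℕ} {U V W : X.Opens} (h : V ≤ U) (h' : W ≤ V)
    (ξ : modCoh M n U) : modRes h' (modRes h ξ) = modRes (h'.trans h) ξ :=
  resCoh_resCoh (X := TopCat.of X) h h' ξ

lemma modRes_zero {M : X.Modules} {n : ℕ} {U V : X.Opens} (h : V ≤ U) :
    modRes h (0 : modCoh M n U) = 0 :=
  resCoh_zero (X := TopCat.of X) h

lemma modRes_refl {M : X.Modules} {n : ℕ} {U : X.Opens} (ξ : modCoh M n U) :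
    modRes le_rfl ξ = ξ :=
  resCoh_refl (X := TopCat.of X) ξ

lemma modRes_eq_zero_of_le {M : X.Modules} {n : ℕ} {U V W : X.Opens} {h : V ≤ U} (h' : W ≤ V)
    {ξ : modCoh M n U} (hξ : modRes h ξ = 0) : modRes (h'.trans h) ξ = 0 := by
  rw [← modRes_modRes h h', hξ, modRes_zero]

lemma modCoh_bot_eq_zero {M : X.Modules} {n : ℕ} (ξ : modCoh M n ⊥) : ξ = 0 :=
  ext_bot_eq_zero (Y := TopCat.of X) ξ

lemma exists_modRes_eq_zero {M : X.Modules} {n : ℕ} {U : X.Opens} (ξ : modCoh M (n + 1) U)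
    {x : X} (hx : x ∈ U) : ∃ (V : X.Opens) (h : V ≤ U), x ∈ V ∧ modRes h ξ = 0 :=
  exists_resCoh_eq_zero (X := TopCat.of X) n ξ hx

lemma eq_zero_of_modRes_sup {M : X.Modules} {n : ℕ} {U V W : X.Opens}
    (hW : W = U ⊔ V) (hUW : U ≤ W) (hVW : V ≤ W)
    (H : ∀ z : modCoh M n (U ⊓ V), ∃ (a : modCoh M n U) (b : modCoh M n V),
      z = modRes inf_le_left a - modRes inf_le_right b)
    (ξ : modCoh M (n + 1) W) (hU : modRes hUW ξ = 0) (hV : modRes hVW ξ = 0) : ξ = 0 :=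
  eq_zero_of_resCoh_sup (X := TopCat.of X) hW hUW hVW H ξ hU hV

/-- Serre's vanishing theorem. For a class `ξ` in positive degree on an affine open subset `V`,
the functions `f` such that `ξ` vanishes on `D(f)` form an ideal: if `ξ` vanishes on `D(f)` and on
`D(g)`, the Mayer-Vietoris sequence shows that it vanishes on the affine open subset `D(f + g)`,
which is the union of `D(f) ∩ D(f + g)` and `D(g) ∩ D(f + g)`. As `ξ` vanishes locally, this is the
unit ideal. -/
theorem ext_eq_zero_of_isAffineOpen {M : X.Modules} (hM : isQCoh X M) (n : ℕ) {V : X.Opens}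
    (hV : IsAffineOpen V)
    (ξ : modCoh M (n + 1) V) : ξ = 0 := by
  induction n using Nat.strong_induction_on generalizing V with
  | _ n ih =>
  -- The Mayer-Vietoris condition in degree `n`, for two basic open subsets covering an affine one.
  have H : ∀ {V : X.Opens} (_ : IsAffineOpen V) (f g : Γ(X, V)),
      V = X.basicOpen f ⊔ X.basicOpen g →
      ∀ z : modCoh M n (X.basicOpen f ⊓ X.basicOpen g),
        ∃ (a : modCoh M n (X.basicOpen f)) (b : modCoh M n (X.basicOpen g)),
          z = modRes inf_le_left a - modRes inf_le_right b := by
    intro V hV f g hfg z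
    obtain _ | n := n
    · obtain ⟨z, rfl⟩ := (Ext.mk₀_bijective _ _).2 z
      obtain ⟨a, b, hab⟩ := exists_section_sub hM hV f g hfg (freeAbHomEquiv _ _ z)
      obtain ⟨a, rfl⟩ :=
        (freeAbHomEquiv (X := TopCat.of X) (X.basicOpen f) ((toAbSheaf X).obj M)).surjective a
      obtain ⟨b, rfl⟩ :=
        (freeAbHomEquiv (X := TopCat.of X) (X.basicOpen g) ((toAbSheaf X).obj M)).surjective b
      refine ⟨Ext.mk₀ a, Ext.mk₀ b, ?_⟩
      rw [modRes, modRes, resCoh, resCoh, Ext.mk₀_comp_mk₀, Ext.mk₀_comp_mk₀, sub_eq_add_neg,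
        ← Ext.mk₀_neg, ← Ext.mk₀_add, ← sub_eq_add_neg]
      congr 1
      apply (freeAbHomEquiv _ _).injective
      rw [freeAbHomEquiv_sub, freeAbHomEquiv_map, freeAbHomEquiv_map]
      exact hab
    · have hfg' : IsAffineOpen (X.basicOpen f ⊓ X.basicOpen g) := by
        rw [← X.basicOpen_mul]
        exact hV.basicOpen _
      exact ⟨0, 0, by rw [ih n (Nat.lt_succ_self n) hfg' z, modRes_zero, modRes_zero, sub_zero]⟩
  let P : Γ(X, V) → Prop := fun f => modRes (X.basicOpen_le f) ξ = 0
  have hP : Ideal.span {f | P f} = ⊤ := by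
    rw [← hV.self_le_iSup_basicOpen_iff]
    intro x hx
    obtain ⟨W, hWV, hxW, hW⟩ := exists_modRes_eq_zero ξ hx
    obtain ⟨f, hfW, hxf⟩ := hV.exists_basicOpen_le ⟨x, hxW⟩ hx
    exact Opens.mem_iSup.2 ⟨⟨f, modRes_eq_zero_of_le hfW hW⟩, hxf⟩
  have hspan : ∀ f ∈ Ideal.span {f | P f}, P f := by
    intro f hf
    induction hf using Submodule.span_induction with
    | mem f hf => exact hf
    | zero =>
      have h0 : X.basicOpen (0 : Γ(X, V)) ≤ ⊥ := (X.basicOpen_zero V).le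
      exact modRes_eq_zero_of_le h0 (modCoh_bot_eq_zero (modRes bot_le ξ))
    | smul a f _ hf =>
      have h0 : X.basicOpen (a • f) ≤ X.basicOpen f := by
        rw [smul_eq_mul, X.basicOpen_mul]; exact inf_le_right
      exact modRes_eq_zero_of_le h0 hf
    | add f g _ _ hf hg =>
      let W := X.basicOpen (f + g)
      let i : W ⟶ V := homOfLE (X.basicOpen_le (f + g))
      have hf' : X.basicOpen (X.presheaf.map i.op f) = W ⊓ X.basicOpen f := X.basicOpen_res _ _
      have hg' : X.basicOpen (X.presheaf.map i.op g) = W ⊓ X.basicOpen g := X.basicOpen_res _ _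
      have hW : W = X.basicOpen (X.presheaf.map i.op f) ⊔ X.basicOpen (X.presheaf.map i.op g) := by
        rw [hf', hg', ← inf_sup_left, left_eq_inf]
        exact X.basicOpen_add_le _ _
      refine eq_zero_of_modRes_sup hW (X.basicOpen_le _) (X.basicOpen_le _)
        (H (hV.basicOpen (f + g)) _ _ hW) _ ?_ ?_
      · rw [modRes_modRes]
        exact modRes_eq_zero_of_le (hf'.le.trans inf_le_right) hf
      · rw [modRes_modRes]
        exact modRes_eq_zero_of_le (hg'.le.trans inf_le_right) hg
  have h1 : P 1 := hspan 1 (hP ▸ Submodule.mem_top)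
  have hV1 : V ≤ X.basicOpen (1 : Γ(X, V)) := (X.basicOpen_of_isUnit isUnit_one).ge
  rw [← modRes_refl ξ]
  exact modRes_eq_zero_of_le hV1 h1

end Affine

/-! ### Exactness of the underlying abelian sheaf and of inverse images -/

section Exactness

open TopologicalSpace Opposite Abelian Limits

lemma preservesFiniteLimits_toAbSheaf (X : Scheme.{0}) : PreservesFiniteLimits (toAbSheaf X) :=
  inferInstanceAs (PreservesFiniteLimits (SheafOfModules.toSheaf.{0} X.ringCatSheaf))

/-- A colimit of modules is the sheafification of the colimit of the underlying presheaves of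
modules, and sheafification is compatible with forgetting the module structure. -/
lemma preservesFiniteColimits_toSheaf (X : Scheme.{0}) :
    PreservesFiniteColimits (SheafOfModules.toSheaf.{0} X.ringCatSheaf) where
  preservesFiniteColimits J _ _ := by
    let R := X.ringCatSheaf
    have : PreservesColimitsOfShape J
        (PresheafOfModules.sheafification.{0} (𝟙 R.obj) ⋙ SheafOfModules.toSheaf.{0} R) :=
      have : PreservesColimitsOfShape J
          (PresheafOfModules.toPresheaf.{0} R.obj ⋙
            presheafToSheaf (Opens.grothendieckTopology X) AddCommGrpCat.{0}) :=
        comp_preservesColimitsOfShape _ _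
      preservesColimitsOfShape_of_natIso
        (PresheafOfModules.sheafificationCompToSheaf (𝟙 R.obj)).symm
    refine ⟨fun {K} => ?_⟩
    let adj := PresheafOfModules.sheafificationAdjunction.{0} (𝟙 R.obj)
    let G : J ⥤ PresheafOfModules.{0} R.obj :=
      K ⋙ SheafOfModules.forget.{0} R ⋙ PresheafOfModules.restrictScalars.{0} (𝟙 R.obj)
    have : PreservesColimit (G ⋙ PresheafOfModules.sheafification (𝟙 R.obj))
        (SheafOfModules.toSheaf.{0} R) :=
      preservesColimit_of_preserves_colimit_cocone
        (isColimitOfPreserves (PresheafOfModules.sheafification.{0} (𝟙 R.obj))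
          (colimit.isColimit G))
        (isColimitOfPreserves
          (PresheafOfModules.sheafification.{0} (𝟙 R.obj) ⋙ SheafOfModules.toSheaf.{0} R)
          (colimit.isColimit G))
    exact preservesColimit_of_iso_diagram (K₁ := G ⋙ PresheafOfModules.sheafification (𝟙 R.obj)) _
      (Functor.isoWhiskerLeft K (asIso adj.counit) ≪≫ K.rightUnitor)

lemma preservesFiniteColimits_toAbSheaf (X : Scheme.{0}) :
    PreservesFiniteColimits (toAbSheaf X) :=
  preservesFiniteColimits_toSheaf X

variable {X Y : TopCat.{0}} (f : X ⟶ Y)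

lemma preservesFiniteLimits_pullback :
    PreservesFiniteLimits (TopCat.Sheaf.pullback AddCommGrpCat.{0} f) :=
  Functor.sheafPullbackConstruction.preservesFiniteLimits (Opens.map f) _ _ _

attribute [local instance] preservesFiniteLimits_pullback in
lemma additive_pullback : (TopCat.Sheaf.pullback AddCommGrpCat.{0} f).Additive :=
  Functor.additive_of_preserves_binary_products _

lemma additive_pushforward : (TopCat.Sheaf.pushforward AddCommGrpCat.{0} f).Additive :=
  Functor.additive_of_preserves_binary_products _

end Exactness

/-! ### Comparison of cohomology along an adjunction -/

section Comparison

open Abelian Limits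

universe w v u v' u'

variable {A : Type u} [Category.{v} A] [Abelian A] [HasExt.{w} A]
  {B : Type u'} [Category.{v'} B] [Abelian B] [HasExt.{w} B]
  {L : B ⥤ A} {R : A ⥤ B} (adj : L ⊣ R) [L.Additive] [PreservesFiniteLimits L]
  [PreservesFiniteColimits L]

/-- For an adjunction `L ⊣ R` with `L` exact, the map `Ext^n(Z, R F) → Ext^n(L Z, F)`. -/
def extComparison (Z : B) (F : A) (n : ℕ) : Ext.{w} Z (R.obj F) n →+ Ext.{w} (L.obj Z) F n :=
  ((Ext.mk₀ (adj.counit.app F)).postcomp (L.obj Z) (add_zero n)).comp (L.mapExtAddHom _ _ n)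

lemma extComparison_apply (Z : B) (F : A) (n : ℕ) (x : Ext.{w} Z (R.obj F) n) :
    extComparison adj Z F n x =
      (x.mapExactFunctor L).comp (Ext.mk₀ (adj.counit.app F)) (add_zero n) := rfl

lemma extComparison_naturality (Z : B) {F G : A} (g : F ⟶ G) (n : ℕ)
    (x : Ext.{w} Z (R.obj F) n) :
    extComparison adj Z G n (x.comp (Ext.mk₀ (R.map g)) (add_zero n)) =
      (extComparison adj Z F n x).comp (Ext.mk₀ g) (add_zero n) := by
  simp only [extComparison_apply, Ext.mapExactFunctor_comp, Ext.mapExactFunctor_mk₀,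
    Ext.comp_assoc_of_third_deg_zero, Ext.mk₀_comp_mk₀]
  congr 2
  exact adj.counit.naturality g

lemma extComparison_extClass (Z : B) {S : ShortComplex A} (hS : S.ShortExact)
    [R.PreservesZeroMorphisms]
    (hS' : (S.map R).ShortExact) (n : ℕ) (x : Ext.{w} Z (R.obj S.X₃) n) :
    extComparison adj Z S.X₁ (n + 1) (x.comp hS'.extClass rfl) =
      (extComparison adj Z S.X₃ n x).comp hS.extClass rfl := by
  let φ : (S.map R).map L ⟶ S :=
    { τ₁ := adj.counit.app S.X₁
      τ₂ := adj.counit.app S.X₂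
      τ₃ := adj.counit.app S.X₃
      comm₁₂ := (adj.counit.naturality S.f).symm
      comm₂₃ := (adj.counit.naturality S.g).symm }
  have h := ShortComplex.ShortExact.extClass_naturality (hS'.map_of_exact L) hS φ
  have e : (x.comp hS'.extClass rfl).mapExactFunctor L =
      (x.mapExactFunctor L).comp (hS'.map_of_exact L).extClass rfl :=
    (Ext.mapExactFunctor_comp L _ _ _).trans
      (congrArg (fun y => Ext.comp (x.mapExactFunctor L) y rfl)
        (Ext.mapExactFunctor_extClass L hS'))
  refine (congrArg (fun y => Ext.comp y (Ext.mk₀ (adj.counit.app S.X₁)) rfl) e).trans ?_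
  exact (Ext.comp_assoc_of_third_deg_zero _ _ _ _).trans
    ((congrArg (fun y => Ext.comp (x.mapExactFunctor L) y rfl) h).trans
      (Ext.comp_assoc_of_second_deg_zero _ _ _ _).symm)

lemma extComparison_zero_bijective (Z : B) (F : A) :
    Function.Bijective (extComparison adj Z F 0) := by
  have e (g : Z ⟶ R.obj F) : extComparison adj Z F 0 (Ext.mk₀ g) =
      Ext.mk₀ ((adj.homEquiv Z F).symm g) := by
    rw [extComparison_apply, Ext.mapExactFunctor_mk₀, Ext.mk₀_comp_mk₀, adj.homEquiv_counit]
  have : ⇑(extComparison adj Z F 0) =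
      Ext.homEquiv₀.symm ∘ (adj.homEquiv Z F).symm ∘ Ext.homEquiv₀ := by
    funext x
    obtain ⟨g, rfl⟩ := Ext.homEquiv₀.symm.surjective x
    simpa using! (e g).trans (congrArg (fun h => Ext.mk₀ ((adj.homEquiv Z F).symm h))
      (Ext.homEquiv₀.apply_symm_apply g).symm)
  rw [this]
  exact ((Equiv.bijective _).comp (Equiv.bijective _)).comp (Equiv.bijective _)

/-- If the objects in a class `P` are acyclic for the right adjoint `R`, in the sense that `R` is
exact on short exact sequences from an object of `P` to an injective object, and `P` is stable
under the corresponding cokernels, then `Ext^n(Z, R F) → Ext^n(L Z, F)` is an isomorphism on `P`. -/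
theorem extComparison_bijective [EnoughInjectives A] [R.PreservesZeroMorphisms] (P : A → Prop)
    (hP : ∀ S : ShortComplex A, S.ShortExact → P S.X₁ → Injective S.X₂ →
      P S.X₃ ∧ (S.map R).ShortExact)
    (Z : B) {F : A} (hF : P F) (n : ℕ) : Function.Bijective (extComparison adj Z F n) := by
  induction n generalizing F with
  | zero => exact extComparison_zero_bijective adj Z F
  | succ n hn =>
    let I : InjectivePresentation F := Classical.arbitrary _
    let S := ShortComplex.mk _ _ (cokernel.condition I.f)
    have hI : Injective S.X₂ := I.injective
    have hS : S.ShortExact := { exact := ShortComplex.exact_cokernel I.f }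
    obtain ⟨hP₃, hRS⟩ := hP S hS hF hI
    have hRI : Injective (S.map R).X₂ := Adjunction.map_injective adj _ hI
    exact AddMonoidHom.bijective_of_surjective_of_bijective_of_right_exact _ _ _ _
      (extComparison adj Z S.X₂ n) (extComparison adj Z S.X₃ n) (extComparison adj Z S.X₁ (n + 1))
      (by
        ext x
        exact (extComparison_naturality adj Z S.g n x).symm)
      (by
        ext x
        exact (extComparison_extClass adj Z hS hRS n x).symm)
      ((ShortComplex.ab_exact_iff_function_exact _).mp
        (Ext.covariant_sequence_exact₃' Z hRS n (n + 1) rfl))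
      ((ShortComplex.ab_exact_iff_function_exact _).mp
        (Ext.covariant_sequence_exact₃' (L.obj Z) hS n (n + 1) rfl))
      (by
        cases n with
        | zero => exact (extComparison_zero_bijective adj Z S.X₂).surjective
        | succ n => exact fun y => ⟨0, (map_zero _).trans (Ext.eq_zero_of_injective y).symm⟩)
      (hn hP₃)
      (fun x₁ ↦ Ext.covariant_sequence_exact₁ Z hRS x₁ (Ext.eq_zero_of_injective _) rfl)
      (fun y₁ ↦ Ext.covariant_sequence_exact₁ _ hS y₁ (Ext.eq_zero_of_injective _) rfl)

end Comparison

/-! ### Direct images of locally acyclic sheaves -/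

section LocallyAcyclic

open TopologicalSpace Opposite Abelian Limits

attribute [local instance] preservesFiniteLimits_pullback additive_pullback additive_pushforward

variable {X Y : TopCat.{0}} (f : X ⟶ Y)

/-- A sheaf on `X` is locally acyclic for `f : X ⟶ Y` if its cohomology classes in positive degrees
on `f⁻¹ V` vanish after restriction to the inverse images of the members of an open cover of `V`;
that is, if its higher direct images vanish. -/
def IsLocallyAcyclic (F : TopCat.Sheaf AddCommGrpCat.{0} X) : Prop :=
  ∀ (n : ℕ) (V : Opens Y) (y : Y) (_ : y ∈ V)
    (ξ : Ext.{0} ((freeAb X).obj ((Opens.map f).obj V)) F (n + 1)),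
    ∃ (W : Opens Y) (h : W ≤ V), y ∈ W ∧ resCoh ((Opens.map f).map (homOfLE h)).le ξ = 0

variable {f}

lemma IsLocallyAcyclic.shortExact_map_pushforward
    {S : ShortComplex (TopCat.Sheaf AddCommGrpCat.{0} X)} (hS : S.ShortExact)
    (h₁ : IsLocallyAcyclic f S.X₁) :
    (S.map (TopCat.Sheaf.pushforward AddCommGrpCat.{0} f)).ShortExact := by
  have := hS.mono_f
  have hexact : (S.map (TopCat.Sheaf.pushforward AddCommGrpCat.{0} f)).Exact :=
    hS.exact.map_of_mono_of_preservesKernel _ hS.mono_f inferInstance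
  have hmono : Mono (S.map (TopCat.Sheaf.pushforward AddCommGrpCat.{0} f)).f :=
    inferInstanceAs (Mono ((TopCat.Sheaf.pushforward AddCommGrpCat.{0} f).map S.f))
  have hepi : Epi (S.map (TopCat.Sheaf.pushforward AddCommGrpCat.{0} f)).g := by
    apply (TopCat.Sheaf.isLocallySurjective_iff_epi _).1
    refine (TopCat.Presheaf.isLocallySurjective_iff _).2 fun V s y hy => ?_
    obtain ⟨g, hg⟩ := (freeAbHomEquiv ((Opens.map f).obj V) S.X₃).surjective s
    -- The obstruction to lifting the section `g` is a class of degree one, which vanishes locally.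
    obtain ⟨W, h, hyW, hW⟩ := h₁ 0 V y hy ((Ext.mk₀ g).comp hS.extClass (zero_add 1))
    rw [resCoh, Ext.mk₀_comp_mk₀_assoc] at hW
    obtain ⟨x, hx⟩ := Ext.covariant_sequence_exact₃ _ hS _ _ hW
    obtain ⟨t, rfl⟩ := (Ext.mk₀_bijective _ _).2 x
    rw [Ext.mk₀_comp_mk₀] at hx
    refine ⟨W, h, ⟨freeAbHomEquiv ((Opens.map f).obj W) S.X₂ t, ?_⟩, hyW⟩
    have e := congrArg (freeAbHomEquiv _ _) ((Ext.mk₀_bijective _ _).1 hx)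
    rw [freeAbHomEquiv_comp] at e
    refine e.trans ?_
    subst hg
    exact freeAbHomEquiv_map _ g
  exact { exact := hexact }

lemma IsLocallyAcyclic.of_shortExact
    {S : ShortComplex (TopCat.Sheaf AddCommGrpCat.{0} X)} (hS : S.ShortExact)
    (h₁ : IsLocallyAcyclic f S.X₁) (h₂ : Injective S.X₂) : IsLocallyAcyclic f S.X₃ := by
  intro n V y hy ξ
  obtain ⟨W, h, hyW, hW⟩ := h₁ (n + 1) V y hy (ξ.comp hS.extClass rfl)
  refine ⟨W, h, hyW, ?_⟩
  rw [resCoh, ← Ext.comp_assoc (h₁₂ := zero_add _) (h₂₃ := rfl) (h := by omega)] at hW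
  obtain ⟨x, hx⟩ := Ext.covariant_sequence_exact₃ _ hS _ _ hW
  rw [Ext.eq_zero_of_injective x, Ext.zero_comp] at hx
  exact hx.symm

/-- Precomposition with an isomorphism is bijective on `Ext`. -/
lemma bijective_mk₀_precomp_of_isIso {A : Type*} [Category* A] [Abelian A] [HasExt.{0} A]
    {Z Z' : A} (g : Z' ⟶ Z) [IsIso g] (F : A) (n : ℕ) :
    Function.Bijective ((Ext.mk₀ g).precomp F (zero_add n)) := by
  refine Function.bijective_iff_has_inverse.2
    ⟨(Ext.mk₀ (inv g)).precomp F (zero_add n), fun x => ?_, fun x => ?_⟩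
  · exact (Ext.mk₀_comp_mk₀_assoc _ _ _).trans (by simp)
  · exact (Ext.mk₀_comp_mk₀_assoc _ _ _).trans (by simp)

/-- The constant sheaf `ℤ`. -/
def constInt (X : TopCat.{0}) : TopCat.Sheaf AddCommGrpCat.{0} X :=
  (constantSheaf (Opens.grothendieckTopology X) AddCommGrpCat.{0}).obj (.of (ULift ℤ))

variable (f) in
/-- The inverse image of a constant sheaf is the constant sheaf: both functors are left adjoint to
taking global sections. -/
def constIntIso : (TopCat.Sheaf.pullback AddCommGrpCat.{0} f).obj (constInt Y) ≅ constInt X :=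
  (Adjunction.leftAdjointUniq
    ((constantSheafAdj (Opens.grothendieckTopology Y) AddCommGrpCat.{0}
      (T := (⊤ : Opens Y)) isTerminalTop).comp
      (TopCat.Sheaf.pullbackPushforwardAdjunction AddCommGrpCat.{0} f))
    (constantSheafAdj (Opens.grothendieckTopology X) AddCommGrpCat.{0}
      (T := (⊤ : Opens X)) isTerminalTop)).app (.of (ULift ℤ))

variable (f) in
/-- The comparison `H^n(Y, f_* F) → H^n(X, F)`. -/
def cohomologyComparisonHom (F : TopCat.Sheaf AddCommGrpCat.{0} X) (n : ℕ) :
    Ext.{0} (constInt Y) ((TopCat.Sheaf.pushforward AddCommGrpCat.{0} f).obj F) n →+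
    Ext.{0} (constInt X) F n :=
  ((Ext.mk₀ (constIntIso f).inv).precomp F (zero_add n)).comp
    (extComparison (TopCat.Sheaf.pullbackPushforwardAdjunction AddCommGrpCat.{0} f) _ F n)

variable (f) in
/-- The comparison `H^n(Y, f_* F) → H^n(X, F)`, as a natural transformation. -/
def cohomologyComparison (n : ℕ) :
    TopCat.Sheaf.pushforward AddCommGrpCat.{0} f ⋙ cohomology Y n ⟶ cohomology X n where
  app F :=
    let φ := AddCommGrpCat.ofHom (cohomologyComparisonHom f F n)
    φ
  naturality F G g := by
    ext x
    refine (congrArg (Ext.comp (Ext.mk₀ (constIntIso f).inv) · (zero_add n))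
      (extComparison_naturality
        (TopCat.Sheaf.pullbackPushforwardAdjunction AddCommGrpCat.{0} f) _ g n x)).trans ?_
    exact (Ext.comp_assoc_of_third_deg_zero _ _ _ _).symm

lemma IsLocallyAcyclic.isIso_cohomologyComparison_app
    {F : TopCat.Sheaf AddCommGrpCat.{0} X} (hF : IsLocallyAcyclic f F) (n : ℕ) :
    IsIso ((cohomologyComparison f n).app F) := by
  have h : Function.Bijective (cohomologyComparisonHom f F n) :=
    (bijective_mk₀_precomp_of_isIso _ F n).comp
      (extComparison_bijective _ (IsLocallyAcyclic f)
        (fun S hS h₁ h₂ => ⟨h₁.of_shortExact hS h₂, h₁.shortExact_map_pushforward hS⟩) _ hF n)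
  exact (ConcreteCategory.isIso_iff_bijective (AddCommGrpCat.ofHom
    (cohomologyComparisonHom f F n))).2 h

end LocallyAcyclic

/-! ### Direct images of quasi-coherent modules -/

section QuasiCoherent

open TopologicalSpace Opposite Abelian Limits

attribute [local instance] preservesFiniteLimits_toAbSheaf preservesFiniteColimits_toAbSheaf
  additive_pushforward

variable {X : Scheme.{0}} {Y : TopCat.{0}} (f : TopCat.of X ⟶ Y)

/-- Quasi-coherent modules are locally acyclic for a continuous map to a space that has arbitrarily
small open subsets with affine inverse image. -/
lemma isLocallyAcyclic_of_isQCoh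
    (hf : ∀ (V : Opens Y) (y : Y), y ∈ V →
      ∃ W ≤ V, y ∈ W ∧ IsAffineOpen (X := X) ((Opens.map f).obj W))
    {M : X.Modules} (hM : isQCoh X M) : IsLocallyAcyclic f ((toAbSheaf X).obj M) := by
  intro n V y hy ξ
  obtain ⟨W, h, hyW, hW⟩ := hf V y hy
  exact ⟨W, h, hyW, ext_eq_zero_of_isAffineOpen hM n hW _⟩

theorem shortExact_map_pushforward_of_isQCoh
    (hf : ∀ (V : Opens Y) (y : Y), y ∈ V →
      ∃ W ≤ V, y ∈ W ∧ IsAffineOpen (X := X) ((Opens.map f).obj W))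
    {S : ShortComplex X.Modules} (hS : S.ShortExact) (h₁ : isQCoh X S.X₁) :
    (S.map (toAbSheaf X ⋙ TopCat.Sheaf.pushforward AddCommGrpCat.{0} f)).ShortExact :=
  IsLocallyAcyclic.shortExact_map_pushforward (S := S.map (toAbSheaf X))
    (hS.map_of_exact (toAbSheaf X)) (isLocallyAcyclic_of_isQCoh f hf h₁)

theorem nonempty_cohomology_iso_of_isQCoh
    (hf : ∀ (V : Opens Y) (y : Y), y ∈ V →
      ∃ W ≤ V, y ∈ W ∧ IsAffineOpen (X := X) ((Opens.map f).obj W)) (n : ℕ) :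
    Nonempty ((isQCoh X).ι ⋙ toAbSheaf X ⋙ cohomology (TopCat.of X) n ≅
      (isQCoh X).ι ⋙ toAbSheaf X ⋙ TopCat.Sheaf.pushforward AddCommGrpCat.{0} f ⋙
        cohomology Y n) := by
  let α : (isQCoh X).ι ⋙ toAbSheaf X ⋙ TopCat.Sheaf.pushforward AddCommGrpCat.{0} f ⋙
      cohomology Y n ⟶ (isQCoh X).ι ⋙ toAbSheaf X ⋙ cohomology (TopCat.of X) n :=
    Functor.whiskerLeft (isQCoh X).ι (Functor.whiskerLeft (toAbSheaf X) (cohomologyComparison f n))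
  have (M : (isQCoh X).FullSubcategory) : IsIso (α.app M) :=
    (isLocallyAcyclic_of_isQCoh f hf M.property).isIso_cohomologyComparison_app n
  have := NatIso.isIso_of_isIso_app α
  exact ⟨(asIso α).symm⟩

end QuasiCoherent

/-! ### Smooth algebras of relative dimension one -/

section SmoothAlgebra

open Algebra IsLocalRing

variable {k B : Type} [Field k] [CommRing B] [Algebra k B]

/-- A standard smooth algebra of relative dimension one has a coordinate: a function `x` such that
`dx` is a basis of the module of differentials. -/
lemma exists_basis_kaehlerDifferential [Nontrivial B]
    [IsStandardSmoothOfRelativeDimension 1 k B] :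
    ∃ (x : B) (b : Module.Basis Unit B (Ω[B⁄k])), b () = KaehlerDifferential.D k B x := by
  obtain ⟨I, J, _, _, P, -⟩ := ‹IsStandardSmoothOfRelativeDimension 1 k B›.out
  have h := P.basisKaehler.mk_eq_rank
  rw [IsStandardSmoothOfRelativeDimension.rank_kaehlerDifferential 1, Nat.cast_one,
    Cardinal.lift_one, Cardinal.lift_eq_one, Cardinal.eq_one_iff_unique] at h
  obtain ⟨_, ⟨i⟩⟩ := h
  have := uniqueOfSubsingleton i
  refine ⟨P.val i, P.basisKaehler.reindex (Equiv.ofUnique _ _), ?_⟩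
  rw [Module.Basis.reindex_apply, ← P.basisKaehler_apply]
  exact congrArg _ (Subsingleton.elim _ _)

variable {x : B} {b : Module.Basis Unit B (Ω[B⁄k])}

lemma derivation_apply_eq {M : Type} [AddCommGroup M] [Module k M] [Module B M]
    [IsScalarTower k B M] (hb : b () = KaehlerDifferential.D k B x) (d : Derivation k B M) (f : B) :
    d f = b.coord () (KaehlerDifferential.D k B f) • d x := by
  have h : KaehlerDifferential.D k B f =
      b.coord () (KaehlerDifferential.D k B f) • KaehlerDifferential.D k B x := by
    rw [← hb]
    simpa using (b.sum_repr (KaehlerDifferential.D k B f)).symm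
  have := congrArg d.liftKaehlerDifferential h
  rwa [map_smul, Derivation.liftKaehlerDifferential_comp_D,
    Derivation.liftKaehlerDifferential_comp_D] at this

/-- At a rational point `ε`, the function `x - x(ε)` generates the maximal ideal modulo its square:
the derivation `f ↦ f - f(ε)` with values in the quotient kills `x`, so it is zero. -/
lemma ker_le_span_sup_sq (hb : b () = KaehlerDifferential.D k B x) (ε : B →ₐ[k] k) :
    RingHom.ker ε ≤ Ideal.span {x - algebraMap k B (ε x)} ⊔ RingHom.ker ε ^ 2 := by
  set I := Ideal.span {x - algebraMap k B (ε x)} ⊔ RingHom.ker ε ^ 2 with hI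
  let d : Derivation k B (B ⧸ I) := Derivation.mk'
    ((Ideal.Quotient.mkₐ k I).toLinearMap ∘ₗ
      (LinearMap.id - (Algebra.linearMap k B) ∘ₗ ε.toLinearMap)) (by
    intro f g
    have hm : (f - algebraMap k B (ε f)) * (g - algebraMap k B (ε g)) ∈ I := by
      refine Ideal.mem_sup_right ?_
      rw [pow_two]
      exact Ideal.mul_mem_mul (by simp [RingHom.mem_ker]) (by simp [RingHom.mem_ker])
    rw [← Ideal.Quotient.eq_zero_iff_mem] at hm
    simp only [LinearMap.comp_apply, LinearMap.sub_apply, LinearMap.id_apply,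
      AlgHom.toLinearMap_apply, Ideal.Quotient.mkₐ_eq_mk, Algebra.linearMap_apply,
      Algebra.smul_def, Ideal.Quotient.algebraMap_eq, ← map_mul, ← map_add]
    rw [← sub_eq_zero, ← map_sub, ← neg_eq_zero, ← map_neg, ← hm]
    congr 1
    simp only [map_mul]
    ring)
  intro f hf
  have h := derivation_apply_eq hb d f
  have hx : d x = 0 := by
    refine Ideal.Quotient.eq_zero_iff_mem.2 (Ideal.mem_sup_left ?_)
    exact Ideal.subset_span rfl
  rw [hx, smul_zero] at h
  have h' := Ideal.Quotient.eq_zero_iff_mem.1 h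
  rw [RingHom.mem_ker] at hf
  simpa [hf] using h'

/-- The local rings of a smooth algebra of relative dimension one at rational points are discrete
valuation rings. -/
theorem isDiscreteValuationRing_of_isLocalization [IsDomain B] [IsNoetherianRing B]
    (hb : b () = KaehlerDifferential.D k B x) (ε : B →ₐ[k] k) (S : Type) [CommRing S] [IsDomain S]
    [Algebra B S] [hm : (RingHom.ker ε).IsPrime] [IsLocalization.AtPrime S (RingHom.ker ε)] :
    IsDiscreteValuationRing S := by
  have := IsLocalization.AtPrime.isLocalRing S (RingHom.ker ε)
  have := IsLocalization.isNoetherianRing (RingHom.ker ε).primeCompl S inferInstance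
  have hmax : maximalIdeal S = (RingHom.ker ε).map (algebraMap B S) :=
    (IsLocalization.AtPrime.map_eq_maximalIdeal (RingHom.ker ε) S).symm
  set t : B := x - algebraMap k B (ε x) with ht
  have htm : t ∈ RingHom.ker ε := by simp [RingHom.mem_ker, ht]
  have hspan : maximalIdeal S = Ideal.span {algebraMap B S t} := by
    apply le_antisymm
    · refine Submodule.le_of_le_smul_of_le_jacobson_bot (I := maximalIdeal S)
        (IsNoetherian.noetherian _) (by rw [jacobson_eq_maximalIdeal _ bot_ne_top]) ?_
      conv_lhs => rw [hmax]
      refine (Ideal.map_mono (ker_le_span_sup_sq hb ε)).trans ?_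
      rw [Ideal.map_sup, Ideal.map_span, Set.image_singleton, Ideal.map_pow, ← hmax, pow_two]
      rfl
    · rw [Ideal.span_singleton_le_iff_mem, hmax]
      exact Ideal.mem_map_of_mem _ htm
  have hfield : ¬ IsField S := by
    rw [isField_iff_maximalIdeal_eq, hspan, Ideal.span_singleton_eq_bot]
    have hinj := IsLocalization.injective S (RingHom.ker ε).primeCompl_le_nonZeroDivisors
    rw [map_eq_zero_iff _ hinj]
    intro h0
    have h1 : KaehlerDifferential.D k B t = b () := by
      rw [ht, map_sub, Derivation.map_algebraMap, sub_zero, hb]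
    rw [h0, map_zero] at h1
    exact b.ne_zero () h1.symm
  have hprin : (maximalIdeal S).IsPrincipal := ⟨⟨_, hspan⟩⟩
  exact ((IsDiscreteValuationRing.TFAE S hfield).out 0 4).2 hprin

end SmoothAlgebra

/-! ### Local properties of curves -/

section Curve

open TopologicalSpace Opposite Limits

/-- The structure map `ℂ → Γ(X, U)` of a scheme over `ℂ`. -/
def constSection {X : Scheme.{0}} (s : X ⟶ Spec (.of ℂ)) (U : X.Opens) : ℂ →+* Γ(X, U) :=
  ((Scheme.ΓSpecIso (.of ℂ)).inv ≫ s.appLE ⊤ U le_top).hom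

variable {X : Scheme.{0}}

lemma map_constSection (s : X ⟶ Spec (.of ℂ)) {U V : X.Opens} (h : V ≤ U) (c : ℂ) :
    X.presheaf.map (homOfLE h).op (constSection s U c) = constSection s V c := by
  exact ConcreteCategory.congr_hom (s.appLE_map (U := ⊤) (V := U) (V' := V) le_top (homOfLE h).op)
    ((Scheme.ΓSpecIso (.of ℂ)).inv c)

lemma le_preimage_of_mem {p : Spec (.of ℂ) ⟶ X} {U : X.Opens}
    (h : p (IsLocalRing.closedPoint ℂ) ∈ U) : ⊤ ≤ p ⁻¹ᵁ U := by
  intro y _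
  rw [Subsingleton.elim y (IsLocalRing.closedPoint ℂ)]
  exact h

/-- The value of a function at a complex point. -/
def evalPoint (p : Spec (.of ℂ) ⟶ X) {U : X.Opens} (h : p (IsLocalRing.closedPoint ℂ) ∈ U) :
    Γ(X, U) →+* ℂ :=
  (p.appLE U ⊤ (le_preimage_of_mem h) ≫ (Scheme.ΓSpecIso (.of ℂ)).hom).hom

lemma evalPoint_ne_zero_iff (p : Spec (.of ℂ) ⟶ X) {U : X.Opens}
    (h : p (IsLocalRing.closedPoint ℂ) ∈ U) (f : Γ(X, U)) :
    evalPoint p h f ≠ 0 ↔ p (IsLocalRing.closedPoint ℂ) ∈ X.basicOpen f := by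
  have h1 : (Spec (.of ℂ)).basicOpen (p.appLE U ⊤ (le_preimage_of_mem h) f) =
      ⊤ ⊓ p ⁻¹ᵁ X.basicOpen f := Scheme.basicOpen_appLE _ _ _ _ _
  have h2 : IsLocalRing.closedPoint ℂ ∈
      (Spec (.of ℂ)).basicOpen (p.appLE U ⊤ (le_preimage_of_mem h) f) ↔
        p (IsLocalRing.closedPoint ℂ) ∈ X.basicOpen f := by
    rw [h1]
    exact ⟨fun h => h.2, fun h => ⟨trivial, h⟩⟩
  have h3 := basicOpen_eq_of_affine' (R := .of ℂ) (p.appLE U ⊤ (le_preimage_of_mem h) f)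
  refine Iff.trans ?_ ((SetLike.ext_iff.1 h3 (IsLocalRing.closedPoint ℂ)).symm.trans h2)
  refine Iff.not (b := _ ∈ IsLocalRing.maximalIdeal ℂ) ?_
  rw [IsLocalRing.maximalIdeal_eq_bot]
  rfl

lemma evalPoint_constSection (s : X ⟶ Spec (.of ℂ)) {p : Spec (.of ℂ) ⟶ X} (hp : p ≫ s = 𝟙 _)
    {U : X.Opens} (h : p (IsLocalRing.closedPoint ℂ) ∈ U) (c : ℂ) :
    evalPoint p h (constSection s U c) = c := by
  have h1 : s.appLE ⊤ U le_top ≫ p.appLE U ⊤ (le_preimage_of_mem h) = 𝟙 _ := by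
    have : ∀ (q : Spec (.of ℂ) ⟶ Spec (.of ℂ)) (e : ⊤ ≤ q ⁻¹ᵁ ⊤), q = 𝟙 _ →
        q.appLE ⊤ ⊤ e = 𝟙 _ := by
      rintro q e rfl
      simp [Scheme.Hom.appLE]
      rfl
    exact (Scheme.Hom.appLE_comp_appLE _ _ _ _ _ _ _).trans (this _ _ hp)
  have h2 := ConcreteCategory.congr_hom h1 ((Scheme.ΓSpecIso (.of ℂ)).inv c)
  have h3 := congrArg (Scheme.ΓSpecIso (.of ℂ)).hom h2
  refine h3.trans ?_
  exact ConcreteCategory.congr_hom (Scheme.ΓSpecIso (.of ℂ)).inv_hom_id c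

lemma exists_isStandardSmooth (s : X ⟶ Spec (.of ℂ)) [SmoothOfRelativeDimension 1 s] (x : X) :
    ∃ V : X.Opens, IsAffineOpen V ∧ x ∈ V ∧
      (constSection s V).IsStandardSmoothOfRelativeDimension 1 := by
  obtain ⟨U, hU, V, hV, hxV, e, h⟩ :=
    SmoothOfRelativeDimension.exists_isStandardSmoothOfRelativeDimension (n := 1) (f := s) x
  have hUt : U = ⊤ := by
    ext y
    rw [Subsingleton.elim y (s x)]
    simpa using e hxV
  subst hUt
  refine ⟨V, hV, hxV, ?_⟩
  exact RingHom.isStandardSmoothOfRelativeDimension_respectsIso.2 _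
    (Scheme.ΓSpecIso (.of ℂ)).symm.commRingCatIsoToRingEquiv h

lemma mem_primeIdealOf_iff {U : X.Opens} (hU : IsAffineOpen U) (x : U) (f : Γ(X, U)) :
    f ∈ (hU.primeIdealOf x).asIdeal ↔ (x : X) ∉ X.basicOpen f := by
  have h : (hU.primeIdealOf x : Spec Γ(X, U)) ∈ PrimeSpectrum.basicOpen f ↔
      (x : X) ∈ X.basicOpen f := by
    have h1 := hU.fromSpec_preimage_basicOpen f
    have h2 := hU.fromSpec_primeIdealOf x
    exact (SetLike.ext_iff.1 h1 (hU.primeIdealOf x)).symm.trans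
      (iff_of_eq (congrArg (· ∈ X.basicOpen f) h2))
  rw [← h]
  exact not_not.symm

/-- The local rings of a smooth curve over `ℂ` at closed points are discrete valuation rings. -/
theorem isDiscreteValuationRing_stalk [IsIntegral X] (s : X ⟶ Spec (.of ℂ))
    [SmoothOfRelativeDimension 1 s] {x : X} (hx : IsClosed {x}) :
    IsDiscreteValuationRing (X.presheaf.stalk x) := by
  obtain ⟨V, hV, hxV, hs⟩ := exists_isStandardSmooth s x
  have : LocallyOfFiniteType s := by
    have := SmoothOfRelativeDimension.smooth 1 s
    infer_instance
  let p := pointOfClosedPoint s x hx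
  have hpx : p (IsLocalRing.closedPoint ℂ) = x := pointOfClosedPoint_apply s x hx _
  have hpV : p (IsLocalRing.closedPoint ℂ) ∈ V := hpx ▸ hxV
  let : Algebra ℂ Γ(X, V) := (constSection s V).toAlgebra
  have : Algebra.IsStandardSmoothOfRelativeDimension 1 ℂ Γ(X, V) := hs
  have : Nonempty V := ⟨⟨x, hxV⟩⟩
  have := Algebra.IsStandardSmoothOfRelativeDimension.isStandardSmooth 1 (R := ℂ) (S := Γ(X, V))
  have : Algebra.FiniteType ℂ Γ(X, V) := inferInstance
  have : IsNoetherianRing Γ(X, V) := Algebra.FiniteType.isNoetherianRing ℂ _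
  let ε : Γ(X, V) →ₐ[ℂ] ℂ :=
    { evalPoint p hpV with
      commutes' := evalPoint_constSection s (pointOfClosedPoint_comp s x hx) hpV }
  have hker : RingHom.ker ε = (hV.primeIdealOf ⟨x, hxV⟩).asIdeal := by
    ext f
    have h := evalPoint_ne_zero_iff p hpV f
    rw [hpx] at h
    exact (not_not.symm.trans (not_congr h)).trans (mem_primeIdealOf_iff hV ⟨x, hxV⟩ f).symm
  obtain ⟨y, b, hb⟩ := exists_basis_kaehlerDifferential (k := ℂ) (B := Γ(X, V))
  let : Algebra Γ(X, V) (X.presheaf.stalk x) :=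
    TopCat.Presheaf.algebra_section_stalk X.presheaf (⟨x, hxV⟩ : V)
  have hloc : IsLocalization.AtPrime (X.presheaf.stalk x) (hV.primeIdealOf ⟨x, hxV⟩).asIdeal :=
    hV.isLocalization_stalk ⟨x, hxV⟩
  have hprime : (RingHom.ker ε).IsPrime := RingHom.ker_isPrime _
  have : IsLocalization.AtPrime (X.presheaf.stalk x) (RingHom.ker ε) := by
    convert hloc
  exact isDiscreteValuationRing_of_isLocalization hb ε _

lemma isClosed_singleton_of_ne_genericPoint [IsIntegral X] (s : X ⟶ Spec (.of ℂ))
    [SmoothOfRelativeDimension 1 s] {x : X} (hx : x ≠ genericPoint X) : IsClosed {x} := by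
  have : LocallyOfFiniteType s := by
    have := SmoothOfRelativeDimension.smooth 1 s
    infer_instance
  have : JacobsonSpace X := LocallyOfFiniteType.jacobsonSpace s
  obtain ⟨y, hxy, hy⟩ := nonempty_inter_closedPoints (X := X)
    (Z := closure {x}) ⟨x, subset_closure rfl⟩ isClosed_closure.isLocallyClosed
  have hy' := isDiscreteValuationRing_stalk s hy
  rw [← specializes_iff_mem_closure] at hxy
  have hgen : genericPoint X ⤳ y := (genericPoint_spec X).specializes trivial
  -- The points specializing to `y` are the prime ideals of the local ring at `y`.
  obtain ⟨q, hq⟩ := (Scheme.range_fromSpecStalk (X := X) (x := y)).ge hxy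
  obtain ⟨q', hq'⟩ := (Scheme.range_fromSpecStalk (X := X) (x := y)).ge hgen
  have hbot : X.fromSpecStalk y (⊥ : PrimeSpectrum (X.presheaf.stalk y)) = genericPoint X := by
    refine (Specializes.antisymm ((genericPoint_spec X).specializes trivial) ?_).eq.symm
    rw [← hq']
    exact ((PrimeSpectrum.le_iff_specializes (⊥ : PrimeSpectrum (X.presheaf.stalk y)) q').1
      bot_le).map (X.fromSpecStalk y).continuous
  have hq0 : q.asIdeal ≠ ⊥ := by
    intro h
    apply hx
    rw [← hq, ← hbot]
    exact congrArg _ (PrimeSpectrum.ext h)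
  have hqm : q = IsLocalRing.closedPoint _ :=
    PrimeSpectrum.ext (IsLocalRing.eq_maximalIdeal (q.isPrime.isMaximal hq0))
  rw [hqm, Scheme.fromSpecStalk_closedPoint] at hq
  exact hq ▸ hy

lemma finite_of_isClosed [IsIntegral X] (s : X ⟶ Spec (.of ℂ)) [QuasiCompact s]
    [SmoothOfRelativeDimension 1 s] {Z : Set X} (hZ : IsClosed Z) (hZ' : Z ≠ Set.univ) :
    Z.Finite := by
  have : LocallyOfFiniteType s := by
    have := SmoothOfRelativeDimension.smooth 1 s
    infer_instance
  have := LocallyOfFiniteType.isLocallyNoetherian s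
  have : CompactSpace X := QuasiCompact.compactSpace_of_compactSpace s
  have : IsNoetherian X := {}
  obtain ⟨S, hS, hSc, hSi, rfl⟩ :=
    TopologicalSpace.NoetherianSpace.exists_finite_set_isClosed_irreducible hZ
  refine hS.sUnion fun T hT => ?_
  obtain ⟨x, hx⟩ := QuasiSober.sober (hSi T hT) (hSc T hT)
  have hne : x ≠ genericPoint X := by
    rintro rfl
    apply hZ'
    rw [← Set.univ_subset_iff, ← (genericPoint_spec X).def, hx.def]
    exact Set.subset_sUnion_of_mem hT
  rw [← hx.def, (isClosed_singleton_of_ne_genericPoint s hne).closure_eq]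
  exact Set.finite_singleton x

end Curve

/-! ### The function field of a curve and its valuations -/

section FunctionField

open TopologicalSpace Opposite Limits

variable {X : Scheme.{0}} [IsIntegral X] (s : X ⟶ Spec (.of ℂ))

lemma genericPoint_mem {U : X.Opens} {x : X} (hx : x ∈ U) : genericPoint X ∈ U :=
  ((genericPoint_spec X).mem_open_set_iff U.isOpen).2 ⟨x, trivial, hx⟩

/-- The rational function defined by a function on an open subset that contains the point `x`. -/
def toFF {U : X.Opens} {x : X} (hx : x ∈ U) : Γ(X, U) →+* X.functionField :=
  (X.presheaf.germ U (genericPoint X) (genericPoint_mem hx)).hom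

lemma toFF_injective {U : X.Opens} {x : X} (hx : x ∈ U) : Function.Injective (toFF hx) :=
  germ_injective_of_isIntegral X (genericPoint X) (genericPoint_mem hx)

lemma toFF_map {U V : X.Opens} (h : V ≤ U) {x y : X} (hx : x ∈ U) (hy : y ∈ V) (f : Γ(X, U)) :
    toFF hy (X.presheaf.map (homOfLE h).op f) = toFF hx f :=
  X.presheaf.germ_res_apply (homOfLE h) (genericPoint X) (genericPoint_mem hy) f

lemma toFF_eq_algebraMap {U : X.Opens} {x : X} (hx : x ∈ U) (f : Γ(X, U)) {y : X} (hy : y ∈ U) :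
    toFF hx f = algebraMap (X.presheaf.stalk y) X.functionField (X.presheaf.germ U y hy f) :=
  (ConcreteCategory.congr_hom (X.presheaf.germ_stalkSpecializes hy
    ((genericPoint_spec X).specializes trivial)) f).symm

lemma valuationRing_stalk [SmoothOfRelativeDimension 1 s] (x : X) :
    ValuationRing (X.presheaf.stalk x) := by
  by_cases hx : x = genericPoint X
  · subst hx
    exact inferInstanceAs (ValuationRing X.functionField)
  · have := isDiscreteValuationRing_stalk s (isClosed_singleton_of_ne_genericPoint s hx)
    infer_instance

variable [SmoothOfRelativeDimension 1 s]

/-- The local ring at `x`, as a valuation subring of the function field. -/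
def localRing (x : X) : ValuationSubring X.functionField :=
  .ofSubring (algebraMap (X.presheaf.stalk x) X.functionField).range fun g => by
    have := valuationRing_stalk s x
    exact ValuationRing.isInteger_or_isInteger (X.presheaf.stalk x) g

/-- The valuation of the function field attached to a point (written multiplicatively: it is `≤ 1`
on the rational functions that are regular at the point). -/
def val (x : X) : Valuation X.functionField (localRing s x).ValueGroup :=
  (localRing s x).valuation

lemma val_le_one_iff {x : X} {g : X.functionField} :
    val s x g ≤ 1 ↔ ∃ a, algebraMap (X.presheaf.stalk x) X.functionField a = g :=
  (localRing s x).valuation_le_one_iff g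

lemma val_algebraMap_eq_one_iff {x : X} (a : X.presheaf.stalk x) :
    val s x (algebraMap _ _ a) = 1 ↔ IsUnit a := by
  let e : X.presheaf.stalk x ≃+* localRing s x :=
    RingEquiv.ofBijective (algebraMap (X.presheaf.stalk x) X.functionField).rangeRestrict
      ⟨fun a b h => IsFractionRing.injective (X.presheaf.stalk x) X.functionField
        (congrArg Subtype.val h), RingHom.rangeRestrict_surjective _⟩
  have h := (localRing s x).valuation_eq_one_iff (e a)
  rw [MulEquiv.isUnit_map] at h
  exact h.symm

lemma val_toFF_le_one {U : X.Opens} {x y : X} (hx : x ∈ U) (hy : y ∈ U) (f : Γ(X, U)) :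
    val s y (toFF hx f) ≤ 1 :=
  (val_le_one_iff s).2 ⟨_, (toFF_eq_algebraMap hx f hy).symm⟩

lemma val_toFF_eq_one_iff {U : X.Opens} {x y : X} (hx : x ∈ U) (hy : y ∈ U) (f : Γ(X, U)) :
    val s y (toFF hx f) = 1 ↔ y ∈ X.basicOpen f := by
  rw [toFF_eq_algebraMap hx f hy, val_algebraMap_eq_one_iff, Scheme.mem_basicOpen _ _ _ hy]

lemma val_toFF_lt_one_iff {U : X.Opens} {x y : X} (hx : x ∈ U) (hy : y ∈ U) (f : Γ(X, U)) :
    val s y (toFF hx f) < 1 ↔ y ∉ X.basicOpen f := by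
  rw [← val_toFF_eq_one_iff s hx hy, lt_iff_le_and_ne]
  exact and_iff_right (val_toFF_le_one s hx hy f)

lemma exists_toFF_eq_of_val_le_one {x : X} {g : X.functionField} (h : val s x g ≤ 1) :
    ∃ (U : X.Opens) (hx : x ∈ U) (f : Γ(X, U)), toFF hx f = g := by
  obtain ⟨a, rfl⟩ := (val_le_one_iff s).1 h
  obtain ⟨U, hx, f, rfl⟩ := X.presheaf.exists_germ_eq a
  exact ⟨U, hx, f, toFF_eq_algebraMap hx f hx⟩

/-- A rational function that is regular at all points of an open subset is a function on it. -/
lemma exists_toFF_eq {U : X.Opens} {x : X} (hx : x ∈ U) {g : X.functionField}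
    (h : ∀ y ∈ U, val s y g ≤ 1) : ∃ f : Γ(X, U), toFF hx f = g := by
  choose V hV f hf using fun y : U => exists_toFF_eq_of_val_le_one s (h y y.2)
  let W : U → X.Opens := fun y => U ⊓ V y
  have hW : ∀ y : U, (y : X) ∈ W y := fun y => ⟨y.2, hV y⟩
  let f' : ∀ y : U, Γ(X, W y) := fun y => X.presheaf.map (homOfLE inf_le_right).op (f y)
  have hf' (y : U) : toFF (hW y) (f' y) = g := (toFF_map inf_le_right (hV y) (hW y) _).trans (hf y)
  obtain ⟨t, ht, -⟩ := X.sheaf.existsUnique_gluing' W U (fun y => homOfLE inf_le_left)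
    (fun y hy => Opens.mem_iSup.2 ⟨⟨y, hy⟩, hW ⟨y, hy⟩⟩) f' (by
      intro y z
      have hx' : genericPoint X ∈ W y ⊓ W z :=
        ⟨genericPoint_mem (hW y), genericPoint_mem (hW z)⟩
      apply toFF_injective hx'
      exact ((toFF_map inf_le_left (hW y) hx' _).trans (hf' y)).trans
        ((toFF_map inf_le_right (hW z) hx' _).trans (hf' z)).symm)
  refine ⟨t, ?_⟩
  rw [← hf' ⟨x, hx⟩, ← ht ⟨x, hx⟩]
  exact (toFF_map inf_le_left hx _ t).symm

lemma isOpen_setOf_val_le_one (g : X.functionField) : IsOpen {x | val s x g ≤ 1} := by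
  refine isOpen_iff_forall_mem_open.2 fun x hx => ?_
  obtain ⟨U, hxU, f, rfl⟩ := exists_toFF_eq_of_val_le_one s hx
  exact ⟨U, fun y hy => val_toFF_le_one s hxU hy f, U.isOpen, hxU⟩

lemma val_genericPoint_le_one (g : X.functionField) : val s (genericPoint X) g ≤ 1 :=
  (val_le_one_iff s).2 ⟨g, by simp [RingHom.algebraMap_toAlgebra]⟩

lemma ne_genericPoint_of_one_lt_val {x : X} {g : X.functionField} (h : 1 < val s x g) :
    x ≠ genericPoint X := by
  rintro rfl
  exact absurd (val_genericPoint_le_one s g) (not_le.2 h)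

lemma isClosed_singleton_of_one_lt_val {x : X} {g : X.functionField} (h : 1 < val s x g) :
    IsClosed {x} :=
  isClosed_singleton_of_ne_genericPoint s (ne_genericPoint_of_one_lt_val s h)

lemma finite_setOf_one_lt_val [QuasiCompact s] (g : X.functionField) :
    {x | 1 < val s x g}.Finite := by
  refine finite_of_isClosed s ?_ ?_
  · have := (isOpen_setOf_val_le_one s g).isClosed_compl
    simpa [Set.compl_ofPred] using this
  · intro h
    exact ne_genericPoint_of_one_lt_val s (h.ge trivial : 1 < val s (genericPoint X) g) rfl

/-- The constants in the function field. -/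
def constFF : ℂ →+* X.functionField :=
  (toFF (U := ⊤) (x := genericPoint X) trivial).comp (constSection s ⊤)

omit [SmoothOfRelativeDimension 1 s] in
lemma toFF_constSection {U : X.Opens} {x : X} (hx : x ∈ U) (c : ℂ) :
    toFF hx (constSection s U c) = constFF s c := by
  rw [← map_constSection s le_top]
  exact toFF_map _ _ _ _

lemma val_constFF (x : X) {c : ℂ} (hc : c ≠ 0) : val s x (constFF s c) = 1 := by
  have hx : x ∈ (⊤ : X.Opens) := trivial
  rw [← toFF_constSection s hx, val_toFF_eq_one_iff s hx hx,
    Scheme.basicOpen_of_isUnit _ ((isUnit_iff_ne_zero.2 hc).map _)]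
  trivial

lemma val_constFF_le_one (x : X) (c : ℂ) : val s x (constFF s c) ≤ 1 := by
  by_cases hc : c = 0
  · simp [hc]
  · exact (val_constFF s x hc).le

/-- The residue field at a closed point is `ℂ`. -/
lemma exists_val_sub_constFF_lt_one {x : X} (hx : IsClosed {x}) {g : X.functionField}
    (h : val s x g ≤ 1) : ∃ c : ℂ, val s x (g - constFF s c) < 1 := by
  have : LocallyOfFiniteType s := by
    have := SmoothOfRelativeDimension.smooth 1 s
    infer_instance
  obtain ⟨U, hxU, f, rfl⟩ := exists_toFF_eq_of_val_le_one s h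
  obtain ⟨p, hps, hpx⟩ : ∃ p : Spec (.of ℂ) ⟶ X, p ≫ s = 𝟙 _ ∧
      p (IsLocalRing.closedPoint ℂ) = x :=
    ⟨pointOfClosedPoint s x hx, pointOfClosedPoint_comp s x hx, pointOfClosedPoint_apply s x hx _⟩
  subst hpx
  refine ⟨evalPoint p hxU f, ?_⟩
  rw [← toFF_constSection s hxU, ← map_sub, val_toFF_lt_one_iff s hxU hxU,
    ← evalPoint_ne_zero_iff p hxU, not_not, map_sub, evalPoint_constSection s hps, sub_self]

/-- A uniformizing parameter at a closed point. -/
lemma exists_uniformizer {x : X} (hx : IsClosed {x}) :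
    ∃ t : X.functionField, t ≠ 0 ∧ val s x t < 1 ∧
      ∀ g, val s x g < 1 → ∃ h, val s x h ≤ 1 ∧ g = t * h := by
  have := isDiscreteValuationRing_stalk s hx
  obtain ⟨t, ht⟩ := IsDiscreteValuationRing.exists_irreducible (X.presheaf.stalk x)
  refine ⟨algebraMap _ _ t, ?_, ?_, fun g hg => ?_⟩
  · exact (map_ne_zero_iff _ (IsFractionRing.injective (X.presheaf.stalk x) X.functionField)).2
      ht.ne_zero
  · exact lt_of_le_of_ne ((val_le_one_iff s).2 ⟨t, rfl⟩)
      fun h => ht.not_isUnit ((val_algebraMap_eq_one_iff s t).1 h)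
  · obtain ⟨a, rfl⟩ := (val_le_one_iff s).1 hg.le
    have ha : a ∈ IsLocalRing.maximalIdeal (X.presheaf.stalk x) :=
      fun hu => hg.ne ((val_algebraMap_eq_one_iff s a).2 hu)
    rw [ht.maximalIdeal_eq, Ideal.mem_span_singleton] at ha
    obtain ⟨b, rfl⟩ := ha
    exact ⟨algebraMap _ _ b, (val_le_one_iff s).2 ⟨b, rfl⟩, map_mul _ _ _⟩

/-- The valuation at a closed point is discrete: the powers of a rational function with a zero
cancel any pole. -/
lemma exists_val_mul_pow_le_one {x : X} (hx : IsClosed {x}) {g : X.functionField}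
    (hg : val s x g < 1) (h : X.functionField) :
    ∃ N : ℕ, ∀ n, N ≤ n → val s x (h * g ^ n) ≤ 1 := by
  have := isDiscreteValuationRing_stalk s hx
  obtain ⟨t, ht⟩ := IsDiscreteValuationRing.exists_irreducible (X.presheaf.stalk x)
  obtain ⟨a, b, hb, rfl⟩ := IsFractionRing.div_surjective (X.presheaf.stalk x) h
  obtain ⟨N, u, hu⟩ := IsDiscreteValuationRing.associated_pow_irreducible
    (nonZeroDivisors.ne_zero hb) ht
  have htval : val s x (algebraMap (X.presheaf.stalk x) _ t) ≠ 0 := by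
    rw [Valuation.ne_zero_iff]
    exact (map_ne_zero_iff _ (IsFractionRing.injective (X.presheaf.stalk x) X.functionField)).2
      ht.ne_zero
  have hgt : val s x g ≤ val s x (algebraMap (X.presheaf.stalk x) _ t) := by
    obtain ⟨c, rfl⟩ := (val_le_one_iff s).1 hg.le
    have hc : c ∈ IsLocalRing.maximalIdeal (X.presheaf.stalk x) :=
      fun hu => hg.ne ((val_algebraMap_eq_one_iff s c).2 hu)
    rw [ht.maximalIdeal_eq, Ideal.mem_span_singleton] at hc
    obtain ⟨d, rfl⟩ := hc
    rw [map_mul, map_mul]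
    exact mul_le_of_le_one_right' ((val_le_one_iff s).2 ⟨d, rfl⟩)
  have hbval : val s x (algebraMap (X.presheaf.stalk x) _ b) =
      val s x (algebraMap (X.presheaf.stalk x) _ t) ^ N := by
    rw [← map_pow, ← map_pow, ← hu, map_mul, map_mul,
      (val_algebraMap_eq_one_iff s (u : X.presheaf.stalk x)).2 u.isUnit, _root_.mul_one]
  refine ⟨N, fun n hn => ?_⟩
  rw [map_mul, map_pow, map_div₀, hbval, div_mul_eq_mul_div]
  refine div_le_one_of_le₀ ?_ zero_le
  calc val s x (algebraMap (X.presheaf.stalk x) _ a) * val s x g ^ n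
      ≤ 1 * val s x g ^ n := by
        gcongr
        exact (val_le_one_iff s).2 ⟨a, rfl⟩
    _ = val s x g ^ n := _root_.one_mul _
    _ ≤ val s x g ^ N := pow_le_pow_right_of_le_one' hg.le hn
    _ ≤ _ := by gcongr

omit [SmoothOfRelativeDimension 1 s] in
lemma exists_isClosed_singleton [LocallyOfFiniteType s] : ∃ x : X, IsClosed {x} := by
  have : JacobsonSpace X := LocallyOfFiniteType.jacobsonSpace s
  obtain ⟨x, -, hx⟩ := nonempty_inter_closedPoints (X := X) (Z := Set.univ)
    ⟨genericPoint X, trivial⟩ isClosed_univ.isLocallyClosed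
  exact ⟨x, hx⟩

/-- Global functions are constant. -/
lemma exists_eq_constFF [IsProper s] {g : X.functionField} (h : ∀ x, val s x g ≤ 1) :
    ∃ c : ℂ, g = constFF s c := by
  obtain ⟨x, hx⟩ := exists_isClosed_singleton s
  obtain ⟨c, hc⟩ := exists_val_sub_constFF_lt_one s hx (h x)
  refine ⟨c, ?_⟩
  obtain ⟨f, rfl⟩ := exists_toFF_eq s (U := ⊤) (x := x) trivial fun y _ => h y
  have hx' : x ∈ (⊤ : X.Opens) := trivial
  rw [← toFF_constSection s hx', ← map_sub, val_toFF_lt_one_iff s hx' hx'] at hc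
  rw [← toFF_constSection s hx']
  congr 1
  rw [← sub_eq_zero]
  by_contra hne
  apply hc
  rw [Scheme.basicOpen_of_isUnit]
  · trivial
  · let := (isField_of_universallyClosed ℂ s).toField
    exact isUnit_iff_ne_zero.2 hne

end FunctionField

/-! ### Rational functions as finite maps to the affine line -/

section AffineLine

open TopologicalSpace Opposite Limits Polynomial

variable {X : Scheme.{0}} (s : X ⟶ Spec (.of ℂ))

/-- The ring homomorphism `ℂ[T] → Γ(X, U)` sending `T` to a function `f`. -/
def polyHom {U : X.Opens} (f : Γ(X, U)) : ℂ[X] →+* Γ(X, U) :=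
  eval₂RingHom (constSection s U) f

/-- The morphism `U ⟶ 𝔸¹` defined by a function `f` on `U`. -/
def toLine {U : X.Opens} (f : Γ(X, U)) : U.toScheme ⟶ Spec (.of ℂ[X]) :=
  U.toSpecΓ ≫ Spec.map (CommRingCat.ofHom (polyHom s f))

lemma toSpecΓ_SpecMap_constSection (U : X.Opens) :
    U.toSpecΓ ≫ Spec.map (CommRingCat.ofHom (constSection s U)) = U.ι ≫ s := by
  have h : CommRingCat.ofHom (constSection s U) =
      (Scheme.ΓSpecIso (.of ℂ)).inv ≫ s.appLE ⊤ U le_top := rfl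
  have h1 : U.toSpecΓ ≫ Spec.map (s.appLE ⊤ U le_top) =
      s.resLE ⊤ U le_top ≫ Scheme.Opens.toSpecΓ ⊤ := Scheme.Opens.toSpecΓ_SpecMap_appLE _ _ _ _
  have h2 : s.resLE ⊤ U le_top ≫ Scheme.Opens.ι ⊤ = U.ι ≫ s := Scheme.Hom.resLE_comp_ι _ _
  rw [h, Spec.map_comp]
  refine (Category.assoc _ _ _).symm.trans ((congrArg (· ≫ _) h1).trans ?_)
  rw [Scheme.Opens.toSpecΓ_top, Category.assoc, Category.assoc, toSpecΓ_SpecMap_ΓSpecIso_inv,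
    Category.comp_id]
  exact h2

lemma toLine_comp {U : X.Opens} (f : Γ(X, U)) :
    toLine s f ≫ Spec.map (CommRingCat.ofHom C) = U.ι ≫ s := by
  have h : CommRingCat.ofHom C ≫ CommRingCat.ofHom (polyHom s f) =
      CommRingCat.ofHom (constSection s U) := by
    ext c
    simp [polyHom]
  rw [toLine, Category.assoc, ← Spec.map_comp, h, toSpecΓ_SpecMap_constSection]

/-- The pullback of `f` along a morphism to `U`, in terms of the coordinate of the affine line. -/
lemma appTop_comp_toLine {U : X.Opens} (f : Γ(X, U)) {T : Scheme.{0}} (i : T ⟶ U.toScheme)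
    (h : ⊤ ≤ (i ≫ U.ι) ⁻¹ᵁ U) :
    (i ≫ toLine s f).appTop ((Scheme.ΓSpecIso (.of ℂ[X])).inv Polynomial.X) =
      (i ≫ U.ι).appLE U ⊤ h f := by
  have h1 : (Spec.map (CommRingCat.ofHom (polyHom s f))).appTop
      ((Scheme.ΓSpecIso (.of ℂ[X])).inv Polynomial.X) = (Scheme.ΓSpecIso Γ(X, U)).inv f := by
    refine (ConcreteCategory.congr_hom (Scheme.ΓSpecIso_inv_naturality
      (CommRingCat.ofHom (polyHom s f))) Polynomial.X).symm.trans ?_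
    exact congrArg (Scheme.ΓSpecIso Γ(X, U)).inv (eval₂_X _ _)
  have h2 : U.toSpecΓ.appTop ((Scheme.ΓSpecIso Γ(X, U)).inv f) = U.topIso.inv f := by
    rw [Scheme.Opens.toSpecΓ_appTop]
    exact congrArg U.topIso.inv (ConcreteCategory.congr_hom (Scheme.ΓSpecIso Γ(X, U)).inv_hom_id f)
  have h3 : U.ι.appLE U ⊤ (by simp) ≫ i.appLE ⊤ ⊤ le_top = (i ≫ U.ι).appLE U ⊤ h :=
    Scheme.Hom.appLE_comp_appLE _ _ _ _ _ _ _
  rw [← h3, toLine]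
  refine (congrArg i.appTop ((congrArg U.toSpecΓ.appTop h1).trans h2)).trans ?_
  have h4 : i.appLE ⊤ ⊤ le_top = i.appTop := (Scheme.Hom.app_eq_appLE (f := i) (U := ⊤)).symm
  have h5 : U.ι.appLE U ⊤ (by simp) = U.topIso.inv := by
    simp [Scheme.Opens.ι_appLE]
    rfl
  rw [h5, h4]
  rfl

lemma mem_asIdeal_toLine_iff {U : X.Opens} (f : Γ(X, U)) (u : U.toScheme) (q : ℂ[X]) :
    q ∈ PrimeSpectrum.asIdeal (toLine s f u) ↔ U.ι u ∉ X.basicOpen (polyHom s f q) := by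
  have h := SetLike.ext_iff.1 (Scheme.Opens.toSpecΓ_preimage_basicOpen U (polyHom s f q)) u
  rw [← not_iff_not, not_not]
  exact h

variable [IsIntegral X] [SmoothOfRelativeDimension 1 s]

/-- The open subset of points where a rational function is regular. -/
def regularLocus (g : X.functionField) : X.Opens :=
  ⟨{x | val s x g ≤ 1}, isOpen_setOf_val_le_one s g⟩

lemma genericPoint_mem_regularLocus (g : X.functionField) : genericPoint X ∈ regularLocus s g :=
  val_genericPoint_le_one s g

/-- A rational function, as a function on the open subset of points where it is regular. -/
def regularFun (g : X.functionField) : Γ(X, regularLocus s g) :=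
  (exists_toFF_eq s (genericPoint_mem_regularLocus s g) fun _ h => h).choose

lemma toFF_regularFun (g : X.functionField) {x : X} (hx : x ∈ regularLocus s g) :
    toFF hx (regularFun s g) = g :=
  (exists_toFF_eq s (genericPoint_mem_regularLocus s g) fun _ h => h).choose_spec

variable [IsProper s]

omit [IsProper s] in
/-- A morphism from the spectrum of a valuation ring to the curve whose generic point is in the
regular locus of `g`, and along which `g` is integral, has its image in the regular locus. -/
lemma closedPoint_mem_regularLocus (g : X.functionField) {R K : Type} [CommRing R] [IsDomain R]
    [ValuationRing R] [Field K] [Algebra R K] [IsFractionRing R K] (l : Spec (.of R) ⟶ X)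
    (h : ⊤ ≤ (Spec.map (CommRingCat.ofHom (algebraMap R K)) ≫ l) ⁻¹ᵁ regularLocus s g)
    (r : Γ(Spec (.of R), ⊤))
    (hr : (Spec.map (CommRingCat.ofHom (algebraMap R K))).appTop r =
      (Spec.map (CommRingCat.ofHom (algebraMap R K)) ≫ l).appLE _ ⊤ h (regularFun s g)) :
    l (IsLocalRing.closedPoint R) ∈ regularLocus s g := by
  set x := l (IsLocalRing.closedPoint R) with hx
  set j := Spec.map (CommRingCat.ofHom (algebraMap R K)) with hj
  by_contra hxU
  have hlt : val s x g⁻¹ < 1 := by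
    rw [map_inv₀]
    exact inv_lt_one_of_one_lt₀ (not_le.1 hxU)
  have hg : g ≠ 0 := by
    rintro rfl
    exact hxU (by simp [regularLocus])
  obtain ⟨V, hxV, a, ha⟩ := exists_toFF_eq_of_val_le_one s hlt.le
  have hlV : ⊤ ≤ l ⁻¹ᵁ V := by
    intro y _
    exact ((IsLocalRing.specializes_closedPoint y).map l.continuous).mem_open V.isOpen hxV
  have hnu : ¬ IsUnit (l.appLE V ⊤ hlV a) := by
    intro hu
    rw [← ha, val_toFF_lt_one_iff s hxV hxV] at hlt
    have h1 : (Spec (.of R)).basicOpen (l.appLE V ⊤ hlV a) = ⊤ ⊓ l ⁻¹ᵁ X.basicOpen a :=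
      Scheme.basicOpen_appLE _ _ _ _ _
    rw [Scheme.basicOpen_of_isUnit _ hu] at h1
    exact hlt ((SetLike.ext_iff.1 h1 (IsLocalRing.closedPoint R)).1 trivial).2
  have hinj : Function.Injective j.appTop := by
    have h1 : (Scheme.ΓSpecIso (.of R)).inv ≫ j.appTop =
        CommRingCat.ofHom (algebraMap R K) ≫ (Scheme.ΓSpecIso (.of K)).inv :=
      (Scheme.ΓSpecIso_inv_naturality _).symm
    have h2 : j.appTop = (Scheme.ΓSpecIso (.of R)).hom ≫
        CommRingCat.ofHom (algebraMap R K) ≫ (Scheme.ΓSpecIso (.of K)).inv := by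
      rw [← h1, Iso.hom_inv_id_assoc]
    rw [h2]
    exact ((ConcreteCategory.bijective_of_isIso (Scheme.ΓSpecIso (.of K)).inv).1.comp
      (IsFractionRing.injective R K)).comp
      (ConcreteCategory.bijective_of_isIso (Scheme.ΓSpecIso (.of R)).hom).1
  have hjV : ⊤ ≤ (j ≫ l) ⁻¹ᵁ V := fun y _ => hlV (x := j y) trivial
  have hja : j.appTop (l.appLE V ⊤ hlV a) = (j ≫ l).appLE V ⊤ hjV a := by
    have h1 : l.appLE V ⊤ hlV ≫ j.appLE ⊤ ⊤ le_top = (j ≫ l).appLE V ⊤ hjV :=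
      Scheme.Hom.appLE_comp_appLE _ _ _ _ _ _ _
    rw [← h1]
    have h4 : j.appLE ⊤ ⊤ le_top = j.appTop := (Scheme.Hom.app_eq_appLE (f := j) (U := ⊤)).symm
    rw [h4]
    rfl
  have hW : ⊤ ≤ (j ≫ l) ⁻¹ᵁ (regularLocus s g ⊓ V) := fun y hy => ⟨h hy, hjV hy⟩
  have hgen : genericPoint X ∈ regularLocus s g ⊓ V :=
    ⟨genericPoint_mem_regularLocus s g, genericPoint_mem hxV⟩
  have hprod : X.presheaf.map (homOfLE inf_le_left).op (regularFun s g) *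
      X.presheaf.map (homOfLE inf_le_right).op a = (1 : Γ(X, regularLocus s g ⊓ V)) := by
    apply toFF_injective hgen
    have h1 := toFF_map inf_le_left (genericPoint_mem_regularLocus s g) hgen (regularFun s g)
    have h2 := toFF_map inf_le_right hxV hgen a
    rw [map_mul, map_one, h1, h2, ha, toFF_regularFun, mul_inv_cancel₀ hg]
  apply hnu
  refine IsUnit.of_mul_eq_one r (hinj ?_)
  rw [map_mul, map_one, hr, hja, mul_comm]
  have h1 := congrArg ((j ≫ l).appLE _ ⊤ hW) hprod
  rw [map_mul, map_one] at h1
  refine Eq.trans (congrArg₂ _ ?_ ?_) h1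
  · exact (ConcreteCategory.congr_hom ((j ≫ l).map_appLE hW (homOfLE inf_le_left).op)
      (regularFun s g)).symm
  · exact (ConcreteCategory.congr_hom ((j ≫ l).map_appLE hW (homOfLE inf_le_right).op) a).symm

/-- A morphism from an integral affine scheme to an affine scheme is determined by its restriction
to the generic point. -/
lemma eq_of_SpecMap_comp_eq {A : CommRingCat.{0}} {R K : Type} [CommRing R] [IsDomain R] [Field K]
    [Algebra R K] [IsFractionRing R K] {u v : Spec (.of R) ⟶ Spec A}
    (h : Spec.map (CommRingCat.ofHom (algebraMap R K)) ≫ u =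
      Spec.map (CommRingCat.ofHom (algebraMap R K)) ≫ v) : u = v := by
  obtain ⟨a, rfl⟩ := Spec.map_surjective u
  obtain ⟨b, rfl⟩ := Spec.map_surjective v
  rw [← Spec.map_comp, ← Spec.map_comp] at h
  congr 1
  ext q
  exact IsFractionRing.injective R K (ConcreteCategory.congr_hom (Spec.map_injective h) q)

/-- The valuative criterion for `toLine`: as `X` is proper, the morphism extends to `X`, and since
`g` is integral along it, it stays in the regular locus. -/
lemma existence_toLine (g : X.functionField) :
    ValuativeCriterion.Existence (toLine s (regularFun s g)) := by
  intro S
  set j := Spec.map (CommRingCat.ofHom (algebraMap S.R S.K)) with hj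
  have hs : ValuativeCriterion.Existence s := by
    have : UniversallyClosed s := inferInstance
    rw [UniversallyClosed.eq_valuativeCriterion] at this
    exact this.1
  obtain ⟨⟨⟨l, hl₁, hl₂⟩⟩⟩ := hs
    { R := S.R
      K := S.K
      i₁ := S.i₁ ≫ (regularLocus s g).ι
      i₂ := S.i₂ ≫ Spec.map (CommRingCat.ofHom C)
      commSq := ⟨by rw [← reassoc_of% S.commSq.w, toLine_comp, Category.assoc]⟩ }
  change j ≫ l = S.i₁ ≫ (regularLocus s g).ι at hl₁
  have hjl : ⊤ ≤ (j ≫ l) ⁻¹ᵁ regularLocus s g := by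
    rw [hl₁]
    exact fun y _ => (S.i₁ y).2
  have hmem : l (IsLocalRing.closedPoint S.R) ∈ regularLocus s g := by
    refine closedPoint_mem_regularLocus s g l hjl
      (S.i₂.appTop ((Scheme.ΓSpecIso (.of ℂ[X])).inv Polynomial.X)) ?_
    have h1 := appTop_comp_toLine s (regularFun s g) S.i₁ (fun y _ => (S.i₁ y).2)
    rw [S.commSq.w] at h1
    have h2 : ∀ (q q' : Spec (.of S.K) ⟶ X) (e : q = q') (hq : ⊤ ≤ q ⁻¹ᵁ regularLocus s g)
        (hq' : ⊤ ≤ q' ⁻¹ᵁ regularLocus s g), q.appLE _ ⊤ hq = q'.appLE _ ⊤ hq' := by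
      rintro q _ rfl _ _
      rfl
    exact h1.trans (ConcreteCategory.congr_hom (h2 _ _ hl₁.symm _ _) _)
  have hrange : Set.range l ⊆ Set.range (regularLocus s g).ι := by
    rintro _ ⟨y, rfl⟩
    rw [Scheme.Opens.range_ι]
    exact ((IsLocalRing.specializes_closedPoint y).map l.continuous).mem_open
      (regularLocus s g).isOpen hmem
  let l' := IsOpenImmersion.lift (regularLocus s g).ι l hrange
  have hl' : l' ≫ (regularLocus s g).ι = l := IsOpenImmersion.lift_fac _ _ _
  have h1 : j ≫ l' = S.i₁ := by
    rw [← cancel_mono (regularLocus s g).ι, Category.assoc, hl', hl₁]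
  refine ⟨⟨⟨l', h1, ?_⟩⟩⟩
  -- The two morphisms to the affine line agree at the generic point of `Spec R`.
  have h2 : j ≫ l' ≫ toLine s (regularFun s g) = j ≫ S.i₂ := by
    rw [reassoc_of% h1, S.commSq.w]
  exact eq_of_SpecMap_comp_eq h2

omit [IsProper s] in
lemma X_sub_C_mem_toLine_iff (g : X.functionField) (u : (regularLocus s g).toScheme) (c : ℂ) :
    Polynomial.X - C c ∈ PrimeSpectrum.asIdeal (toLine s (regularFun s g) u) ↔
      val s ((regularLocus s g).ι u) (g - constFF s c) < 1 := by
  have hu : (regularLocus s g).ι u ∈ regularLocus s g := u.2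
  rw [mem_asIdeal_toLine_iff, ← val_toFF_lt_one_iff s hu hu]
  have : toFF hu (polyHom s (regularFun s g) (Polynomial.X - C c)) = g - constFF s c := by
    rw [map_sub, map_sub, ← toFF_constSection s hu]
    congr 1
    · refine Eq.trans ?_ (toFF_regularFun s g hu)
      simp [polyHom]
    · simp [polyHom]
  rw [this]

/-- The fibres of a nonconstant rational function are discrete: in the fibre of a closed point, `g`
takes a constant value `c`, so that this fibre is contained in the finite set of
zeros of `g - c`. -/
lemma isDiscrete_preimage_toLine {g : X.functionField} (hg : ∀ c, g ≠ constFF s c)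
    (y : Spec (.of ℂ[X])) :
    _root_.IsDiscrete (toLine s (regularFun s g) ⁻¹' {y}) := by
  have hinj : Function.Injective (regularLocus s g).ι :=
    (regularLocus s g).ι.isOpenEmbedding.injective
  by_cases h : ∃ u, toLine s (regularFun s g) u = y ∧
      (regularLocus s g).ι u ≠ genericPoint X
  · obtain ⟨u, rfl, hu⟩ := h
    obtain ⟨c, hc⟩ := exists_val_sub_constFF_lt_one s
      (isClosed_singleton_of_ne_genericPoint s hu) (show val s _ g ≤ 1 from u.2)
    rw [← X_sub_C_mem_toLine_iff] at hc
    have hsub : ∀ z, toLine s (regularFun s g) z = toLine s (regularFun s g) u →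
        val s ((regularLocus s g).ι z) (g - constFF s c) < 1 := by
      intro z hz
      rw [← X_sub_C_mem_toLine_iff, hz]
      exact hc
    have hne : g - constFF s c ≠ 0 := sub_ne_zero.2 (hg c)
    have hone : ∀ x, val s x (g - constFF s c) < 1 → 1 < val s x (g - constFF s c)⁻¹ := by
      intro x hx
      rw [map_inv₀]
      exact (one_lt_inv₀ (zero_lt_iff.2 ((Valuation.ne_zero_iff _).2 hne))).2 hx
    refine Set.Finite.isDiscrete_of_subset_closedPoints ?_ ?_
    · refine Set.Finite.of_finite_image (f := (regularLocus s g).ι) ?_ hinj.injOn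
      refine (finite_setOf_one_lt_val s (g - constFF s c)⁻¹).subset ?_
      rintro _ ⟨z, hz, rfl⟩
      exact hone _ (hsub z hz)
    · intro z hz
      have h1 := isClosed_singleton_of_one_lt_val s (hone _ (hsub z hz))
      have h2 := h1.preimage (regularLocus s g).ι.continuous
      rwa [← Set.image_singleton, Set.preimage_image_eq _ hinj] at h2
  · push Not at h
    refine Set.Subsingleton.isDiscrete fun u hu v hv => hinj ?_
    rw [h u hu, h v hv]

/-- A nonconstant rational function is a finite map from the open subset where it is regular to the
affine line. -/
theorem isFinite_toLine {g : X.functionField} (hg : ∀ c, g ≠ constFF s c) :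
    IsFinite (toLine s (regularFun s g)) := by
  have : IsLocallyNoetherian X := LocallyOfFiniteType.isLocallyNoetherian s
  have : CompactSpace X := QuasiCompact.compactSpace_of_compactSpace s
  have : IsNoetherian X := {}
  have hcomp := toLine_comp s (regularFun s g)
  have : LocallyOfFiniteType (toLine s (regularFun s g) ≫ Spec.map (CommRingCat.ofHom C)) := by
    rw [hcomp]; infer_instance
  have : IsSeparated (toLine s (regularFun s g) ≫ Spec.map (CommRingCat.ofHom C)) := by
    rw [hcomp]; infer_instance
  have : QuasiCompact (toLine s (regularFun s g) ≫ Spec.map (CommRingCat.ofHom C)) := by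
    rw [hcomp]; infer_instance
  have := locallyOfFiniteType_of_comp (toLine s (regularFun s g)) (Spec.map (CommRingCat.ofHom C))
  have := IsSeparated.of_comp (toLine s (regularFun s g)) (Spec.map (CommRingCat.ofHom C))
  have := QuasiCompact.of_comp (toLine s (regularFun s g)) (Spec.map (CommRingCat.ofHom C))
  have := UniversallyClosed.of_valuativeCriterion _ (existence_toLine s g)
  have : IsProper (toLine s (regularFun s g)) := {}
  have := locallyQuasiFinite_iff_isDiscrete_preimage_singleton.2 (isDiscrete_preimage_toLine s hg)
  exact IsFinite.of_isProper_of_locallyQuasiFinite _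

theorem isAffineOpen_regularLocus {g : X.functionField} (hg : ∀ c, g ≠ constFF s c) :
    IsAffineOpen (regularLocus s g) := by
  have := isFinite_toLine s hg
  exact isAffine_of_isAffineHom (toLine s (regularFun s g))

theorem finite_polyHom {g : X.functionField} (hg : ∀ c, g ≠ constFF s c) :
    (polyHom s (regularFun s g)).Finite := by
  have := isFinite_toLine s hg
  have hU := isAffineOpen_regularLocus s hg
  have : IsIso (regularLocus s g).toSpecΓ := hU.isoSpec_hom ▸ inferInstance
  have : IsFinite (Spec.map (CommRingCat.ofHom (polyHom s (regularFun s g)))) := by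
    have h : Spec.map (CommRingCat.ofHom (polyHom s (regularFun s g))) =
        inv (regularLocus s g).toSpecΓ ≫ toLine s (regularFun s g) := by
      rw [toLine, IsIso.inv_hom_id_assoc]
    rw [h]
    infer_instance
  exact (IsFinite.SpecMap_iff _).1 this

end AffineLine

/-! ### Rational functions with prescribed poles -/

section Poles

open TopologicalSpace Opposite Limits Polynomial

variable {X : Scheme.{0}} [IsIntegral X] (s : X ⟶ Spec (.of ℂ)) [SmoothOfRelativeDimension 1 s]
  [IsProper s]

/-- The functions on the regular locus of a nonconstant rational function `f` form a finite module
over the polynomials in `f`. -/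
lemma exists_generators {f : X.functionField} (hf : ∀ c, f ≠ constFF s c) :
    ∃ (n : ℕ) (b : Fin n → X.functionField),
      (∀ i x, val s x f ≤ 1 → val s x (b i) ≤ 1) ∧
      ∀ g, (∀ x, val s x f ≤ 1 → val s x g ≤ 1) →
        ∃ q : Fin n → ℂ[X], g = ∑ i, (q i).eval₂ (constFF s) f * b i := by
  have hfin := finite_polyHom s hf
  let : Algebra ℂ[X] Γ(X, regularLocus s f) := (polyHom s (regularFun s f)).toAlgebra
  have : Module.Finite ℂ[X] Γ(X, regularLocus s f) := hfin
  have hgen := genericPoint_mem_regularLocus s f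
  obtain ⟨n, b, hb⟩ := Module.Finite.exists_fin (R := ℂ[X]) (M := Γ(X, regularLocus s f))
  refine ⟨n, fun i => toFF hgen (b i), fun i x hx => val_toFF_le_one s hgen hx _, fun g hg => ?_⟩
  obtain ⟨g', rfl⟩ := exists_toFF_eq s hgen hg
  have hg' : g' ∈ Submodule.span ℂ[X] (Set.range b) := hb ▸ Submodule.mem_top
  obtain ⟨q, rfl⟩ := (Submodule.mem_span_range_iff_exists_fun ℂ[X]).1 hg'
  refine ⟨q, ?_⟩
  rw [map_sum]
  refine Finset.sum_congr rfl fun i _ => ?_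
  rw [Algebra.smul_def, map_mul]
  congr 1
  refine (hom_eval₂ (q i) (constSection s _) (toFF hgen) (regularFun s f)).trans ?_
  rw [toFF_regularFun]
  congr 1
  ext c
  exact toFF_constSection s hgen c

omit [IsProper s] in
/-- The powers of `f` clear the poles of `g` contained in the zeros of `f`. -/
lemma exists_forall_val_mul_pow_le_one [QuasiCompact s] {f g : X.functionField} (hf : f ≠ 0)
    (h : ∀ x, val s x f = 1 → val s x g ≤ 1) :
    ∃ N : ℕ, ∀ n, N ≤ n → ∀ x, val s x f ≤ 1 → val s x (g * f ^ n) ≤ 1 := by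
  have hfin := finite_setOf_one_lt_val s f⁻¹
  have key : ∀ x, ∃ N : ℕ, ∀ n, N ≤ n → val s x f < 1 → val s x (g * f ^ n) ≤ 1 := by
    intro x
    by_cases hx : val s x f < 1
    · have hx' : 1 < val s x f⁻¹ := by
        rw [map_inv₀]
        exact (one_lt_inv₀ (zero_lt_iff.2 ((Valuation.ne_zero_iff _).2 hf))).2 hx
      obtain ⟨N, hN⟩ := exists_val_mul_pow_le_one s (isClosed_singleton_of_one_lt_val s hx') hx g
      exact ⟨N, fun n hn _ => hN n hn⟩
    · exact ⟨0, fun n _ h => absurd h hx⟩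
  choose N hN using key
  refine ⟨hfin.toFinset.sup N, fun n hn x hx => ?_⟩
  rcases hx.lt_or_eq with hx | hx
  · refine hN x n (le_trans (Finset.le_sup (f := N) ?_) hn) hx
    rw [Set.Finite.mem_toFinset, Set.mem_ofPred_eq, map_inv₀]
    exact (one_lt_inv₀ (zero_lt_iff.2 ((Valuation.ne_zero_iff _).2 hf))).2 hx
  · rw [map_mul, map_pow, hx, one_pow, _root_.mul_one]
    exact h x hx

omit [IsProper s] in
lemma val_inv_le_one_iff {x : X} {f : X.functionField} (hf : f ≠ 0) :
    val s x f⁻¹ ≤ 1 ↔ 1 ≤ val s x f := by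
  rw [map_inv₀]
  exact inv_le_one₀ (zero_lt_iff.2 ((Valuation.ne_zero_iff _).2 hf))

/-- Let `f` be a nonconstant rational function. Given infinitely many rational functions that are
regular where `f` has neither a zero nor a pole, some nontrivial linear combination of them is a sum
of a function that is regular outside the poles of `f` and one that is regular outside its zeros.
This expresses that `H¹(X, 𝒪_X)` is finite-dimensional. -/
lemma exists_sum_eq_add {f : X.functionField} (hf : ∀ c, f ≠ constFF s c)
    (g : ℕ → X.functionField) (hg : ∀ n x, val s x f = 1 → val s x (g n) ≤ 1) :
    ∃ (c : ℕ →₀ ℂ) (b b' : X.functionField), c ≠ 0 ∧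
      (∀ x, val s x f ≤ 1 → val s x b ≤ 1) ∧ (∀ x, 1 ≤ val s x f → val s x b' ≤ 1) ∧
      c.sum (fun n a => constFF s a * g n) = b + b' := by
  have hf0 : f ≠ 0 := by simpa using hf 0
  let : Algebra ℂ X.functionField := (constFF s).toAlgebra
  have hsmul : ∀ (a : ℂ) (x : X.functionField), a • x = constFF s a * x := fun a x =>
    Algebra.smul_def a x
  let reg : (X → Prop) → Submodule ℂ X.functionField := fun p =>
    { carrier := {g | ∀ x, p x → val s x g ≤ 1}
      add_mem' := fun ha hb x hx => ((val s x).map_add _ _).trans (max_le (ha x hx) (hb x hx))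
      zero_mem' := fun x _ => by simp
      smul_mem' := fun a g hg x hx => by
        rw [hsmul, map_mul]
        exact mul_le_one' (val_constFF_le_one s x a) (hg x hx) }
  let B := reg fun x => val s x f ≤ 1
  let B' := reg fun x => 1 ≤ val s x f
  obtain ⟨m, b, hb, hgen⟩ := exists_generators s hf
  have hN : ∀ i, ∃ N : ℕ, ∀ n, N ≤ n → b i * f⁻¹ ^ n ∈ B' := by
    intro i
    obtain ⟨N, hN⟩ := exists_forall_val_mul_pow_le_one s (g := b i) (inv_ne_zero hf0) (by
      intro x hx
      refine hb i x ?_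
      rw [map_inv₀, inv_eq_one] at hx
      exact hx.le)
    exact ⟨N, fun n hn x hx => hN n hn x ((val_inv_le_one_iff s hf0).2 hx)⟩
  choose N hN using hN
  let S : Set X.functionField := ⋃ i, (fun n => b i * f⁻¹ ^ n) '' (Set.Iio (N i))
  have hS : S.Finite := Set.finite_iUnion fun i => (Set.finite_Iio _).image _
  let M := Submodule.span ℂ S
  have : FiniteDimensional ℂ M := FiniteDimensional.span_of_finite ℂ hS
  -- Every product of a generator with an integral power of `f` lies in `M + B + B'`.
  have hmono : ∀ i (k l : ℕ), f ^ k * b i * f⁻¹ ^ l ∈ M ⊔ (B ⊔ B') := by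
    intro i k l
    rcases le_total l k with h | h
    · refine (le_sup_left.trans le_sup_right : B ≤ _) ?_
      intro x hx
      have : f ^ k * b i * f⁻¹ ^ l = f ^ (k - l) * b i := by
        rw [inv_pow, pow_sub₀ f hf0 h]
        ring
      rw [this, map_mul, map_pow]
      exact mul_le_one' (pow_le_one' hx _) (hb i x hx)
    · have : f ^ k * b i * f⁻¹ ^ l = b i * f⁻¹ ^ (l - k) := by
        rw [pow_sub₀ _ (inv_ne_zero hf0) h, inv_pow f k, inv_inv]
        ring
      rw [this]
      by_cases hlt : l - k < N i
      · exact (le_sup_left : M ≤ _) (Submodule.subset_span (Set.mem_iUnion.2 ⟨i, l - k, hlt, rfl⟩))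
      · exact (le_sup_right.trans le_sup_right : B' ≤ _) (hN i _ (not_lt.1 hlt))
  have hmem : ∀ g, (∀ x, val s x f = 1 → val s x g ≤ 1) → g ∈ M ⊔ (B ⊔ B') := by
    intro g hg
    obtain ⟨l, hl⟩ := exists_forall_val_mul_pow_le_one s hf0 hg
    obtain ⟨q, hq⟩ := hgen _ (hl l le_rfl)
    have hgq : g = (∑ i, (q i).eval₂ (constFF s) f * b i) * f⁻¹ ^ l := by
      rw [← hq, inv_pow, mul_inv_cancel_right₀ (pow_ne_zero _ hf0)]
    rw [hgq, Finset.sum_mul]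
    refine Submodule.sum_mem _ fun i _ => ?_
    rw [eval₂_eq_sum_range, Finset.sum_mul, Finset.sum_mul]
    refine Submodule.sum_mem _ fun k _ => ?_
    have := Submodule.smul_mem _ ((q i).coeff k) (hmono i k l)
    rw [hsmul] at this
    convert this using 1
    ring
  -- The classes of the `g n` modulo `B + B'` lie in the image of `M`.
  let π := (B ⊔ B').mkQ
  have hπ : ∀ n, π (g n) ∈ M.map π := by
    intro n
    obtain ⟨y, hy, z, hz, h⟩ := Submodule.mem_sup.1 (hmem (g n) (hg n))
    refine ⟨y, hy, ?_⟩
    rw [← h, map_add, show π z = 0 from (Submodule.Quotient.mk_eq_zero _).2 hz, add_zero]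
  have hdep : ¬ LinearIndependent ℂ (fun n => (⟨π (g n), hπ n⟩ : M.map π)) := by
    intro hli
    have := hli.finite
    exact not_finite ℕ
  rw [linearIndependent_iff] at hdep
  push Not at hdep
  obtain ⟨c, hc, hc0⟩ := hdep
  have hc' : c.sum (fun n a => constFF s a * g n) ∈ B ⊔ B' := by
    rw [← Submodule.Quotient.mk_eq_zero]
    have := congrArg (M.map π).subtype hc
    rw [Finsupp.linearCombination_apply, map_finsuppSum, map_zero] at this
    refine Eq.trans ?_ this
    refine (map_finsuppSum π c _).trans ?_
    refine Finsupp.sum_congr fun n _ => ?_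
    rw [← hsmul, map_smul, map_smul]
    rfl
  obtain ⟨y, hy, z, hz, h⟩ := Submodule.mem_sup.1 hc'
  exact ⟨c, y, z, hc0, hy, hz, h.symm⟩

omit [IsProper s] in
/-- The order of the pole of a combination of functions with poles of distinct orders. -/
lemma one_lt_val_sum {x : X} {f : X.functionField} (hf : 1 < val s x f) {g : ℕ → X.functionField}
    (hg : ∀ n, val s x (g n) = val s x f ^ (n + 1)) {c : ℕ →₀ ℂ} (hc : c ≠ 0) :
    1 < val s x (c.sum fun n a => constFF s a * g n) := by
  have hne : c.support.Nonempty := Finsupp.support_nonempty_iff.2 hc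
  set n₀ := c.support.max' hne with hn₀
  have hmem : n₀ ∈ c.support := Finset.max'_mem _ _
  have hval : ∀ n ∈ c.support, val s x (constFF s (c n) * g n) = val s x f ^ (n + 1) := by
    intro n hn
    rw [map_mul, val_constFF s x (Finsupp.mem_support_iff.1 hn), hg, _root_.one_mul]
  rw [Finsupp.sum, ← Finset.add_sum_erase _ _ hmem, Valuation.map_add_eq_of_lt_left, hval _ hmem]
  · exact one_lt_pow₀ hf (Nat.succ_ne_zero _)
  · rw [hval _ hmem]
    refine Valuation.map_sum_lt _ (pow_ne_zero _ (zero_lt_one.trans hf).ne') fun n hn => ?_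
    rw [hval _ (Finset.mem_of_mem_erase hn)]
    refine pow_lt_pow_right₀ hf (Nat.succ_lt_succ (lt_of_le_of_ne ?_ (Finset.ne_of_mem_erase hn)))
    exact Finset.le_max' _ _ (Finset.mem_of_mem_erase hn)

omit [IsProper s] in
lemma ne_constFF_of_one_lt_val {x : X} {f : X.functionField} (hf : 1 < val s x f) (c : ℂ) :
    f ≠ constFF s c := by
  rintro rfl
  exact absurd (val_constFF_le_one s x c) (not_le.2 hf)

/-- Every closed point `P` of the curve is the unique pole of a rational function. Let `f` have a
pole at `P`, and let `h` be a function not vanishing at `P` and vanishing at the other poles of `f`.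
The functions `f ^ (n + 1) * h ^ k`, for large `k`, have no pole other than `P` among the poles of
`f`. A nontrivial combination of them is a sum `b + b'`, where `b` is regular outside the poles of
`f` and `b'` is regular at these, and `P` is the only pole of `b`. -/
lemma exists_forall_one_lt_val_iff_eq {P : X} (hP : IsClosed {P}) :
    ∃ b, ∀ x, 1 < val s x b ↔ x = P := by
  obtain ⟨t, ht0, ht, -⟩ := exists_uniformizer s hP
  set f := t⁻¹ with hfdef
  have hf0 : f ≠ 0 := inv_ne_zero ht0
  have hfP : 1 < val s P f := by
    rw [map_inv₀]
    exact (one_lt_inv₀ (zero_lt_iff.2 ((Valuation.ne_zero_iff _).2 ht0))).2 ht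
  have hf := ne_constFF_of_one_lt_val s hfP
  have hf' : ∀ c, f⁻¹ ≠ constFF s c := by
    intro c hc
    refine hf c⁻¹ ?_
    rw [map_inv₀, ← hc, inv_inv]
  -- The function `h` is regular at the poles of `f`, vanishes at those distinct from `P`, and does
  -- not vanish at `P`.
  obtain ⟨h, hreg, hhP, hhQ⟩ : ∃ h, (∀ x, 1 ≤ val s x f → val s x h ≤ 1) ∧ val s P h = 1 ∧
      ∀ x, x ≠ P → 1 < val s x f → val s x h < 1 := by
    have hfin : ({x | 1 < val s x f} \ {P}).Finite := (finite_setOf_one_lt_val s f).sdiff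
    have hcl : IsClosed ({x | 1 < val s x f} \ {P}) := by
      rw [← Set.biUnion_of_singleton ({x | 1 < val s x f} \ {P})]
      exact hfin.isClosed_biUnion fun x hx => isClosed_singleton_of_one_lt_val s hx.1
    have hPU : P ∈ regularLocus s f⁻¹ := (val_inv_le_one_iff s hf0).2 hfP.le
    obtain ⟨h, hle, hPh⟩ := (isAffineOpen_regularLocus s hf').exists_basicOpen_le
      (V := ⟨_, hcl.isOpen_compl⟩) ⟨P, fun hP => hP.2 rfl⟩ hPU
    refine ⟨toFF hPU h, fun x hx => val_toFF_le_one s hPU ((val_inv_le_one_iff s hf0).2 hx) h,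
      (val_toFF_eq_one_iff s hPU hPU h).2 hPh, fun x hxP hx => ?_⟩
    rw [val_toFF_lt_one_iff s hPU ((val_inv_le_one_iff s hf0).2 hx.le)]
    exact fun hxh => hle hxh ⟨hx, hxP⟩
  have hk : ∀ n : ℕ, ∃ k : ℕ, ∀ x, x ≠ P → 1 < val s x f → val s x (f ^ (n + 1) * h ^ k) ≤ 1 := by
    intro n
    have hfin : {x | 1 < val s x f}.Finite := finite_setOf_one_lt_val s f
    have key : ∀ x, ∃ N : ℕ, ∀ k, N ≤ k → x ≠ P → 1 < val s x f →
        val s x (f ^ (n + 1) * h ^ k) ≤ 1 := by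
      intro x
      by_cases hx : x ≠ P ∧ 1 < val s x f
      · obtain ⟨N, hN⟩ := exists_val_mul_pow_le_one s (isClosed_singleton_of_one_lt_val s hx.2)
          (hhQ x hx.1 hx.2) (f ^ (n + 1))
        exact ⟨N, fun k hk _ _ => hN k hk⟩
      · exact ⟨0, fun _ _ h₁ h₂ => absurd ⟨h₁, h₂⟩ hx⟩
    choose N hN using key
    exact ⟨hfin.toFinset.sup N, fun x hxP hx =>
      hN x _ (Finset.le_sup (f := N) (hfin.mem_toFinset.2 hx)) hxP hx⟩
  choose k hk using hk
  obtain ⟨c, b, b', hc, hb, hb', hsum⟩ := exists_sum_eq_add s hf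
    (fun n => f ^ (n + 1) * h ^ k n) (by
      intro n x hx
      rw [map_mul, map_pow, map_pow, hx, one_pow, _root_.one_mul]
      exact pow_le_one' (hreg x hx.ge) _)
  have hbeq : b = (c.sum fun n a => constFF s a * (f ^ (n + 1) * h ^ k n)) - b' := by
    rw [hsum, add_sub_cancel_right]
  refine ⟨b, fun x => ⟨fun hx => ?_, ?_⟩⟩
  · by_contra hxP
    have hxf : 1 < val s x f := by
      by_contra hxf
      exact absurd (hb x (not_lt.1 hxf)) (not_le.2 hx)
    refine absurd ?_ (not_le.2 hx)
    rw [hbeq]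
    refine ((val s x).map_sub _ _).trans (max_le ?_ (hb' x hxf.le))
    refine Valuation.map_sum_le _ fun n _ => ?_
    rw [map_mul]
    exact mul_le_one' (val_constFF_le_one s x _) (hk n x hxP hxf)
  · rintro rfl
    have h1 := one_lt_val_sum s hfP (g := fun n => f ^ (n + 1) * h ^ k n) (fun n => by
      rw [map_mul, map_pow, map_pow, hhP, one_pow, _root_.mul_one]) hc
    rw [hbeq, Valuation.map_sub_eq_of_lt_left]
    · exact h1
    · exact (hb' x hfP.le).trans_lt h1

lemma exists_forall_one_lt_val_iff_mem {S : Set X} (hS : S.Finite) (hS' : ∀ x ∈ S, IsClosed {x}) :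
    ∃ b, ∀ x, 1 < val s x b ↔ x ∈ S := by
  induction S, hS using Set.Finite.induction_on with
  | empty => exact ⟨0, by simp⟩
  | @insert P S hP _ ih =>
    obtain ⟨b, hb⟩ := ih fun x hx => hS' x (Set.mem_insert_of_mem _ hx)
    obtain ⟨a, ha⟩ := exists_forall_one_lt_val_iff_eq s (hS' P (Set.mem_insert _ _))
    refine ⟨a + b, fun x => ?_⟩
    rw [Set.mem_insert_iff, ← ha, ← hb]
    by_cases h₁ : 1 < val s x a
    · have h₂ : ¬ 1 < val s x b := by
        rw [hb, (ha x).1 h₁]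
        exact hP
      rw [Valuation.map_add_eq_of_lt_left _ ((not_lt.1 h₂).trans_lt h₁)]
      simp [h₁]
    · by_cases h₂ : 1 < val s x b
      · rw [Valuation.map_add_eq_of_lt_right _ ((not_lt.1 h₁).trans_lt h₂)]
        simp [h₂]
      · refine iff_of_false (not_lt.2 ?_) (not_or.2 ⟨h₁, h₂⟩)
        exact ((val s x).map_add _ _).trans (max_le (not_lt.1 h₁) (not_lt.1 h₂))

include s in
/-- The complement of a nonempty finite set of closed points in a smooth proper curve is affine. -/
theorem isAffineOpen_of_finite_compl {U : X.Opens} (hU : ((U : Set X)ᶜ).Finite)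
    (hU' : (U : Set X) ≠ Set.univ) (hgen : genericPoint X ∈ U) : IsAffineOpen U := by
  obtain ⟨b, hb⟩ := exists_forall_one_lt_val_iff_mem s hU fun x hx =>
    isClosed_singleton_of_ne_genericPoint s (by rintro rfl; exact hx hgen)
  obtain ⟨x, hx⟩ := (Set.ne_univ_iff_exists_notMem _).1 hU'
  have h := isAffineOpen_regularLocus s (ne_constFF_of_one_lt_val s ((hb x).2 hx))
  convert h
  ext y
  have := (hb y).not
  rw [not_lt, Set.notMem_compl_iff] at this
  exact this.symm

end Poles

/-! ### Pulling back functions to affine schemes -/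

section PullSection

open TopologicalSpace Opposite Limits

variable {X Y : Scheme.{0}} {A B : Type} [CommRing A] [CommRing B]

/-- The pullback of a function along a morphism from an affine scheme. -/
def pullSection (v : Spec (.of A) ⟶ X) {U : X.Opens} (h : ⊤ ≤ v ⁻¹ᵁ U) : Γ(X, U) →+* A :=
  (v.appLE U ⊤ h ≫ (Scheme.ΓSpecIso (.of A)).hom).hom

lemma pullSection_map (v : Spec (.of A) ⟶ X) {U V : X.Opens} (hVU : V ≤ U) (h : ⊤ ≤ v ⁻¹ᵁ V)
    (h' : ⊤ ≤ v ⁻¹ᵁ U) (f : Γ(X, U)) :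
    pullSection v h (X.presheaf.map (homOfLE hVU).op f) = pullSection v h' f :=
  congrArg (Scheme.ΓSpecIso (.of A)).hom
    (ConcreteCategory.congr_hom (v.map_appLE h (homOfLE hVU).op) f)

lemma pullSection_congr {v w : Spec (.of A) ⟶ X} (hvw : v = w) {U : X.Opens} (h : ⊤ ≤ v ⁻¹ᵁ U)
    (h' : ⊤ ≤ w ⁻¹ᵁ U) (f : Γ(X, U)) : pullSection v h f = pullSection w h' f := by
  subst hvw
  rfl

lemma pullSection_comp (v : Spec (.of A) ⟶ X) (q : X ⟶ Y) {U : Y.Opens} {V : X.Opens}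
    (hq : V ≤ q ⁻¹ᵁ U) (hv : ⊤ ≤ v ⁻¹ᵁ V) (h : ⊤ ≤ (v ≫ q) ⁻¹ᵁ U) (f : Γ(Y, U)) :
    pullSection (v ≫ q) h f = pullSection v hv (q.appLE U V hq f) := by
  have h1 : q.appLE U V hq ≫ v.appLE V ⊤ hv = (v ≫ q).appLE U ⊤ h :=
    Scheme.Hom.appLE_comp_appLE _ _ _ _ _ _ _
  exact congrArg (Scheme.ΓSpecIso (.of A)).hom (ConcreteCategory.congr_hom h1 f).symm

lemma pullSection_SpecMap_comp (φ : A →+* B) (v : Spec (.of A) ⟶ X) {U : X.Opens}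
    (h : ⊤ ≤ v ⁻¹ᵁ U) (h' : ⊤ ≤ (Spec.map (CommRingCat.ofHom φ) ≫ v) ⁻¹ᵁ U) (f : Γ(X, U)) :
    pullSection (Spec.map (CommRingCat.ofHom φ) ≫ v) h' f = φ (pullSection v h f) := by
  set q := Spec.map (CommRingCat.ofHom φ)
  have h1 : v.appLE U ⊤ h ≫ q.appLE ⊤ ⊤ le_top = (q ≫ v).appLE U ⊤ h' :=
    Scheme.Hom.appLE_comp_appLE _ _ _ _ _ _ _
  have h2 : q.appLE ⊤ ⊤ le_top = q.appTop := (Scheme.Hom.app_eq_appLE (f := q) (U := ⊤)).symm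
  rw [pullSection, ← h1, h2]
  exact ConcreteCategory.congr_hom (Scheme.ΓSpecIso_naturality (CommRingCat.ofHom φ))
    (v.appLE U ⊤ h f)

lemma eq_SpecMap_pullSection_comp (v : Spec (.of A) ⟶ X) {V : X.Opens} (hV : IsAffineOpen V)
    (h : ⊤ ≤ v ⁻¹ᵁ V) :
    v = Spec.map (CommRingCat.ofHom (pullSection v h)) ≫ hV.fromSpec := by
  have h1 := hV.SpecMap_appLE_fromSpec v (isAffineOpen_top _) h
  have h2 : Spec.map (Scheme.ΓSpecIso (.of A)).hom ≫ (isAffineOpen_top (Spec (.of A))).fromSpec =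
      𝟙 _ := by
    rw [IsAffineOpen.fromSpec_top, Iso.comp_inv_eq, Category.id_comp, ← cancel_mono
      (Spec.map (Scheme.ΓSpecIso (.of A)).inv), ← Spec.map_comp, Iso.inv_hom_id, Spec.map_id]
    exact (toSpecΓ_SpecMap_ΓSpecIso_inv (.of A)).symm
  have h3 : CommRingCat.ofHom (pullSection v h) =
    v.appLE V ⊤ h ≫ (Scheme.ΓSpecIso (.of A)).hom := rfl
  rw [h3, Spec.map_comp, Category.assoc, h1, ← Category.assoc, h2, Category.id_comp]

/-- Two morphisms from an affine scheme to an affine open subset are equal if they induce the same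
pullback of functions. -/
lemma eq_of_pullSection_eq {v w : Spec (.of A) ⟶ X} {V : X.Opens} (hV : IsAffineOpen V)
    (h : ⊤ ≤ v ⁻¹ᵁ V) (h' : ⊤ ≤ w ⁻¹ᵁ V) (H : ∀ f, pullSection v h f = pullSection w h' f) :
    v = w := by
  rw [eq_SpecMap_pullSection_comp v hV h, eq_SpecMap_pullSection_comp w hV h', RingHom.ext H]

lemma pullSection_SpecMap_fromSpec {V : X.Opens} (hV : IsAffineOpen V) (φ : Γ(X, V) →+* A)
    (h : ⊤ ≤ (Spec.map (CommRingCat.ofHom φ) ≫ hV.fromSpec) ⁻¹ᵁ V) (f : Γ(X, V)) :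
    pullSection (Spec.map (CommRingCat.ofHom φ) ≫ hV.fromSpec) h f = φ f := by
  have h1 := eq_SpecMap_pullSection_comp (Spec.map (CommRingCat.ofHom φ) ≫ hV.fromSpec) hV h
  rw [cancel_mono] at h1
  exact (ConcreteCategory.congr_hom (Spec.map_injective h1) f).symm

lemma fromSpec_comp (s : X ⟶ Spec (.of ℂ)) {V : X.Opens} (hV : IsAffineOpen V) :
    hV.fromSpec ≫ s = Spec.map (CommRingCat.ofHom (constSection s V)) := by
  rw [← cancel_epi hV.isoSpec.hom, hV.isoSpec_hom_fromSpec_assoc, hV.isoSpec_hom,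
    toSpecΓ_SpecMap_constSection]

end PullSection

/-! ### Pulling back rational functions -/

section PullRational

open TopologicalSpace Opposite Limits

variable {X : Scheme.{0}} [IsIntegral X] (s : X ⟶ Spec (.of ℂ)) {q : X ⟶ X}
  (hq : q (genericPoint X) = genericPoint X)

/-- The pullback of rational functions along a dominant morphism from an integral scheme to
itself. -/
def pullFF : X.functionField →+* X.functionField :=
  (X.presheaf.stalkSpecializes (specializes_of_eq hq) ≫ q.stalkMap (genericPoint X)).hom

lemma pullFF_toFF {U : X.Opens} {x y : X} (hx : x ∈ U) (hy : y ∈ q ⁻¹ᵁ U) (f : Γ(X, U)) :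
    pullFF hq (toFF hx f) = toFF hy (q.app U f) := by
  have hyU : q (genericPoint X) ∈ U := genericPoint_mem hy
  have h1 : X.presheaf.germ U (genericPoint X) (genericPoint_mem hx) ≫
      X.presheaf.stalkSpecializes (specializes_of_eq hq) =
        X.presheaf.germ U (q (genericPoint X)) hyU := X.presheaf.germ_stalkSpecializes _ _
  have h2 : X.presheaf.germ U (q (genericPoint X)) hyU ≫ q.stalkMap (genericPoint X) =
      q.app U ≫ X.presheaf.germ (q ⁻¹ᵁ U) (genericPoint X) hyU :=
    q.germ_stalkMap U (genericPoint X) hyU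
  exact (congrArg (q.stalkMap (genericPoint X)) (ConcreteCategory.congr_hom h1 f)).trans
    (ConcreteCategory.congr_hom h2 f)

lemma pullFF_constFF (hqs : q ≫ s = s) (c : ℂ) : pullFF hq (constFF s c) = constFF s c := by
  have h1 : q.app ⊤ (constSection s ⊤ c) = constSection s ⊤ c := by
    have h2 : ∀ (s' : X ⟶ Spec (.of ℂ)), q ≫ s = s' →
        s.appLE ⊤ ⊤ le_top ≫ q.appLE ⊤ ⊤ le_top = s'.appLE ⊤ ⊤ le_top := by
      rintro _ rfl
      exact Scheme.Hom.appLE_comp_appLE _ _ _ _ _ _ _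
    have h3 : q.appLE ⊤ ⊤ le_top = q.app ⊤ := (Scheme.Hom.app_eq_appLE (f := q) (U := ⊤)).symm
    have h4 := h2 s hqs
    rw [h3] at h4
    exact ConcreteCategory.congr_hom h4 ((Scheme.ΓSpecIso (.of ℂ)).inv c)
  have hx : genericPoint X ∈ (⊤ : X.Opens) := trivial
  have hy : genericPoint X ∈ q ⁻¹ᵁ (⊤ : X.Opens) := trivial
  rw [constFF, RingHom.comp_apply, pullFF_toFF hq hx hy, h1]
  rfl

variable [SmoothOfRelativeDimension 1 s]

lemma val_pullFF_le_one {x : X} {g : X.functionField} (h : val s (q x) g ≤ 1) :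
    val s x (pullFF hq g) ≤ 1 := by
  obtain ⟨U, hU, f, rfl⟩ := exists_toFF_eq_of_val_le_one s h
  rw [pullFF_toFF hq hU (y := x) hU]
  exact val_toFF_le_one s (U := q ⁻¹ᵁ U) hU hU _

lemma val_pullFF_eq_one_iff {x : X} {g : X.functionField} (h : val s (q x) g ≤ 1) :
    val s x (pullFF hq g) = 1 ↔ val s (q x) g = 1 := by
  obtain ⟨U, hU, f, rfl⟩ := exists_toFF_eq_of_val_le_one s h
  rw [pullFF_toFF hq hU (y := x) hU, val_toFF_eq_one_iff s hU hU]
  have := val_toFF_eq_one_iff s (U := q ⁻¹ᵁ U) (x := x) (y := x) hU hU (q.app U f)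
  rw [this, ← Scheme.preimage_basicOpen]
  rfl

lemma val_pullFF_lt_one {x : X} {g : X.functionField} (h : val s (q x) g < 1) :
    val s x (pullFF hq g) < 1 :=
  lt_of_le_of_ne (val_pullFF_le_one s hq h.le) fun h' =>
    h.ne ((val_pullFF_eq_one_iff s hq h.le).1 h')

end PullRational

/-! ### Tangent vectors -/

section Tangent

open TopologicalSpace Opposite Limits TrivSqZeroExt

variable {X : Scheme.{0}} (s : X ⟶ Spec (.of ℂ))

/-- The dual numbers over `ℂ`, and their generalizations in several variables with square-zero
maximal ideal `M`. -/
abbrev Dual (M : Type) [AddCommGroup M] [Module ℂ M] [Module ℂᵐᵒᵖ M] [IsCentralScalar ℂ M] : Type :=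
  TrivSqZeroExt ℂ M

lemma subsingleton_primeSpectrum_dual (M : Type) [AddCommGroup M] [Module ℂ M] [Module ℂᵐᵒᵖ M]
    [IsCentralScalar ℂ M] : Subsingleton (PrimeSpectrum (Dual M)) := by
  have key : ∀ (P : PrimeSpectrum (Dual M)) (x : Dual M), x ∈ P.asIdeal ↔ x.fst = 0 := by
    intro P x
    have hinr : ∀ m : M, (inr m : Dual M) ∈ P.asIdeal := fun m =>
      P.isPrime.mem_of_pow_mem 2 (by rw [pow_two, inr_mul_inr]; exact P.asIdeal.zero_mem)
    constructor
    · intro hx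
      by_contra hne
      exact P.isPrime.ne_top (Ideal.eq_top_of_isUnit_mem _ hx
        (isUnit_iff_isUnit_fst.2 (isUnit_iff_ne_zero.2 hne)))
    · intro hx
      rw [← inl_fst_add_inr_snd_eq x, hx, inl_zero, zero_add]
      exact hinr _
  exact ⟨fun P Q => PrimeSpectrum.ext (Ideal.ext fun x => (key P x).trans (key Q x).symm)⟩

/-- A smooth curve has a nonzero tangent vector at every complex point. -/
lemma exists_tangent [SmoothOfRelativeDimension 1 s] {p : Spec (.of ℂ) ⟶ X} (hp : p ≫ s = 𝟙 _) :
    ∃ v : Spec (.of (Dual ℂ)) ⟶ X,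
      v ≫ s = Spec.map (CommRingCat.ofHom (algebraMap ℂ (Dual ℂ))) ∧
      Spec.map (CommRingCat.ofHom (fstHom ℂ ℂ ℂ : Dual ℂ →+* ℂ)) ≫ v = p ∧
      ∃ (V : X.Opens) (h : ⊤ ≤ v ⁻¹ᵁ V) (f : Γ(X, V)), pullSection v h f = inr 1 := by
  obtain ⟨V, hV, hxV, hs⟩ := exists_isStandardSmooth s (p (IsLocalRing.closedPoint ℂ))
  have hpV := le_preimage_of_mem hxV
  let : Algebra ℂ Γ(X, V) := (constSection s V).toAlgebra
  have : Algebra.IsStandardSmoothOfRelativeDimension 1 ℂ Γ(X, V) := hs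
  let ε : Γ(X, V) →ₐ[ℂ] ℂ :=
    { pullSection p hpV with
      commutes' := evalPoint_constSection s hp hxV }
  have : Nontrivial Γ(X, V) := ε.toRingHom.domain_nontrivial
  obtain ⟨y, b, hb⟩ := exists_basis_kaehlerDifferential (k := ℂ) (B := Γ(X, V))
  let D := KaehlerDifferential.D ℂ Γ(X, V)
  let φ : Γ(X, V) →+* Dual ℂ :=
    { toFun f := inl (ε f) + inr (ε (b.coord () (D f)))
      map_one' := by simp [D]
      map_mul' f g := by
        ext <;> simp [D]
        ring
      map_zero' := by simp
      map_add' f g := by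
        ext <;> simp }
  have hle : ⊤ ≤ (Spec.map (CommRingCat.ofHom φ) ≫ hV.fromSpec) ⁻¹ᵁ V := by
    intro z _
    have := (hV.range_fromSpec).le ⟨Spec.map (CommRingCat.ofHom φ) z, rfl⟩
    exact this
  refine ⟨Spec.map (CommRingCat.ofHom φ) ≫ hV.fromSpec, ?_, ?_, V, hle,
    y - algebraMap ℂ _ (ε y), ?_⟩
  · rw [Category.assoc, fromSpec_comp, ← Spec.map_comp]
    congr 1
    refine CommRingCat.hom_ext (RingHom.ext fun c => ?_)
    change φ (algebraMap ℂ _ c) = _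
    ext <;> simp [φ, D] <;> rfl
  · rw [← Spec.map_comp_assoc]
    refine Eq.trans ?_ (eq_SpecMap_pullSection_comp p hV hpV).symm
    congr 2
    ext f
    change (φ f).fst = ε f
    simp [φ]
  · rw [pullSection_SpecMap_fromSpec]
    have hy : b.coord () (D y) = 1 := by
      rw [← hb]
      simp
    change inl (ε (y - algebraMap ℂ _ (ε y))) + inr (ε (b.coord () (D (y - algebraMap ℂ _ (ε y)))))
      = inr 1
    rw [map_sub D, Derivation.map_algebraMap, sub_zero, hy]
    simp

lemma fst_pullSection {v : Spec (.of (Dual ℂ)) ⟶ X} {p : Spec (.of ℂ) ⟶ X}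
    (hv : Spec.map (CommRingCat.ofHom (fstHom ℂ ℂ ℂ : Dual ℂ →+* ℂ)) ≫ v = p) {U : X.Opens}
    (h : ⊤ ≤ v ⁻¹ᵁ U) (hp : p (IsLocalRing.closedPoint ℂ) ∈ U) (f : Γ(X, U)) :
    (pullSection v h f).fst = evalPoint p hp f := by
  subst hv
  exact (pullSection_SpecMap_comp (fstHom ℂ ℂ ℂ : Dual ℂ →+* ℂ) v h _ f).symm

lemma le_preimage_of_fst {v : Spec (.of (Dual ℂ)) ⟶ X} {p : Spec (.of ℂ) ⟶ X}
    (hv : Spec.map (CommRingCat.ofHom (fstHom ℂ ℂ ℂ : Dual ℂ →+* ℂ)) ≫ v = p) {U : X.Opens}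
    (hp : p (IsLocalRing.closedPoint ℂ) ∈ U) : ⊤ ≤ v ⁻¹ᵁ U := by
  intro y _
  subst hv
  have := subsingleton_primeSpectrum_dual ℂ
  have h : y = Spec.map (CommRingCat.ofHom (fstHom ℂ ℂ ℂ : Dual ℂ →+* ℂ))
    (IsLocalRing.closedPoint ℂ) := Subsingleton.elim (α := PrimeSpectrum (Dual ℂ)) _ _
  rw [h]
  exact hp

end Tangent

/-! ### Multiplication by integers on the tangent space of a group -/

section TangentGroup

open TopologicalSpace Opposite Limits TrivSqZeroExt

section

variable {M N P : Type} [AddCommGroup M] [Module ℂ M] [Module ℂᵐᵒᵖ M] [IsCentralScalar ℂ M]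
  [AddCommGroup N] [Module ℂ N] [Module ℂᵐᵒᵖ N] [IsCentralScalar ℂ N]
  [AddCommGroup P] [Module ℂ P] [Module ℂᵐᵒᵖ P] [IsCentralScalar ℂ P]

variable (M) in
/-- The spectrum of the square-zero extension of `ℂ` by `M`, as a scheme over `ℂ`. -/
def tanObj : Over (Spec (.of ℂ)) := Over.mk (Spec.map (CommRingCat.ofHom (algebraMap ℂ (Dual M))))

/-- The morphism of first-order neighbourhoods induced by a linear map. -/
def tanMap (g : M →ₗ[ℂ] N) : tanObj N ⟶ tanObj M :=
  Over.homMk (Spec.map (CommRingCat.ofHom (TrivSqZeroExt.map g : Dual M →+* Dual N))) (by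
    refine (Spec.map_comp _ _).symm.trans (congrArg Spec.map ?_)
    refine CommRingCat.hom_ext (RingHom.ext fun c => ?_)
    exact map_inl g c)

variable (M) in
/-- The point of a first-order neighbourhood. -/
def tanPoint : 𝟙_ (Over (Spec (.of ℂ))) ⟶ tanObj M :=
  Over.homMk (Spec.map (CommRingCat.ofHom (fstHom ℂ ℂ M : Dual M →+* ℂ))) (by
    refine (Spec.map_comp _ _).symm.trans ((congrArg Spec.map ?_).trans (Spec.map_id _))
    exact CommRingCat.hom_ext (RingHom.ext fun c => fst_inl M c))

lemma tanMap_comp (g : M →ₗ[ℂ] N) (h : N →ₗ[ℂ] P) :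
    tanMap h ≫ tanMap g = tanMap (h ∘ₗ g) := by
  ext1
  refine (Spec.map_comp _ _).symm.trans (congrArg Spec.map ?_)
  refine CommRingCat.hom_ext (RingHom.ext fun c => ?_)
  exact (DFunLike.congr_fun (map_comp_map g h) c).symm

lemma tanMap_id : tanMap (LinearMap.id : M →ₗ[ℂ] M) = 𝟙 _ := by
  ext1
  refine (congrArg Spec.map ?_).trans (Spec.map_id _)
  refine CommRingCat.hom_ext (RingHom.ext fun c => ?_)
  exact DFunLike.congr_fun map_id c

lemma tanMap_zero : tanMap (0 : M →ₗ[ℂ] N) = toUnit _ ≫ tanPoint M := by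
  ext1
  refine Eq.trans ?_ (Spec.map_comp _ _)
  refine congrArg Spec.map (CommRingCat.hom_ext (RingHom.ext fun c => ?_))
  change TrivSqZeroExt.map (0 : M →ₗ[ℂ] N) c = inl c.fst
  ext <;> simp

end

variable {E : Over (Spec (.of ℂ))}

/-- The morphism of schemes underlying a morphism from a first-order neighbourhood. -/
def vecHom {M : Type} [AddCommGroup M] [Module ℂ M] [Module ℂᵐᵒᵖ M] [IsCentralScalar ℂ M]
    (v : tanObj M ⟶ E) : Spec (.of (Dual M)) ⟶ E.left := v.left

/-- A first-order neighbourhood in the plane is covered by those in the two coordinate axes. -/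
lemma tanObj_hom_ext {u w : tanObj (ℂ × ℂ) ⟶ E}
    (h₁ : tanMap (LinearMap.fst ℂ ℂ ℂ) ≫ u = tanMap (LinearMap.fst ℂ ℂ ℂ) ≫ w)
    (h₂ : tanMap (LinearMap.snd ℂ ℂ ℂ) ≫ u = tanMap (LinearMap.snd ℂ ℂ ℂ) ≫ w) : u = w := by
  have hsub := subsingleton_primeSpectrum_dual (ℂ × ℂ)
  have : Nonempty (tanObj ℂ).left := ⟨(tanPoint ℂ).left (IsLocalRing.closedPoint ℂ)⟩
  obtain ⟨z⟩ := this
  have h₁' : (tanMap (LinearMap.fst ℂ ℂ ℂ)).left ≫ u.left =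
    (tanMap (LinearMap.fst ℂ ℂ ℂ)).left ≫ w.left := congrArg (·.left) h₁
  have h₂' : (tanMap (LinearMap.snd ℂ ℂ ℂ)).left ≫ u.left =
    (tanMap (LinearMap.snd ℂ ℂ ℂ)).left ≫ w.left := congrArg (·.left) h₂
  obtain ⟨V, hV, hz, -⟩ := exists_isAffineOpen_mem_and_subset (U := ⊤)
    (x := u.left ((tanMap (LinearMap.fst ℂ ℂ ℂ)).left z)) trivial
  have hz' : w.left ((tanMap (LinearMap.fst ℂ ℂ ℂ)).left z) ∈ V := by
    have : ((tanMap (LinearMap.fst ℂ ℂ ℂ)).left ≫ u.left) z ∈ V := hz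
    rw [h₁'] at this
    exact this
  have hu : ⊤ ≤ u.left ⁻¹ᵁ V := by
    intro y _
    rw [Subsingleton.elim (α := PrimeSpectrum (Dual (ℂ × ℂ))) y _]
    exact hz
  have hw : ⊤ ≤ w.left ⁻¹ᵁ V := by
    intro y _
    rw [Subsingleton.elim (α := PrimeSpectrum (Dual (ℂ × ℂ))) y _]
    exact hz'
  ext1
  refine eq_of_pullSection_eq hV hu hw fun f => ?_
  have key : ∀ g : ℂ × ℂ →ₗ[ℂ] ℂ, (tanMap g).left ≫ u.left = (tanMap g).left ≫ w.left →
      TrivSqZeroExt.map g (pullSection u.left hu f) =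
        TrivSqZeroExt.map g (pullSection w.left hw f) := by
    intro g hg
    have h1 := pullSection_SpecMap_comp (TrivSqZeroExt.map g : Dual (ℂ × ℂ) →+* Dual ℂ) u.left hu
      (fun y _ => hu (x := (tanMap g).left y) trivial) f
    have h2 := pullSection_SpecMap_comp (TrivSqZeroExt.map g : Dual (ℂ × ℂ) →+* Dual ℂ) w.left hw
      (fun y _ => hw (x := (tanMap g).left y) trivial) f
    exact h1.symm.trans ((pullSection_congr hg _ _ f).trans h2)
  have k₁ := key _ h₁'
  have k₂ := key _ h₂'
  refine TrivSqZeroExt.ext ?_ (Prod.ext ?_ ?_)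
  · simpa using congrArg TrivSqZeroExt.fst k₁
  · simpa using congrArg TrivSqZeroExt.snd k₁
  · simpa using congrArg TrivSqZeroExt.snd k₂

variable [GrpObj E]

lemma tanMap_zero_comp {M : Type} [AddCommGroup M] [Module ℂ M] [Module ℂᵐᵒᵖ M]
    [IsCentralScalar ℂ M] {v : tanObj ℂ ⟶ E} (hv : tanPoint ℂ ≫ v = η) :
    tanMap (0 : ℂ →ₗ[ℂ] M) ≫ v = 1 := by
  rw [tanMap_zero, Category.assoc, hv, Hom.one_def]

/-- The group law is addition on tangent vectors. -/
lemma tanMap_comp_mul {v : tanObj ℂ ⟶ E} (hv : tanPoint ℂ ≫ v = η) (α β : ℂ →ₗ[ℂ] ℂ) :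
    (tanMap α ≫ v) * (tanMap β ≫ v) = tanMap (α + β) ≫ v := by
  have key : (tanMap (LinearMap.inl ℂ ℂ ℂ) ≫ v) * (tanMap (LinearMap.inr ℂ ℂ ℂ) ≫ v) =
      tanMap (LinearMap.inl ℂ ℂ ℂ + LinearMap.inr ℂ ℂ ℂ) ≫ v := by
    apply tanObj_hom_ext
    · rw [comp_mul, ← Category.assoc, ← Category.assoc, ← Category.assoc, tanMap_comp, tanMap_comp,
        tanMap_comp, LinearMap.fst_comp_inl, LinearMap.fst_comp_inr, tanMap_zero_comp hv,
        LinearMap.comp_add, LinearMap.fst_comp_inl, LinearMap.fst_comp_inr, add_zero,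
        _root_.mul_one]
    · rw [comp_mul, ← Category.assoc, ← Category.assoc, ← Category.assoc, tanMap_comp, tanMap_comp,
        tanMap_comp, LinearMap.snd_comp_inl, LinearMap.snd_comp_inr, tanMap_zero_comp hv,
        LinearMap.comp_add, LinearMap.snd_comp_inl, LinearMap.snd_comp_inr, zero_add,
        _root_.one_mul]
  have h := congrArg (tanMap (α.coprod β) ≫ ·) key
  rw [comp_mul, ← Category.assoc, ← Category.assoc, ← Category.assoc, tanMap_comp, tanMap_comp,
    tanMap_comp, LinearMap.coprod_inl, LinearMap.coprod_inr, LinearMap.comp_add,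
    LinearMap.coprod_inl, LinearMap.coprod_inr] at h
  exact h

lemma tangent_pow {v : tanObj ℂ ⟶ E} (hv : tanPoint ℂ ≫ v = η) (n : ℕ) :
    v ^ n = tanMap (n • LinearMap.id : ℂ →ₗ[ℂ] ℂ) ≫ v := by
  induction n with
  | zero => rw [pow_zero, zero_smul, tanMap_zero_comp hv]
  | succ n ih =>
    rw [pow_succ, ih, add_smul, ← tanMap_comp_mul hv, one_smul, tanMap_id, Category.id_comp]

variable (E)

/-- The unit of the group, as a complex point. -/
def unitHom : Spec (.of ℂ) ⟶ E.left := (η[E] : 𝟙_ _ ⟶ E).left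

/-- The unit of the group, as a point of the underlying space. -/
def unitPt : E.left := unitHom E (IsLocalRing.closedPoint ℂ)

/-- Multiplication by `n` on the group. -/
def mulBy (n : ℕ) : E ⟶ E := 𝟙 E ^ n

variable {E}

lemma unitHom_comp : unitHom E ≫ E.hom = 𝟙 _ := Over.w (η[E] : 𝟙_ _ ⟶ E)

lemma comp_mulBy {T : Over (Spec (.of ℂ))} (f : T ⟶ E) (n : ℕ) : f ≫ mulBy E n = f ^ n := by
  rw [mulBy, comp_pow, Category.comp_id]

lemma one_eq_unit : (1 : 𝟙_ (Over (Spec (.of ℂ))) ⟶ E) = η := by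
  rw [Hom.one_def, toUnit_unit, Category.id_comp]

lemma mulBy_unitPt (n : ℕ) : (mulBy E n).left (unitPt E) = unitPt E := by
  have h : (η : 𝟙_ (Over (Spec (.of ℂ))) ⟶ E) ≫ mulBy E n = η := by
    rw [comp_mulBy, ← one_eq_unit, one_pow]
  have h' : unitHom E ≫ (mulBy E n).left = unitHom E := congrArg (·.left) h
  exact congrArg (fun q : Spec (.of ℂ) ⟶ E.left => q (IsLocalRing.closedPoint ℂ)) h'

variable (E) in
/-- There is a nonzero tangent vector at the unit. -/
lemma exists_tangent_unit [SmoothOfRelativeDimension 1 E.hom] :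
    ∃ v : tanObj ℂ ⟶ E, tanPoint ℂ ≫ v = η ∧
      ∃ (V : E.left.Opens) (h : ⊤ ≤ vecHom v ⁻¹ᵁ V) (f : Γ(E.left, V)),
        pullSection (vecHom v) h f = inr 1 := by
  obtain ⟨v, hv, hp, V, h, f, hf⟩ := exists_tangent E.hom (unitHom_comp (E := E))
  exact ⟨Over.homMk v hv, by ext1; exact hp, V, h, f, hf⟩

/-- Multiplication by `n` acts on tangent vectors as multiplication by `n`. -/
lemma pullSection_mulBy {v : tanObj ℂ ⟶ E} (hv : tanPoint ℂ ≫ v = η) (n : ℕ) {U : E.left.Opens}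
    (h : ⊤ ≤ vecHom v ⁻¹ᵁ U) (h' : ⊤ ≤ vecHom (v ^ n) ⁻¹ᵁ U) (f : Γ(E.left, U)) :
    pullSection (vecHom (v ^ n)) h' f =
      TrivSqZeroExt.map (n • LinearMap.id : ℂ →ₗ[ℂ] ℂ) (pullSection (vecHom v) h f) := by
  have h1 : vecHom (v ^ n) = (tanMap (n • LinearMap.id : ℂ →ₗ[ℂ] ℂ)).left ≫ vecHom v :=
    congrArg (·.left) (tangent_pow hv n)
  refine Eq.trans (pullSection_congr h1 h'
    (fun y _ => h (x := (tanMap (n • LinearMap.id : ℂ →ₗ[ℂ] ℂ)).left y) trivial) f) ?_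
  exact pullSection_SpecMap_comp
    (TrivSqZeroExt.map (n • LinearMap.id : ℂ →ₗ[ℂ] ℂ) : Dual ℂ →+* Dual ℂ) (vecHom v) h _ f

lemma le_preimage_pow {v : tanObj ℂ ⟶ E} (hv : tanPoint ℂ ≫ v = η) (n : ℕ) {U : E.left.Opens}
    (h : ⊤ ≤ vecHom v ⁻¹ᵁ U) : ⊤ ≤ vecHom (v ^ n) ⁻¹ᵁ U := by
  rw [tangent_pow hv n]
  exact fun y _ => h (x := (tanMap (n • LinearMap.id : ℂ →ₗ[ℂ] ℂ)).left y) trivial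

lemma pow_ne_one_of_tangent {v : tanObj ℂ ⟶ E} (hv : tanPoint ℂ ≫ v = η) {V : E.left.Opens}
    (h : ⊤ ≤ vecHom v ⁻¹ᵁ V) (f : Γ(E.left, V)) (hf : pullSection (vecHom v) h f = inr 1) {n : ℕ}
    (hn : n ≠ 0) : v ^ n ≠ 1 := by
  intro h2
  have h2' : v ^ n = v ^ 0 := h2.trans (pow_zero v).symm
  have h3 := pullSection_congr (congrArg vecHom h2') (le_preimage_pow hv n h)
    (le_preimage_pow hv 0 h) f
  rw [pullSection_mulBy hv n h, pullSection_mulBy hv 0 h, hf, map_inr, map_inr] at h3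
  have h4 : (n • LinearMap.id : ℂ →ₗ[ℂ] ℂ) 1 = (0 • LinearMap.id : ℂ →ₗ[ℂ] ℂ) 1 := inr_injective h3
  rw [zero_smul, LinearMap.smul_apply, LinearMap.id_apply, LinearMap.zero_apply, nsmul_eq_mul,
    _root_.mul_one, Nat.cast_eq_zero] at h4
  exact hn h4

lemma mulBy_ne_one [SmoothOfRelativeDimension 1 E.hom] {n : ℕ} (hn : n ≠ 0) : mulBy E n ≠ 1 := by
  obtain ⟨v, hv, V, h, f, hf⟩ := exists_tangent_unit E
  intro h1
  refine pow_ne_one_of_tangent hv h f hf hn ?_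
  rw [← comp_mulBy, h1, comp_one]

section

variable [IsIntegral E.left] [SmoothOfRelativeDimension 1 E.hom] [IsProper E.hom]

omit [SmoothOfRelativeDimension 1 E.hom] in
lemma eq_one_of_forall_apply_eq {q : E ⟶ E} (h : ∀ x, q.left x = unitPt E) : q = 1 := by
  ext1
  have hw : q.left ≫ E.hom = (1 : E ⟶ E).left ≫ E.hom := by rw [Over.w, Over.w]
  have : LocallyOfFiniteType (q.left ≫ E.hom) := by
    rw [Over.w]
    infer_instance
  refine ext_of_apply_eq E.hom Set.univ isClosed_univ.isLocallyClosed dense_univ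
    (fun x _ _ => ?_) hw
  rw [h]
  have : (1 : E ⟶ E).left = E.hom ≫ unitHom E := congrArg (·.left) (Hom.one_def (X := E) (M := E))
  rw [this]
  exact congrArg (unitHom E) (Subsingleton.elim (IsLocalRing.closedPoint ℂ) (E.hom x))

lemma mulBy_genericPoint {n : ℕ} (hn : n ≠ 0) :
    (mulBy E n).left (genericPoint E.left) = genericPoint E.left := by
  by_contra hne
  have hcl := isClosed_singleton_of_ne_genericPoint E.hom hne
  have huniv : ∀ x, (mulBy E n).left x = (mulBy E n).left (genericPoint E.left) := by
    intro x
    have hx : genericPoint E.left ⤳ x := (genericPoint_spec E.left).specializes trivial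
    exact (hx.map (mulBy E n).left.continuous).mem_closed hcl rfl
  refine mulBy_ne_one (E := E) hn (eq_one_of_forall_apply_eq fun x => ?_)
  rw [huniv x, ← huniv (unitPt E), mulBy_unitPt]

omit [IsIntegral E.left] [SmoothOfRelativeDimension 1 E.hom] in
variable (E) in
lemma isClosed_unitPt : IsClosed {unitPt E} := by
  have h : unitPt E ∈ closedPoints E.left :=
    (pointEquivClosedPoint E.hom ⟨unitHom E, unitHom_comp⟩).2
  exact h

variable (E) in
lemma unitPt_ne_genericPoint : unitPt E ≠ genericPoint E.left := by
  intro h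
  have hcl := isClosed_unitPt E
  rw [h] at hcl
  have := isDiscreteValuationRing_stalk E.hom hcl
  exact IsDiscreteValuationRing.not_isField (E.left.presheaf.stalk (genericPoint E.left))
    (Field.toIsField E.left.functionField)

/-- The torsion points of given order form a finite set. -/
lemma finite_mulBy_preimage {n : ℕ} (hn : n ≠ 0) :
    ((mulBy E n).left ⁻¹' {unitPt E}).Finite := by
  refine finite_of_isClosed E.hom ((isClosed_unitPt E).preimage (mulBy E n).left.continuous) ?_
  intro h
  exact mulBy_ne_one hn (eq_one_of_forall_apply_eq fun x => h.ge (Set.mem_univ x))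

end

end TangentGroup

/-! ### Eigenfunctions of an endomorphism of a curve -/

section Eigenfunction

open TopologicalSpace Opposite Limits TrivSqZeroExt

variable {X : Scheme.{0}} [IsIntegral X] (s : X ⟶ Spec (.of ℂ)) [SmoothOfRelativeDimension 1 s]

lemma val_pow_sub_pow_lt_one {x : X} {a b : X.functionField} (ha : val s x a ≤ 1)
    (hb : val s x b ≤ 1) (hab : val s x (a - b) < 1) (m : ℕ) : val s x (a ^ m - b ^ m) < 1 := by
  induction m with
  | zero => simp
  | succ m ih =>
    have h : a ^ (m + 1) - b ^ (m + 1) = a ^ m * (a - b) + (a ^ m - b ^ m) * b := by ring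
    rw [h]
    refine (Valuation.map_add _ _ _).trans_lt (max_lt ?_ ?_)
    · rw [map_mul, map_pow]
      exact (mul_le_of_le_one_left' (pow_le_one' ha m)).trans_lt hab
    · rw [map_mul]
      exact (mul_le_of_le_one_right' hb).trans_lt ih

/-- Let `q` be an endomorphism of a smooth proper curve such that `e` is the only point mapped to
`e`, and which multiplies tangent vectors at `e` by a number `d` that is not a root of unity. Then
pulling back along `q` has a nonconstant eigenfunction regular outside `e`. Let `f` be regular
outside `e`, with a pole at `e` of least possible order `m + 1`. Its leading coefficient is
multiplied by `a = d⁻¹ ^ (m + 1)`, so the pullback of `f` differs from `a f` by a function with a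
pole of smaller order, which is a constant. As `a ≠ 1`, adding a constant to `f` gives an
eigenfunction. -/
lemma exists_eigenfunction [IsProper s] {q : X ⟶ X} (hq : q (genericPoint X) = genericPoint X)
    (hqs : q ≫ s = s) {e : X} (he : IsClosed {e}) (hqe : ∀ x, q x = e ↔ x = e)
    {t : X.functionField} (ht0 : t ≠ 0)
    (htu : ∀ g, val s e g < 1 → ∃ h, val s e h ≤ 1 ∧ g = t * h) (ht : val s e t < 1) {d : ℂ}
    (hd0 : d ≠ 0) (hd : ∀ m ≠ 0, d ^ m ≠ 1)
    (hT : ∃ h, val s e h < 1 ∧ pullFF hq t = t * (constFF s d + h)) :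
    ∃ (f : X.functionField) (a : ℂ), a ≠ 0 ∧ (∀ c, f ≠ constFF s c) ∧
      (∀ x ≠ e, val s x f ≤ 1) ∧ pullFF hq f = constFF s a * f := by
  obtain ⟨h, hh, hTt⟩ := hT
  obtain ⟨w, hw⟩ : ∃ w, w = constFF s d + h := ⟨_, rfl⟩
  rw [← hw] at hTt
  have hwd : val s e (constFF s d - w) < 1 := by
    rw [hw, sub_add_cancel_left, Valuation.map_neg]
    exact hh
  have hw1 : val s e w = 1 := by
    rw [hw, Valuation.map_add_eq_of_lt_left _ (by rwa [val_constFF s e hd0]), val_constFF s e hd0]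
  have hqe' : q e = e := (hqe e).2 rfl
  have hex : ∃ m : ℕ, ∃ f, (∀ x ≠ e, val s x f ≤ 1) ∧ 1 < val s e f ∧ val s e (f * t ^ m) ≤ 1 := by
    obtain ⟨f, hf⟩ := exists_forall_one_lt_val_iff_eq s he
    obtain ⟨m, hm⟩ := exists_val_mul_pow_le_one s he ht f
    exact ⟨m, f, fun x hx => not_lt.1 fun h => hx ((hf x).1 h), (hf e).2 rfl, hm m le_rfl⟩
  classical
  obtain ⟨f, hreg, hpole, hfm⟩ := Nat.find_spec hex
  have hmin := fun m => Nat.find_min hex (m := m)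
  generalize Nat.find hex = m at hfm hmin
  obtain ⟨m, rfl⟩ : ∃ m', m = m' + 1 := by
    refine Nat.exists_eq_succ_of_ne_zero ?_
    rintro rfl
    rw [pow_zero, _root_.mul_one] at hfm
    exact absurd hfm (not_le.2 hpole)
  obtain ⟨u, hu⟩ : ∃ u, u = f * t ^ (m + 1) := ⟨_, rfl⟩
  rw [← hu] at hfm
  have hTu : pullFF hq f * t ^ (m + 1) * w ^ (m + 1) = pullFF hq u := by
    rw [hu, map_mul, map_pow, hTt]
    ring
  have hTuu : val s e (pullFF hq u - u) < 1 := by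
    obtain ⟨c, hc⟩ := exists_val_sub_constFF_lt_one s he hfm
    have h1 : val s e (pullFF hq (u - constFF s c)) < 1 :=
      val_pullFF_lt_one s hq (by rwa [hqe'])
    have h2 : pullFF hq u - u = pullFF hq (u - constFF s c) - (u - constFF s c) := by
      rw [map_sub, pullFF_constFF s hq hqs]
      ring
    rw [h2]
    exact (Valuation.map_sub _ _ _).trans_lt (max_lt h1 hc)
  obtain ⟨a, ha⟩ : ∃ a : ℂ, a = (d ^ (m + 1))⁻¹ := ⟨_, rfl⟩
  have ha0 : a ≠ 0 := ha ▸ inv_ne_zero (pow_ne_zero _ hd0)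
  have hda : constFF s d ^ (m + 1) * constFF s a = 1 := by
    rw [← map_pow, ← map_mul, ha, mul_inv_cancel₀ (pow_ne_zero _ hd0), map_one]
  have ha1 : a - 1 ≠ 0 := by
    rw [sub_ne_zero, ha, ne_eq, inv_eq_one]
    exact hd _ m.succ_ne_zero
  -- The leading terms of the pullback of `f` and of `a f` agree.
  obtain ⟨g, hg⟩ : ∃ g, g = pullFF hq f - constFF s a * f := ⟨_, rfl⟩
  have hgt : val s e (g * t ^ (m + 1)) < 1 := by
    have h1 : val s e (g * t ^ (m + 1)) =
        val s e (g * t ^ (m + 1) * (constFF s d * w) ^ (m + 1)) := by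
      rw [map_mul _ _ ((constFF s d * w) ^ (m + 1)), map_pow _ (constFF s d * w), map_mul _ _ w,
        val_constFF s e hd0, hw1, _root_.mul_one, one_pow, _root_.mul_one]
    have h2 : g * t ^ (m + 1) * (constFF s d * w) ^ (m + 1) =
        constFF s d ^ (m + 1) * (pullFF hq u - u) +
          u * (constFF s d ^ (m + 1) - w ^ (m + 1)) := by
      rw [← hTu, hg, hu]
      linear_combination (-(f * t ^ (m + 1) * w ^ (m + 1))) * hda
    rw [h1, h2]
    refine (Valuation.map_add _ _ _).trans_lt (max_lt ?_ ?_)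
    · rw [map_mul, map_pow]
      exact (mul_le_of_le_one_left' (pow_le_one' (val_constFF_le_one s e d) _)).trans_lt hTuu
    · rw [map_mul]
      exact (mul_le_of_le_one_left' hfm).trans_lt
        (val_pow_sub_pow_lt_one s (val_constFF_le_one s e d) hw1.le hwd _)
  have hgreg : ∀ x ≠ e, val s x g ≤ 1 := by
    intro x hx
    rw [hg]
    refine (Valuation.map_sub _ _ _).trans (max_le ?_ ?_)
    · exact val_pullFF_le_one s hq (hreg _ fun h => hx ((hqe x).1 h))
    · rw [map_mul]
      exact mul_le_one' (val_constFF_le_one s x a) (hreg x hx)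
  have hge : val s e g ≤ 1 := by
    by_contra hge
    refine hmin m m.lt_succ_self ⟨g, hgreg, not_le.1 hge, ?_⟩
    obtain ⟨k, hk, hgk⟩ := htu _ hgt
    have : g * t ^ m = k := mul_left_cancel₀ ht0 (by rw [← hgk]; ring)
    rwa [this]
  obtain ⟨b, hb⟩ := exists_eq_constFF s (g := g) fun x => by
    by_cases hx : x = e
    · exact hx ▸ hge
    · exact hgreg x hx
  obtain ⟨c, hc⟩ : ∃ c : ℂ, b + c = a * c := ⟨b / (a - 1), by field_simp; ring⟩
  have hc' := congrArg (constFF s) hc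
  rw [map_add, map_mul] at hc'
  refine ⟨f + constFF s c, a, ha0, fun c' hc'' => ?_, fun x hx => ?_, ?_⟩
  · refine ne_constFF_of_one_lt_val s hpole (c' - c) ?_
    rw [map_sub, ← hc'', add_sub_cancel_right]
  · exact (Valuation.map_add _ _ _).trans (max_le (hreg x hx) (val_constFF_le_one s x c))
  · rw [map_add, pullFF_constFF s hq hqs]
    linear_combination hc' + hb - hg

/-- The zeros of an eigenfunction form a finite set stable under the endomorphism. -/
lemma exists_finite_mapsTo [IsProper s] {q : X ⟶ X} (hq : q (genericPoint X) = genericPoint X)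
    {e : X} (hqe : ∀ x, q x = e ↔ x = e) {f : X.functionField} {a : ℂ} (ha : a ≠ 0)
    (hf : ∀ c, f ≠ constFF s c) (hreg : ∀ x ≠ e, val s x f ≤ 1)
    (hT : pullFF hq f = constFF s a * f) :
    ∃ Z : Set X, Z.Finite ∧ Z.Nonempty ∧ e ∉ Z ∧ (∀ x ∈ Z, IsClosed {x}) ∧ Set.MapsTo q Z Z := by
  have hf0 : f ≠ 0 := by simpa using hf 0
  have hiff : ∀ x, val s x f < 1 ↔ 1 < val s x f⁻¹ := by
    intro x
    rw [map_inv₀]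
    exact (one_lt_inv₀ (zero_lt_iff.2 ((Valuation.ne_zero_iff _).2 hf0))).symm
  have hpole : ¬ val s e f ≤ 1 := by
    intro he
    obtain ⟨c, hc⟩ := exists_eq_constFF s (g := f) fun x => by
      by_cases hx : x = e
      · exact hx ▸ he
      · exact hreg x hx
    exact hf c hc
  refine ⟨{x | val s x f < 1}, ?_, ?_, fun h => hpole (le_of_lt h), fun x hx =>
    isClosed_singleton_of_one_lt_val s ((hiff x).1 hx), fun x hx => ?_⟩
  · simp only [hiff]
    exact finite_setOf_one_lt_val s f⁻¹
  · by_contra hne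
    rw [Set.not_nonempty_iff_eq_empty, Set.eq_empty_iff_forall_notMem] at hne
    obtain ⟨c, hc⟩ := exists_eq_constFF s (g := f⁻¹) fun x =>
      not_lt.1 fun h => hne x ((hiff x).2 h)
    exact hf c⁻¹ (by rw [map_inv₀, ← hc, inv_inv])
  · have hxe : x ≠ e := by
      rintro rfl
      exact hpole (le_of_lt hx)
    have hqx := hreg (q x) fun h => hxe ((hqe x).1 h)
    refine lt_of_le_of_ne hqx fun h => ?_
    have h1 := (val_pullFF_eq_one_iff s hq hqx).2 h
    rw [hT, map_mul, val_constFF s x ha, _root_.one_mul] at h1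
    exact (ne_of_lt hx) h1

/-- The derivative of a function vanishing at a point, in terms of that of a uniformizer `t`. -/
lemma exists_eq_mul_and_snd_eq {v : Spec (.of (Dual ℂ)) ⟶ X} {p : Spec (.of ℂ) ⟶ X}
    (hv : Spec.map (CommRingCat.ofHom (fstHom ℂ ℂ ℂ : Dual ℂ →+* ℂ)) ≫ v = p)
    {U : X.Opens} (hU : p (IsLocalRing.closedPoint ℂ) ∈ U) (hvU : ⊤ ≤ v ⁻¹ᵁ U) (t : Γ(X, U))
    (htu : ∀ g, val s (p (IsLocalRing.closedPoint ℂ)) g < 1 →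
      ∃ h, val s (p (IsLocalRing.closedPoint ℂ)) h ≤ 1 ∧ g = toFF hU t * h)
    (ht : val s (p (IsLocalRing.closedPoint ℂ)) (toFF hU t) < 1)
    {W : X.Opens} (hW : p (IsLocalRing.closedPoint ℂ) ∈ W) (hvW : ⊤ ≤ v ⁻¹ᵁ W) (f : Γ(X, W))
    (hf : val s (p (IsLocalRing.closedPoint ℂ)) (toFF hW f) < 1) :
    ∃ (h : X.functionField) (c : ℂ), toFF hW f = toFF hU t * h ∧
      (pullSection v hvW f).snd = (pullSection v hvU t).snd * c ∧
      (c = 0 → val s (p (IsLocalRing.closedPoint ℂ)) h < 1) := by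
  obtain ⟨h, hh, hfh⟩ := htu _ hf
  obtain ⟨V, hV, h', rfl⟩ := exists_toFF_eq_of_val_le_one s hh
  have hvV := le_preimage_of_fst hv hV
  have hI : p (IsLocalRing.closedPoint ℂ) ∈ W ⊓ (U ⊓ V) := ⟨hW, hU, hV⟩
  have hvI := le_preimage_of_fst hv hI
  have hIU : W ⊓ (U ⊓ V) ≤ U := inf_le_right.trans inf_le_left
  have hIV : W ⊓ (U ⊓ V) ≤ V := inf_le_right.trans inf_le_right
  have heq : X.presheaf.map (homOfLE inf_le_left).op f =
      X.presheaf.map (homOfLE hIU).op t * X.presheaf.map (homOfLE hIV).op h' := by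
    apply toFF_injective hI
    refine (toFF_map inf_le_left hW hI f).trans (hfh.trans ?_)
    refine Eq.trans ?_ (map_mul (toFF hI) _ _).symm
    exact (congrArg₂ (· * ·) (toFF_map hIU hU hI t) (toFF_map hIV hV hI h')).symm
  have hpull : pullSection v hvW f = pullSection v hvU t * pullSection v hvV h' := by
    have h1 := congrArg (pullSection v hvI) heq
    rw [pullSection_map v inf_le_left hvI hvW, map_mul] at h1
    exact h1.trans (congrArg₂ (· * ·) (pullSection_map v hIU hvI hvU t)
      (pullSection_map v hIV hvI hvV h'))
  have hfst : (pullSection v hvU t).fst = 0 := by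
    rw [fst_pullSection hv hvU hU]
    by_contra hne
    rw [← ne_eq, evalPoint_ne_zero_iff] at hne
    exact (val_toFF_lt_one_iff s hU hU t).1 ht hne
  refine ⟨_, (pullSection v hvV h').fst, hfh, ?_, fun h0 => ?_⟩
  · rw [hpull, snd_mul, hfst, zero_smul, zero_add]
    rfl
  · rw [val_toFF_lt_one_iff s hV hV, ← evalPoint_ne_zero_iff p hV, not_not,
      ← fst_pullSection hv hvV hV, h0]

end Eigenfunction

/-! ### Existence of torsion points -/

section Torsion

open TopologicalSpace Opposite Limits TrivSqZeroExt

variable {E : Over (Spec (.of ℂ))} [GrpObj E] [IsIntegral E.left]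
  [SmoothOfRelativeDimension 1 E.hom]

/-- Multiplication by `n` multiplies a uniformizer at the unit by `n`, up to terms of higher
order. -/
lemma exists_pullFF_mulBy_eq [IsProper E.hom] {n : ℕ} (hn : n ≠ 0) {t : E.left.functionField}
    (htu : ∀ g, val E.hom (unitPt E) g < 1 → ∃ h, val E.hom (unitPt E) h ≤ 1 ∧ g = t * h)
    (ht : val E.hom (unitPt E) t < 1) :
    ∃ h, val E.hom (unitPt E) h < 1 ∧
      pullFF (mulBy_genericPoint (E := E) hn) t = t * (constFF E.hom n + h) := by
  obtain ⟨v, hv, V, hV, f, hf⟩ := exists_tangent_unit E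
  have hv' : Spec.map (CommRingCat.ofHom (fstHom ℂ ℂ ℂ : Dual ℂ →+* ℂ)) ≫ vecHom v = unitHom E :=
    congrArg (·.left) hv
  obtain ⟨U, hU, t, rfl⟩ := exists_toFF_eq_of_val_le_one E.hom ht.le
  have hvU := le_preimage_of_fst hv' hU
  have hVmem : unitPt E ∈ V := by
    have h1 := hV (x := Spec.map (CommRingCat.ofHom (fstHom ℂ ℂ ℂ : Dual ℂ →+* ℂ))
      (IsLocalRing.closedPoint ℂ)) trivial
    have h2 : (Spec.map (CommRingCat.ofHom (fstHom ℂ ℂ ℂ : Dual ℂ →+* ℂ)) ≫ vecHom v)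
      (IsLocalRing.closedPoint ℂ) ∈ V := h1
    rw [hv'] at h2
    exact h2
  -- The uniformizer has a nonzero derivative.
  have hsnd : (pullSection (vecHom v) hvU t).snd ≠ 0 := by
    have hfv : val E.hom (unitPt E) (toFF hVmem f) < 1 := by
      rw [val_toFF_lt_one_iff E.hom hVmem hVmem]
      intro hmem
      have h1 := (evalPoint_ne_zero_iff (unitHom E) hVmem f).2 hmem
      exact h1 ((fst_pullSection hv' hV hVmem f).symm.trans (congrArg TrivSqZeroExt.fst hf))
    obtain ⟨h, c, -, hc, -⟩ := exists_eq_mul_and_snd_eq E.hom hv' hU hvU t htu ht hVmem hV f hfv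
    rw [hf] at hc
    intro h0
    rw [h0, zero_mul] at hc
    exact one_ne_zero hc
  let q := (mulBy E n).left
  have hqe : q (unitPt E) = unitPt E := mulBy_unitPt n
  have hqU : unitPt E ∈ q ⁻¹ᵁ U := by
    change q (unitPt E) ∈ U
    rwa [hqe]
  have hW : unitPt E ∈ U ⊓ q ⁻¹ᵁ U := ⟨hU, hqU⟩
  have hvq := le_preimage_of_fst hv' hqU
  have hvW := le_preimage_of_fst hv' hW
  let g : Γ(E.left, U ⊓ q ⁻¹ᵁ U) := E.left.presheaf.map (homOfLE inf_le_right).op (q.app U t) -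
    n • E.left.presheaf.map (homOfLE inf_le_left).op t
  have hg : toFF hW g = pullFF (mulBy_genericPoint (E := E) hn) (toFF hU t) - n • toFF hU t := by
    refine (map_sub (toFF hW) _ _).trans (congrArg₂ (· - ·) ?_ ?_)
    · exact (toFF_map inf_le_right hqU hW _).trans
        (pullFF_toFF (mulBy_genericPoint (E := E) hn) hU hqU t).symm
    · exact (map_nsmul (toFF hW) _ _).trans (congrArg (n • ·) (toFF_map inf_le_left hU hW _))
  have hpull : (pullSection (vecHom v) hvW g).snd = 0 := by
    have hvn := le_preimage_pow hv n hvU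
    have hcomp : vecHom (v ^ n) = vecHom v ≫ q := congrArg (·.left) (comp_mulBy v n).symm
    have h1 : pullSection (vecHom v) hvq (q.app U t) =
        TrivSqZeroExt.map (n • LinearMap.id : ℂ →ₗ[ℂ] ℂ) (pullSection (vecHom v) hvU t) := by
      rw [← pullSection_mulBy hv n hvU hvn t]
      refine Eq.symm ((pullSection_congr hcomp hvn (fun y _ => hvq (x := y) trivial) t).trans ?_)
      rw [Scheme.Hom.app_eq_appLE]
      exact pullSection_comp _ _ _ _ _ _
    have h2 : pullSection (vecHom v) hvW g =
        pullSection (vecHom v) hvq (q.app U t) - n • pullSection (vecHom v) hvU t := by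
      refine (map_sub (pullSection (vecHom v) hvW) _ _).trans (congrArg₂ (· - ·) ?_ ?_)
      · exact pullSection_map _ inf_le_right hvW hvq _
      · exact (map_nsmul (pullSection (vecHom v) hvW) _ _).trans
          (congrArg (n • ·) (pullSection_map _ inf_le_left hvW hvU _))
    rw [h2, h1, snd_sub, snd_map, snd_smul]
    simp
  have hgv : val E.hom (unitPt E) (toFF hW g) < 1 := by
    rw [hg, nsmul_eq_mul]
    refine (Valuation.map_sub _ _ _).trans_lt (max_lt ?_ ?_)
    · refine val_pullFF_lt_one E.hom (mulBy_genericPoint (E := E) hn) ?_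
      rw [mulBy_unitPt]
      exact ht
    · rw [map_mul, ← map_natCast (constFF E.hom)]
      exact (mul_le_of_le_one_left' (val_constFF_le_one _ _ _)).trans_lt ht
  obtain ⟨h, c, hgh, hc, hc0⟩ := exists_eq_mul_and_snd_eq E.hom hv' hU hvU t htu ht hW hvW g hgv
  rw [hpull, zero_eq_mul] at hc
  refine ⟨h, hc0 (hc.resolve_left hsnd), ?_⟩
  have hgh' := hg.symm.trans hgh
  rw [nsmul_eq_mul] at hgh'
  rw [map_natCast]
  refine (sub_eq_iff_eq_add.1 hgh').trans ?_
  rw [mul_add, add_comm, mul_comm (n : E.left.functionField)]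
  rfl

variable (E) in
/-- The group has a nontrivial torsion point. -/
theorem exists_torsion [IsProper E.hom] :
    ∃ p : 𝟙_ (Over (Spec (.of ℂ))) ⟶ E, p ≠ 1 ∧ IsOfFinOrder p := by
  by_contra hno
  push Not at hno
  -- A closed point, as a complex point.
  have hpt : ∀ x : E.left, IsClosed {x} → ∃ p : 𝟙_ (Over (Spec (.of ℂ))) ⟶ E,
      p.left (IsLocalRing.closedPoint ℂ) = x := fun x hx =>
    ⟨Over.homMk (pointOfClosedPoint E.hom x hx) (pointOfClosedPoint_comp E.hom x hx),
      pointOfClosedPoint_apply E.hom x hx _⟩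
  have hext : ∀ p p' : 𝟙_ (Over (Spec (.of ℂ))) ⟶ E, p.left (IsLocalRing.closedPoint ℂ) =
      p'.left (IsLocalRing.closedPoint ℂ) → p = p' := by
    intro p p' h
    ext1
    exact ext_of_apply_closedPoint_eq E.hom (Over.w p) (Over.w p') h
  have hmul : ∀ (p : 𝟙_ (Over (Spec (.of ℂ))) ⟶ E) (n : ℕ),
      (mulBy E n).left (p.left (IsLocalRing.closedPoint ℂ)) =
        (p ^ n).left (IsLocalRing.closedPoint ℂ) := by
    intro p n
    rw [← comp_mulBy]
    rfl
  have hunit : (1 : 𝟙_ (Over (Spec (.of ℂ))) ⟶ E).left (IsLocalRing.closedPoint ℂ) = unitPt E := by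
    rw [one_eq_unit]
    rfl
  have h2 : (2 : ℕ) ≠ 0 := two_ne_zero
  let q := (mulBy E 2).left
  have hq : q (genericPoint E.left) = genericPoint E.left := mulBy_genericPoint h2
  have hqe : ∀ x, q x = unitPt E ↔ x = unitPt E := by
    refine fun x => ⟨fun hx => ?_, fun hx => by
      rw [hx]
      exact mulBy_unitPt 2⟩
    have hxg : x ≠ genericPoint E.left := by
      rintro rfl
      exact unitPt_ne_genericPoint E (hx.symm.trans hq)
    obtain ⟨p, rfl⟩ := hpt x (isClosed_singleton_of_ne_genericPoint E.hom hxg)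
    have hp : p ^ 2 = 1 := hext _ _ (by rw [← hmul, hunit]; exact hx)
    have hp1 : p = 1 := by
      by_contra hp1
      exact hno p hp1 (isOfFinOrder_iff_pow_eq_one.2 ⟨2, two_pos, hp⟩)
    rw [hp1, hunit]
  obtain ⟨t, ht0, ht, htu⟩ := exists_uniformizer E.hom (isClosed_unitPt E)
  obtain ⟨f, a, ha, hf, hreg, hT⟩ := exists_eigenfunction E.hom hq (Over.w (mulBy E 2))
    (isClosed_unitPt E) hqe ht0 htu ht (d := (2 : ℕ)) (Nat.cast_ne_zero.2 h2)
    (fun m hm => by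
      rw [← Nat.cast_pow, ne_eq, Nat.cast_eq_one]
      exact (Nat.one_lt_two_pow hm).ne') (exists_pullFF_mulBy_eq h2 htu ht)
  obtain ⟨Z, hZ, ⟨x, hx⟩, heZ, hZc, hmaps⟩ := exists_finite_mapsTo E.hom hq hqe ha hf hreg hT
  obtain ⟨p, rfl⟩ := hpt x (hZc x hx)
  -- The points `2 ^ n p` are finite in number, so that `p` is a torsion point.
  have hiter : ∀ n : ℕ, (p ^ (2 ^ n)).left (IsLocalRing.closedPoint ℂ) ∈ Z := by
    intro n
    induction n with
    | zero => simpa using hx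
    | succ n ih =>
      rw [pow_succ, pow_mul, ← hmul]
      exact hmaps ih
  obtain ⟨m, n, hmn, heq⟩ : ∃ m n : ℕ, m < n ∧ p ^ (2 ^ m) = p ^ (2 ^ n) := by
    obtain ⟨m, n, hne, h⟩ := Set.Finite.exists_lt_map_eq_of_forall_mem (t := Z)
      (f := fun n : ℕ => (p ^ (2 ^ n)).left (IsLocalRing.closedPoint ℂ)) hiter hZ
    exact ⟨m, n, hne, hext _ _ h⟩
  refine hno p ?_ (isOfFinOrder_iff_pow_eq_one.2 ⟨2 ^ n - 2 ^ m, ?_, ?_⟩)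
  · rintro rfl
    rw [hunit] at hx
    exact heZ hx
  · exact Nat.sub_pos_of_lt (Nat.pow_lt_pow_right one_lt_two hmn)
  · rw [pow_sub _ (Nat.pow_le_pow_right two_pos hmn.le), ← heq, mul_inv_cancel]

end Torsion

/-! ### Characters of closed subgroups of the 2-torus -/

section TorusSubgroups

open Topology

/-- The characters `z₁ ^ a * z₂ ^ b` that are trivial on a subgroup of the torus. -/
def annihilator (H : Subgroup Torus) : AddSubgroup (ℤ × ℤ) where
  carrier := {a | ∀ g ∈ H, g.1 ^ a.1 * g.2 ^ a.2 = 1}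
  zero_mem' g _ := by simp
  add_mem' {a b} ha hb g hg := by
    rw [Prod.fst_add, Prod.snd_add, zpow_add, zpow_add, _root_.mul_mul_mul_comm, ha g hg, hb g hg,
      _root_.mul_one]
  neg_mem' {a} ha g hg := by
    rw [Prod.fst_neg, Prod.snd_neg, zpow_neg, zpow_neg, ← mul_inv, ha g hg, inv_one]

lemma annihilator_anti {H K : Subgroup Torus} (h : H ≤ K) : annihilator K ≤ annihilator H :=
  fun _ ha g hg => ha g (h hg)

lemma natCard_setOf_pow_eq_one (n : ℕ) [NeZero n] : Nat.card {z : Circle // z ^ n = 1} = n := by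
  refine Eq.trans ?_ (HasEnoughRootsOfUnity.natCard_rootsOfUnity Circle n)
  refine Nat.card_congr ⟨fun z => ⟨toUnits z.1, ?_⟩, fun z => ⟨z.1, ?_⟩, fun z => rfl, fun z => ?_⟩
  · rw [mem_rootsOfUnity, ← map_pow, z.2, map_one]
  · have := z.2
    rw [mem_rootsOfUnity] at this
    exact_mod_cast congrArg Units.val this
  · ext
    rfl

lemma finite_setOf_zpow_eq_one {n : ℤ} (hn : n ≠ 0) : {z : Circle | z ^ n = 1}.Finite := by
  have : NeZero n.natAbs := ⟨Int.natAbs_ne_zero.2 hn⟩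
  have h : Finite {z : Circle // z ^ n.natAbs = 1} :=
    Nat.finite_of_card_ne_zero (by rw [natCard_setOf_pow_eq_one]; exact NeZero.ne _)
  refine Set.Finite.subset (s := {z : Circle | z ^ n.natAbs = 1}) h fun z hz => ?_
  exact (pow_natAbs_eq_one (G := Circle)).2 hz

lemma eq_zero_of_forall_zpow_eq_one {n : ℤ} (h : ∀ z : Circle, z ^ n = 1) : n = 0 := by
  obtain ⟨z, hz⟩ := HasEnoughRootsOfUnity.exists_primitiveRoot Circle (n.natAbs + 1)
  have h1 := (hz.zpow_eq_one_iff_dvd n).1 (h z)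
  by_contra hne
  have h2 := Int.natAbs_dvd_natAbs.2 h1
  rw [Int.natAbs_natCast] at h2
  exact absurd (Nat.le_of_dvd (Int.natAbs_pos.2 hne) h2) (by omega)

lemma zpow_det_eq_one {G : Type*} [CommGroup G] {z w : G} {a b c d : ℤ} (h₁ : z ^ a * w ^ b = 1)
    (h₂ : z ^ c * w ^ d = 1) : z ^ (a * d - b * c) = 1 := by
  rw [zpow_sub, zpow_mul, mul_comm b, zpow_mul, eq_inv_of_mul_eq_one_left h₁,
    eq_inv_of_mul_eq_one_left h₂, inv_zpow, inv_zpow, ← zpow_mul, ← zpow_mul, mul_comm d,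
    inv_inv, inv_mul_cancel]

/-- Two linearly independent characters have only finitely many common zeros, so the characters
trivial on a nontrivial connected subgroup are pairwise dependent. -/
lemma IsDirection.det_eq_zero {L : Subgroup Torus} (hL : IsDirection L) {a b : ℤ × ℤ}
    (ha : a ∈ annihilator L) (hb : b ∈ annihilator L) : a.1 * b.2 - a.2 * b.1 = 0 := by
  by_contra hne
  have hfin : (L : Set Torus).Finite := by
    refine ((finite_setOf_zpow_eq_one hne).prod
      (finite_setOf_zpow_eq_one (neg_ne_zero.2 hne))).subset fun g hg =>
      ⟨zpow_det_eq_one (ha g hg) (hb g hg), ?_⟩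
    have h := zpow_det_eq_one ((mul_comm _ _).trans (ha g hg)) ((mul_comm _ _).trans (hb g hg))
    change g.2 ^ _ = 1
    rwa [neg_sub]
  refine hL.ne_bot ?_
  rw [Subgroup.eq_bot_iff_forall]
  intro g hg
  by_contra hg1
  exact hL.isConnected.isPreconnected.infinite_of_nontrivial ⟨g, hg, 1, one_mem L, hg1⟩ hfin

/-- The characters trivial on a one-dimensional connected subgroup are the multiples of one of
them. -/
lemma IsDirection.exists_generator {L : Subgroup Torus} (hL : IsDirection L) :
    ∃ α ∈ annihilator L, ∀ a ∈ annihilator L, ∃ k : ℤ, a = k • α := by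
  suffices h : IsAddCyclic (annihilator L) by
    obtain ⟨α, hα⟩ := h.exists_generator
    refine ⟨α, α.2, fun a ha => ?_⟩
    obtain ⟨k, hk⟩ := AddSubgroup.mem_zmultiples_iff.1 (hα ⟨a, ha⟩)
    exact ⟨k, (congrArg Subtype.val hk).symm⟩
  by_cases hfst : ∃ a ∈ annihilator L, a.1 ≠ 0
  · obtain ⟨a, ha, ha1⟩ := hfst
    refine isAddCyclic_of_injective ((AddMonoidHom.fst ℤ ℤ).comp (annihilator L).subtype) ?_
    rw [injective_iff_map_eq_zero]
    rintro ⟨b, hb⟩ hb1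
    have hb1' : b.1 = 0 := hb1
    have := hL.det_eq_zero ha hb
    rw [hb1', mul_zero, sub_zero] at this
    exact Subtype.ext (Prod.ext hb1' ((mul_eq_zero.1 this).resolve_left ha1))
  · push Not at hfst
    refine isAddCyclic_of_injective ((AddMonoidHom.snd ℤ ℤ).comp (annihilator L).subtype) ?_
    rw [injective_iff_map_eq_zero]
    rintro ⟨b, hb⟩ hb1
    exact Subtype.ext (Prod.ext (hfst b hb) hb1)

/-- The identity component of `H` is contained in every closed subgroup of finite index. -/
lemma IsAlong.le_of_relIndex_ne_zero {L H K : Subgroup Torus} {j : ℕ} (hH : IsAlong L j H)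
    (hK : IsClosed (K : Set Torus)) (hKH : K.relIndex H ≠ 0) : L ≤ K := by
  rw [← hH.identityComponent]
  rintro _ ⟨g, hg, rfl⟩
  have : (K.subgroupOf H).FiniteIndex := ⟨hKH⟩
  have hcl : IsClosed (K.subgroupOf H : Set H) := hK.preimage continuous_subtype_val
  have hclopen : IsClopen (K.subgroupOf H : Set H) :=
    ⟨hcl, (K.subgroupOf H).isOpen_of_isClosed_of_finiteIndex hcl⟩
  exact hclopen.connectedComponent_subset (one_mem (K.subgroupOf H)) hg

/-- A power of every element of `H` lies in the identity component. -/
lemma IsAlong.exists_pow_mem {L H : Subgroup Torus} {j : ℕ} (hH : IsAlong L j H) (hj : 1 ≤ j) :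
    ∃ m : ℕ, m ≠ 0 ∧ ∀ g ∈ H, g ^ m ∈ L := by
  have hfin : Finite (ConnectedComponents H) :=
    Nat.finite_of_card_ne_zero (by rw [hH.card_components]; omega)
  let C := Subgroup.connectedComponentOfOne H
  have hinj : Function.Injective (Quotient.lift (s := QuotientGroup.leftRel C)
      (fun g : H => (g : ConnectedComponents H)) (by
        intro g h hgh
        rw [ConnectedComponents.coe_eq_coe']
        have h1 : g⁻¹ * h ∈ connectedComponent (1 : H) := QuotientGroup.leftRel_apply.1 hgh
        have h2 := (continuous_const_mul g).image_connectedComponent_subset 1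
          ⟨_, h1, rfl⟩
        change g * (g⁻¹ * h) ∈ _ at h2
        rw [mul_inv_cancel_left, _root_.mul_one] at h2
        exact (connectedComponent_eq h2).symm ▸ mem_connectedComponent)) := by
    rintro ⟨g⟩ ⟨h⟩ hgh
    have h1 : (g : ConnectedComponents H) = h := hgh
    rw [ConnectedComponents.coe_eq_coe'] at h1
    have h2 := (continuous_const_mul h⁻¹).image_connectedComponent_subset h ⟨g, h1, rfl⟩
    change h⁻¹ * g ∈ _ at h2
    rw [inv_mul_cancel] at h2
    exact (QuotientGroup.eq.2 (show h⁻¹ * g ∈ C from h2)).symm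
  have : Finite (H ⧸ C) := Finite.of_injective _ hinj
  have hC : C.FiniteIndex := Subgroup.finiteIndex_of_finite_quotient
  refine ⟨C.index, hC.index_ne_zero, fun g hg => ?_⟩
  have := C.pow_index_mem (⟨g, hg⟩ : H)
  rw [← hH.identityComponent]
  exact ⟨_, this, rfl⟩

/-- The subgroup of the elements on which the `k`-th power of the character `p` is trivial. -/
def torsionKer (p : Torus →* Circle) (k : ℕ) : Subgroup Torus := ((powMonoidHom k).comp p).ker

lemma mem_torsionKer {p : Torus →* Circle} {k : ℕ} {g : Torus} :
    g ∈ torsionKer p k ↔ p g ^ k = 1 := Iff.rfl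

lemma ker_le_torsionKer (p : Torus →* Circle) (k : ℕ) : p.ker ≤ torsionKer p k := by
  intro g hg
  rw [mem_torsionKer, hg, one_pow]

variable {p : Torus →* Circle} {i σ : Circle →* Torus}

lemma isDirection_ker (hp : Continuous p) (hi : Continuous i) (hi' : Function.Injective i)
    (hpi : i.range = p.ker) (hσ : ∀ z, p (σ z) = z) : IsDirection p.ker := by
  obtain ⟨z, hz⟩ := HasEnoughRootsOfUnity.exists_primitiveRoot Circle 2
  have hz1 : z ≠ 1 := hz.ne_one one_lt_two
  refine ⟨isClosed_singleton.preimage hp, ?_, fun h => ?_, fun h => ?_⟩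
  · rw [← hpi, MonoidHom.coe_range]
    exact isConnected_range hi
  · rw [← hpi] at h
    have : i z ∈ (⊥ : Subgroup Torus) := h ▸ ⟨z, rfl⟩
    exact hz1 (hi' ((Subgroup.mem_bot.1 this).trans (map_one i).symm))
  · have : σ z ∈ p.ker := h ▸ Subgroup.mem_top _
    exact hz1 ((hσ z).symm.trans this)

lemma isAlong_torsionKer (hp : Continuous p) (hi : Continuous i)
    (hpi : i.range = p.ker) (hσ : ∀ z, p (σ z) = z) (k : ℕ) [NeZero k] :
    IsAlong p.ker k (torsionKer p k) := by
  have hfin : {z : Circle | z ^ k = 1}.Finite := by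
    have := finite_setOf_zpow_eq_one (n := k) (Nat.cast_ne_zero.2 (NeZero.ne k))
    simpa using this
  have : Finite {z : Circle // z ^ k = 1} := hfin
  -- The connected components are the fibres of `p`.
  let f : torsionKer p k → {z : Circle // z ^ k = 1} := fun g => ⟨p g, g.2⟩
  have hf : Continuous f := (hp.comp continuous_subtype_val).subtype_mk _
  have key : ∀ g h : torsionKer p k, g ∈ connectedComponent h ↔ p g = p h := by
    intro g h
    constructor
    · intro hgh
      have h1 := (isPreconnected_connectedComponent (x := h)).constant hf.continuousOn hgh
        mem_connectedComponent
      exact congrArg Subtype.val h1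
    · intro hgh
      have hmem : ∀ z, (h : Torus) * i z ∈ torsionKer p k := by
        intro z
        refine mul_mem h.2 (ker_le_torsionKer p k ?_)
        rw [← hpi]
        exact ⟨z, rfl⟩
      have hc : IsPreconnected (Set.range fun z => (⟨h * i z, hmem z⟩ : torsionKer p k)) :=
        isPreconnected_range ((continuous_const.mul hi).subtype_mk _)
      refine hc.subset_connectedComponent ⟨1, ?_⟩ ?_
      · exact Subtype.ext (show (h : Torus) * i 1 = h by rw [map_one, _root_.mul_one])
      · have : (h : Torus)⁻¹ * g ∈ i.range := by
          rw [hpi, MonoidHom.mem_ker, map_mul, map_inv, hgh, inv_mul_cancel]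
        obtain ⟨z, hz⟩ := this
        exact ⟨z, Subtype.ext (show (h : Torus) * i z = g by rw [hz, mul_inv_cancel_left])⟩
  refine ⟨?_, ?_, ?_⟩
  · exact isClosed_singleton.preimage (hp.pow k)
  · ext g
    constructor
    · rintro ⟨h, hh, rfl⟩
      have := (key h 1).1 hh
      rwa [OneMemClass.coe_one, map_one] at this
    · intro hg
      exact ⟨⟨g, ker_le_torsionKer p k hg⟩, (key _ 1).2 (by
        rw [OneMemClass.coe_one, map_one]; exact hg), rfl⟩
  · refine Eq.trans ?_ (natCard_setOf_pow_eq_one k)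
    refine Nat.card_congr (Equiv.ofBijective (Quotient.lift (s := connectedComponentSetoid _) f ?_)
      ⟨?_, ?_⟩)
    · intro g h hgh
      exact Subtype.ext ((key g h).1 (hgh ▸ mem_connectedComponent))
    · rintro ⟨g⟩ ⟨h⟩ hgh
      exact ConnectedComponents.coe_eq_coe'.2 ((key g h).2 (congrArg Subtype.val hgh))
    · rintro ⟨z, hz⟩
      exact ⟨((⟨σ z, by rw [mem_torsionKer, hσ, hz]⟩ : torsionKer p k) :
        _root_.ConnectedComponents _), Subtype.ext (hσ z)⟩

/-- A smaller power of the character `p` is trivial on every proper subgroup of `torsionKer p k`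
that contains the kernel of `p`. -/
lemma exists_pow_eq_one_of_lt_torsionKer {k : ℕ} [NeZero k] {K : Subgroup Torus}
    (hK : p.ker ≤ K) (hK' : K < torsionKer p k) :
    ∃ m : ℕ, m ≠ 0 ∧ m < k ∧ ∀ g ∈ K, p g ^ m = 1 := by
  have hfin : {z : Circle | z ^ k = 1}.Finite := by
    have := finite_setOf_zpow_eq_one (n := k) (Nat.cast_ne_zero.2 (NeZero.ne k))
    simpa using this
  have hsub : (K.map p : Set Circle) ⊆ {z : Circle | z ^ k = 1} := by
    rintro _ ⟨g, hg, rfl⟩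
    exact hK'.le hg
  have : Finite (K.map p) := hfin.subset hsub
  refine ⟨Nat.card (K.map p), Nat.card_pos.ne', ?_, fun g hg => ?_⟩
  · have hss : (K.map p : Set Circle) ⊂ {z : Circle | z ^ k = 1} := by
      refine ⟨hsub, fun h => hK'.not_ge fun g hg => ?_⟩
      obtain ⟨g', hg', hgg'⟩ := h (show p g ^ k = 1 from hg)
      have : g'⁻¹ * g ∈ K := hK (by rw [MonoidHom.mem_ker, map_mul, map_inv, hgg', inv_mul_cancel])
      have := mul_mem hg' this
      rwa [mul_inv_cancel_left] at this
    have h1 := Set.ncard_lt_ncard hss hfin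
    have h2 : {z : Circle | z ^ k = 1}.ncard = k := natCard_setOf_pow_eq_one k
    rw [h2] at h1
    exact h1
  · have := pow_card_eq_one' (x := (⟨p g, g, hg, rfl⟩ : K.map p))
    exact congrArg Subtype.val this

end TorusSubgroups

/-! ### The generating closed sets of the torsion point topology -/

section Generators

open TopologicalSpace Opposite Limits

variable (E : Over (Spec (.of ℂ))) [GrpObj E]

/-- The points `y` of `E` such that `k y` is the unit for all the multiples `k α` of `α` that are
trivial on `K`. -/
def ordSet (α : ℤ × ℤ) (K : Subgroup Torus) : Set E.left :=
  {y | ∀ k : ℤ, k • α ∈ annihilator K → (𝟙 E ^ k : E ⟶ E).left y = unitPt E}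

variable {E}

lemma mem_range_unit_iff (y : E.left) : y ∈ Set.range (η[E] : 𝟙_ _ ⟶ E).left ↔ y = unitPt E := by
  constructor
  · rintro ⟨z, rfl⟩
    exact congrArg (unitHom E) (Subsingleton.elim (α := PrimeSpectrum ℂ) z _)
  · rintro rfl
    exact ⟨_, rfl⟩

lemma comp_id_zpow {T : Over (Spec (.of ℂ))} (f : T ⟶ E) (k : ℤ) : f ≫ 𝟙 E ^ k = f ^ k := by
  rw [GrpObj.comp_zpow, Category.comp_id]

lemma mem_kerProj_smul_iff [IsCommMonObj E] (α : ℤ × ℤ) (k : ℤ) (x : chi E) :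
    x ∈ kerProj E (k • α).1 (k • α).2 ↔
      (𝟙 E ^ k : E ⟶ E).left ((proj E α.1 α.2).left x) = unitPt E := by
  have h : proj E (k • α).1 (k • α).2 = proj E α.1 α.2 ≫ 𝟙 E ^ k := by
    rw [comp_id_zpow, proj, proj, mul_zpow, ← zpow_mul, ← zpow_mul, Prod.smul_fst, Prod.smul_snd,
      smul_eq_mul, smul_eq_mul, mul_comm k, mul_comm k]
  refine (mem_range_unit_iff _).trans ?_
  rw [h]
  rfl

/-- If the characters trivial on `K` are multiples of `α`, then `𝔛(K)` is the preimage of a subset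
of `E` under the projection attached to `α`. -/
lemma var_eq_preimage [IsCommMonObj E] {α : ℤ × ℤ} {K : Subgroup Torus}
    (hα : ∀ a ∈ annihilator K, ∃ k : ℤ, a = k • α) :
    var E K = (proj E α.1 α.2).left ⁻¹' ordSet E α K := by
  ext x
  constructor
  · intro hx k hk
    exact (mem_kerProj_smul_iff α k x).1 (hx _ _ hk)
  · intro hx a b hab
    obtain ⟨k, hk⟩ := hα (a, b) hab
    have h := (mem_kerProj_smul_iff α k x).2 (hx k (hk ▸ hab))
    rw [← hk] at h
    exact h

variable (E) in
/-- The points in `ordSet E α H`, but not in `ordSet E α K` for any proper closed subgroup `K` of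
finite index. -/
def exactOrdSet (α : ℤ × ℤ) (H : Subgroup Torus) : Set E.left :=
  ordSet E α H \ ⋃ K ∈ {K : Subgroup Torus | IsClosed (K : Set Torus) ∧ K < H ∧ K.relIndex H ≠ 0},
    ordSet E α K

lemma bvar_eq_preimage [IsCommMonObj E] {α : ℤ × ℤ} {L H : Subgroup Torus} {j : ℕ}
    (hα : ∀ a ∈ annihilator L, ∃ k : ℤ, a = k • α) (hH : IsAlong L j H) :
    bvar E H = (proj E α.1 α.2).left ⁻¹' exactOrdSet E α H := by
  have hLH : L ≤ H := by
    rw [← hH.identityComponent]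
    exact Subgroup.map_subtype_le _
  rw [bvar, exactOrdSet, Set.preimage_sdiff, Set.preimage_iUnion₂,
    var_eq_preimage fun a ha => hα a (annihilator_anti hLH ha)]
  congr 1
  refine Set.iUnion₂_congr fun K hK => ?_
  exact var_eq_preimage fun a ha => hα a
    (annihilator_anti (hH.le_of_relIndex_ne_zero hK.1 hK.2.2) ha)

variable [IsIntegral E.left] [SmoothOfRelativeDimension 1 E.hom] [IsProper E.hom]

omit [IsIntegral E.left] [SmoothOfRelativeDimension 1 E.hom] [IsProper E.hom] in
lemma id_zpow_natCast (n : ℕ) : (𝟙 E ^ (n : ℤ) : E ⟶ E) = mulBy E n := zpow_natCast _ _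

omit [IsIntegral E.left] [SmoothOfRelativeDimension 1 E.hom] [IsProper E.hom] in
lemma exactOrdSet_subset {α : ℤ × ℤ} {H : Subgroup Torus} {m : ℕ}
    (hm : (m : ℤ) • α ∈ annihilator H) :
    exactOrdSet E α H ⊆ (mulBy E m).left ⁻¹' {unitPt E} := by
  intro y hy
  have := hy.1 m hm
  rwa [id_zpow_natCast] at this

lemma genericPoint_notMem_mulBy_preimage {m : ℕ} (hm : m ≠ 0) :
    genericPoint E.left ∉ (mulBy E m).left ⁻¹' {unitPt E} := by
  intro h
  have h1 : (mulBy E m).left (genericPoint E.left) = unitPt E := h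
  rw [mulBy_genericPoint hm] at h1
  exact unitPt_ne_genericPoint E h1.symm

/-- A set of torsion points of bounded order is closed, and its complement is affine if it is
nonempty. -/
lemma isClosed_and_isAffineOpen_of_subset {m : ℕ} (hm : m ≠ 0) {S : Set E.left}
    (hS : S ⊆ (mulBy E m).left ⁻¹' {unitPt E}) :
    ∃ h : IsClosed S, S.Nonempty → IsAffineOpen (⟨Sᶜ, h.isOpen_compl⟩ : E.left.Opens) := by
  have hfin : S.Finite := (finite_mulBy_preimage hm).subset hS
  have hgen : genericPoint E.left ∉ S := fun h => genericPoint_notMem_mulBy_preimage hm (hS h)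
  have hcl : IsClosed S := by
    rw [← Set.biUnion_of_singleton S]
    refine hfin.isClosed_biUnion fun x hx =>
      isClosed_singleton_of_ne_genericPoint E.hom fun h => hgen (h ▸ hx)
  refine ⟨hcl, fun hne => isAffineOpen_of_finite_compl E.hom ?_ ?_ hgen⟩
  · simpa using hfin
  · simpa [Set.nonempty_iff_ne_empty] using hne

/-- Every generating closed set is the preimage, under a homomorphism to `E`, of a finite set of
torsion points. -/
lemma exists_eq_preimage_of_mem_generatingClosed [IsCommMonObj E] {D : Set (chi E)}
    (hD : D ∈ generatingClosed E) :
    ∃ (π : E ⊗ E ⟶ E) (S : Set E.left) (h : IsClosed S), D = π.left ⁻¹' S ∧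
      (S.Nonempty → IsAffineOpen (⟨Sᶜ, h.isOpen_compl⟩ : E.left.Opens)) := by
  obtain ⟨L, j, H, hL, hj, hH, rfl⟩ := hD
  obtain ⟨α, hαL, hα⟩ := hL.exists_generator
  obtain ⟨m, hm, hmH⟩ := hH.exists_pow_mem hj
  have hmα : (m : ℤ) • α ∈ annihilator H := by
    intro g hg
    have := hαL _ (hmH g hg)
    simp only [Prod.pow_fst, Prod.pow_snd, ← zpow_natCast, ← zpow_mul] at this
    exact this
  obtain ⟨hcl, haff⟩ := isClosed_and_isAffineOpen_of_subset hm (exactOrdSet_subset (E := E) hmα)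
  exact ⟨proj E α.1 α.2, _, hcl, bvar_eq_preimage hα hH, haff⟩

omit [IsIntegral E.left] [SmoothOfRelativeDimension 1 E.hom] in
lemma left_closedPoint_eq_unitPt_iff (q : 𝟙_ (Over (Spec (.of ℂ))) ⟶ E) :
    q.left (IsLocalRing.closedPoint ℂ) = unitPt E ↔ q = 1 := by
  rw [one_eq_unit]
  constructor
  · intro h
    ext1
    exact ext_of_apply_closedPoint_eq E.hom (Over.w q) unitHom_comp h
  · rintro rfl
    rfl

omit [IsIntegral E.left] [SmoothOfRelativeDimension 1 E.hom] in
lemma id_zpow_left_eq_unitPt_iff (q : 𝟙_ (Over (Spec (.of ℂ))) ⟶ E) (k : ℤ) :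
    (𝟙 E ^ k : E ⟶ E).left (q.left (IsLocalRing.closedPoint ℂ)) = unitPt E ↔ q ^ k = 1 := by
  rw [← left_closedPoint_eq_unitPt_iff, ← comp_id_zpow q k]
  rfl

omit [IsIntegral E.left] [SmoothOfRelativeDimension 1 E.hom] in
lemma unitPt_mem_ordSet (α : ℤ × ℤ) (K : Subgroup Torus) : unitPt E ∈ ordSet E α K := by
  intro k _
  rw [← (left_closedPoint_eq_unitPt_iff (1 : 𝟙_ (Over (Spec (.of ℂ))) ⟶ E)).2 rfl,
    (left_closedPoint_eq_unitPt_iff (1 : 𝟙_ (Over (Spec (.of ℂ))) ⟶ E)).2 rfl]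
  conv_lhs => rw [← (left_closedPoint_eq_unitPt_iff (1 : 𝟙_ (Over (Spec (.of ℂ))) ⟶ E)).2 rfl]
  rw [id_zpow_left_eq_unitPt_iff, one_zpow]

lemma smul_mem_annihilator_iff {p : Torus →* Circle} {α : ℤ × ℤ}
    (hα : ∀ g : Torus, g.1 ^ α.1 * g.2 ^ α.2 = p g) (m : ℤ) (H : Subgroup Torus) :
    m • α ∈ annihilator H ↔ ∀ g ∈ H, p g ^ m = 1 := by
  refine forall₂_congr fun g _ => ?_
  rw [← hα, mul_zpow, ← zpow_mul, ← zpow_mul, mul_comm α.1, mul_comm α.2]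
  rfl

variable {p : Torus →* Circle} {i σ : Circle →* Torus} {α : ℤ × ℤ}

omit [IsIntegral E.left] [SmoothOfRelativeDimension 1 E.hom] in
/-- The unit is the only point of `E` of exact order one. -/
lemma exactOrdSet_ker (hp : Continuous p) (hi : Continuous i) (hpi : i.range = p.ker)
    (hσ : ∀ z, p (σ z) = z) (hα : ∀ g : Torus, g.1 ^ α.1 * g.2 ^ α.2 = p g) :
    exactOrdSet E α (torsionKer p 1) = {unitPt E} := by
  have hH := isAlong_torsionKer hp hi hpi hσ 1
  have hker : torsionKer p 1 = p.ker := by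
    ext g
    rw [mem_torsionKer, pow_one, MonoidHom.mem_ker]
  refine Set.Subset.antisymm (fun y hy => ?_) ?_
  · have h1 : (1 : ℤ) • α ∈ annihilator (torsionKer p 1) := by
      rw [smul_mem_annihilator_iff hα]
      intro g hg
      rwa [zpow_one, ← MonoidHom.mem_ker, ← hker]
    have := hy.1 1 h1
    rwa [zpow_one] at this
  · rintro _ rfl
    refine ⟨unitPt_mem_ordSet _ _, fun h => ?_⟩
    obtain ⟨K, hK, -⟩ := Set.mem_iUnion₂.1 h
    have hle := hH.le_of_relIndex_ne_zero hK.1 hK.2.2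
    rw [← hker] at hle
    exact hK.2.1.not_ge hle

omit [IsIntegral E.left] [SmoothOfRelativeDimension 1 E.hom] in
/-- The unit does not have exact order `k ≥ 2`. -/
lemma unitPt_notMem_exactOrdSet (hp : Continuous p)
    (hσ : ∀ z, p (σ z) = z) {k : ℕ} (hk : 2 ≤ k) :
    unitPt E ∉ exactOrdSet E α (torsionKer p k) := by
  have : NeZero k := ⟨by omega⟩
  intro h
  refine h.2 (Set.mem_iUnion₂.2 ⟨p.ker, ⟨isClosed_singleton.preimage hp, ?_, ?_⟩,
    unitPt_mem_ordSet _ _⟩)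
  · refine lt_of_le_of_ne (ker_le_torsionKer p k) fun h => ?_
    obtain ⟨z, hz⟩ := HasEnoughRootsOfUnity.exists_primitiveRoot Circle k
    have h1 : σ z ∈ torsionKer p k := by
      rw [mem_torsionKer, hσ, hz.pow_eq_one]
    rw [← h, MonoidHom.mem_ker, hσ] at h1
    exact hz.ne_one (by omega) h1
  · rw [Subgroup.relIndex, show p.ker.subgroupOf (torsionKer p k) =
      (p.comp (torsionKer p k).subtype).ker from rfl, Subgroup.index_ker]
    have hfin : ((p.comp (torsionKer p k).subtype).range : Set Circle).Finite := by
      refine (finite_setOf_zpow_eq_one (n := k) (by exact_mod_cast this.out)).subset ?_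
      rintro _ ⟨g, rfl⟩
      exact (zpow_natCast _ _).trans g.2
    have := hfin.to_subtype
    exact Nat.card_pos.ne'

omit [IsIntegral E.left] [SmoothOfRelativeDimension 1 E.hom] in
/-- A complex point of order `k` has exact order `k`. -/
lemma mem_exactOrdSet (hp : Continuous p) (hi : Continuous i) (hpi : i.range = p.ker)
    (hσ : ∀ z, p (σ z) = z) (hα : ∀ g : Torus, g.1 ^ α.1 * g.2 ^ α.2 = p g)
    {q : 𝟙_ (Over (Spec (.of ℂ))) ⟶ E} {k : ℕ} [NeZero k] (hq : orderOf q = k) :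
    q.left (IsLocalRing.closedPoint ℂ) ∈ exactOrdSet E α (torsionKer p k) := by
  have hH := isAlong_torsionKer hp hi hpi hσ k
  refine ⟨fun m hm => ?_, fun h => ?_⟩
  · rw [smul_mem_annihilator_iff hα] at hm
    obtain ⟨z, hz⟩ := HasEnoughRootsOfUnity.exists_primitiveRoot Circle k
    have h1 := hm (σ z) (by rw [mem_torsionKer, hσ, hz.pow_eq_one])
    rw [hσ] at h1
    rw [id_zpow_left_eq_unitPt_iff, ← orderOf_dvd_iff_zpow_eq_one, hq]
    exact (hz.zpow_eq_one_iff_dvd m).1 h1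
  · obtain ⟨K, hK, hqK⟩ := Set.mem_iUnion₂.1 h
    obtain ⟨m, hm, hmk, hKm⟩ := exists_pow_eq_one_of_lt_torsionKer
      (hH.le_of_relIndex_ne_zero hK.1 hK.2.2) hK.2.1
    have h1 := hqK m ((smul_mem_annihilator_iff hα m K).2 fun g hg => by
      rw [zpow_natCast]
      exact hKm g hg)
    rw [id_zpow_left_eq_unitPt_iff, ← orderOf_dvd_iff_zpow_eq_one, hq, Int.natCast_dvd_natCast]
      at h1
    exact absurd (Nat.le_of_dvd (Nat.pos_of_ne_zero hm) h1) (not_le.2 hmk)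

/-- Every point of `E` avoids one of the two sets of torsion points of exact order `1` and `k`,
where `k` is the order of some nontrivial torsion point. -/
lemma exists_bvar_eq_preimage [IsCommMonObj E] (hp : Continuous p) (hi : Continuous i)
    (hi' : Function.Injective i) (hpi : i.range = p.ker)
    (hσ : ∀ z, p (σ z) = z) (hα : ∀ g : Torus, g.1 ^ α.1 * g.2 ^ α.2 = p g)
    (hα' : ∀ a ∈ annihilator p.ker, ∃ k : ℤ, a = k • α) (y : E.left) :
    ∃ (S : Set E.left) (h : IsClosed S), y ∉ S ∧
      (proj E α.1 α.2).left ⁻¹' S ∈ generatingClosed E ∧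
      IsAffineOpen (⟨Sᶜ, h.isOpen_compl⟩ : E.left.Opens) := by
  have key : ∀ k : ℕ, k ≠ 0 → y ∉ exactOrdSet E α (torsionKer p k) →
      (exactOrdSet E α (torsionKer p k)).Nonempty → ∃ (S : Set E.left) (h : IsClosed S), y ∉ S ∧
      (proj E α.1 α.2).left ⁻¹' S ∈ generatingClosed E ∧
      IsAffineOpen (⟨Sᶜ, h.isOpen_compl⟩ : E.left.Opens) := by
    intro k hk hy hne
    have : NeZero k := ⟨hk⟩
    have hH := isAlong_torsionKer hp hi hpi hσ k
    have hk' : (k : ℤ) • α ∈ annihilator (torsionKer p k) := by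
      rw [smul_mem_annihilator_iff hα]
      intro g hg
      rw [zpow_natCast]
      exact hg
    obtain ⟨hcl, haff⟩ := isClosed_and_isAffineOpen_of_subset hk (exactOrdSet_subset (E := E) hk')
    exact ⟨_, hcl, hy, ⟨p.ker, k, torsionKer p k, isDirection_ker hp hi hi' hpi hσ,
      Nat.one_le_iff_ne_zero.2 hk, hH, (bvar_eq_preimage hα' hH).symm⟩, haff hne⟩
  by_cases hy : y = unitPt E
  · obtain ⟨q, hq1, hq⟩ := exists_torsion E
    have hk0 : orderOf q ≠ 0 := hq.orderOf_pos.ne'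
    have hk1 : orderOf q ≠ 1 := fun h => hq1 (orderOf_eq_one_iff.1 h)
    have : NeZero (orderOf q) := ⟨hk0⟩
    refine key (orderOf q) hk0 ?_ ⟨_, mem_exactOrdSet hp hi hpi hσ hα rfl⟩
    rw [hy]
    exact unitPt_notMem_exactOrdSet hp hσ (by omega)
  · refine key 1 one_ne_zero ?_ ?_
    · rw [exactOrdSet_ker hp hi hpi hσ hα]
      exact hy
    · rw [exactOrdSet_ker hp hi hpi hσ hα]
      exact Set.singleton_nonempty _

omit [GrpObj E] [IsIntegral E.left] [SmoothOfRelativeDimension 1 E.hom] [IsProper E.hom] in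
lemma range_inr_eq_ker_fst :
    (MonoidHom.inr Circle Circle).range = (MonoidHom.fst Circle Circle).ker := by
  ext g
  constructor
  · rintro ⟨z, rfl⟩
    rfl
  · intro h
    exact ⟨g.2, Prod.ext (Eq.symm h) rfl⟩

omit [GrpObj E] [IsIntegral E.left] [SmoothOfRelativeDimension 1 E.hom] [IsProper E.hom] in
lemma range_inl_eq_ker_snd :
    (MonoidHom.inl Circle Circle).range = (MonoidHom.snd Circle Circle).ker := by
  ext g
  constructor
  · rintro ⟨z, rfl⟩
    rfl
  · intro h
    exact ⟨g.1, Prod.ext rfl (Eq.symm h)⟩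

lemma exists_fst_preimage [IsCommMonObj E] (y : E.left) :
    ∃ (S : Set E.left) (h : IsClosed S), y ∉ S ∧ (fst E E).left ⁻¹' S ∈ generatingClosed E ∧
      IsAffineOpen (⟨Sᶜ, h.isOpen_compl⟩ : E.left.Opens) := by
  have h := exists_bvar_eq_preimage (E := E) (p := MonoidHom.fst Circle Circle)
    (i := MonoidHom.inr Circle Circle) (σ := MonoidHom.inl Circle Circle) (α := (1, 0))
    continuous_fst (continuous_const.prodMk continuous_id) (fun z w h => congrArg Prod.snd h)
    range_inr_eq_ker_fst (fun z => rfl) (fun g => by simp)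
    (fun a ha => ⟨a.1, Prod.ext (by simp) ?_⟩) y
  · simpa [proj] using h
  · have := eq_zero_of_forall_zpow_eq_one (n := a.2) fun z => by
      simpa using ha (1, z) rfl
    simp [this]

lemma exists_snd_preimage [IsCommMonObj E] (y : E.left) :
    ∃ (S : Set E.left) (h : IsClosed S), y ∉ S ∧ (snd E E).left ⁻¹' S ∈ generatingClosed E ∧
      IsAffineOpen (⟨Sᶜ, h.isOpen_compl⟩ : E.left.Opens) := by
  have h := exists_bvar_eq_preimage (E := E) (p := MonoidHom.snd Circle Circle)
    (i := MonoidHom.inl Circle Circle) (σ := MonoidHom.inr Circle Circle) (α := (0, 1))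
    continuous_snd (continuous_id.prodMk continuous_const) (fun z w h => congrArg Prod.fst h)
    range_inl_eq_ker_snd (fun z => rfl) (fun g => by simp)
    (fun a ha => ⟨a.2, Prod.ext ?_ (by simp)⟩) y
  · simpa [proj] using h
  · have := eq_zero_of_forall_zpow_eq_one (n := a.1) fun z => by
      simpa using ha (z, 1) rfl
    simp [this]

end Generators

/-! ### Affine open sets of the torsion point topology -/

section AffineBasis

open TopologicalSpace Limits

variable {E : Over (Spec (.of ℂ))}

lemma isAffineOpen_inf_preimage {X Y S : Scheme.{0}} [IsAffine S] (f : X ⟶ Y) (g : Y ⟶ S)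
    [IsSeparated g] {W : X.Opens} (hW : IsAffineOpen W) {U : Y.Opens} (hU : IsAffineOpen U) :
    IsAffineOpen (W ⊓ f ⁻¹ᵁ U) := by
  have : IsAffine W := hW
  have : IsAffineHom ((W.ι ≫ f) ≫ g) := inferInstance
  have : IsAffineHom (W.ι ≫ f) := MorphismProperty.of_postcomp (W := @IsAffineHom)
    (W' := @IsSeparated) (W.ι ≫ f) g inferInstance inferInstance
  have h := (hU.preimage (W.ι ≫ f)).image_of_isOpenImmersion W.ι
  convert h using 1
  rw [Scheme.Hom.comp_preimage, Scheme.Hom.image_preimage_eq_opensRange_inf,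
    Scheme.Opens.opensRange_ι]

lemma isAffineOpen_inf_fst_snd {U₁ U₂ : E.left.Opens} (h₁ : IsAffineOpen U₁)
    (h₂ : IsAffineOpen U₂) :
    IsAffineOpen ((fst E E).left ⁻¹ᵁ U₁ ⊓ (snd E E).left ⁻¹ᵁ U₂ : (chi E).Opens) := by
  have : IsAffine U₁ := h₁
  have : IsAffine U₂ := h₂
  let g : pullback (U₁.ι ≫ E.hom) (U₂.ι ≫ E.hom) ⟶ pullback E.hom E.hom :=
    pullback.map _ _ _ _ U₁.ι U₂.ι (𝟙 _) (by simp) (by simp)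
  have h : IsAffineOpen g.opensRange := isAffineOpen_opensRange g
  have hU : ((fst E E).left ⁻¹ᵁ U₁ ⊓ (snd E E).left ⁻¹ᵁ U₂ : (chi E).Opens) = g.opensRange := by
    refine Opens.ext (Eq.trans ?_ (Scheme.Pullback.range_map _ _ _ _ _ _ _ _ _).symm)
    rw [Scheme.Opens.range_ι, Scheme.Opens.range_ι]
    rfl
  exact hU ▸ h

lemma isSeparated_chi [IsProper E.hom] : (chi E).IsSeparated := by
  have : IsSeparated (E ⊗ E).hom := by
    change IsSeparated (pullback.fst E.hom E.hom ≫ E.hom)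
    infer_instance
  have := (inferInstance : IsSeparated ((E ⊗ E).hom ≫ terminal.from _))
  exact ⟨by rwa [terminal.comp_from] at this⟩

variable [GrpObj E] [IsCommMonObj E] [IsIntegral E.left] [SmoothOfRelativeDimension 1 E.hom]
  [IsProper E.hom]

variable (E) in
lemma continuous_idFun : Continuous (idFun E) := by
  refine continuous_generateFrom_iff.2 fun U hU => ?_
  obtain ⟨π, S, hS, hD, -⟩ := exists_eq_preimage_of_mem_generatingClosed hU
  have h : IsClosed (Uᶜ : Set (chi E)) := hD ▸ hS.preimage π.left.continuous
  exact isClosed_compl_iff.1 h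

/-- Every point of `χ` has an affine neighbourhood that is open in the torsion point topology,
namely the product of the complements of two sets of torsion points of `E`. -/
lemma exists_isOpen_and_isAffineOpen (y : ChiTP E) :
    ∃ W : Set (ChiTP E), IsOpen W ∧ y ∈ W ∧
      ∃ W' : (chi E).Opens, (W' : Set (chi E)) = W ∧ IsAffineOpen W' := by
  obtain ⟨S₁, hS₁, hy₁, hD₁, hA₁⟩ := exists_fst_preimage (E := E) ((fst E E).left y)
  obtain ⟨S₂, hS₂, hy₂, hD₂, hA₂⟩ := exists_snd_preimage (E := E) ((snd E E).left y)
  have ho : ∀ D ∈ generatingClosed E, IsOpen (X := ChiTP E) Dᶜ := fun D hD =>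
    isOpen_generateFrom_of_mem (show Dᶜᶜ ∈ generatingClosed E from (compl_compl D).symm ▸ hD)
  exact ⟨((fst E E).left ⁻¹' S₁)ᶜ ∩ ((snd E E).left ⁻¹' S₂)ᶜ, (ho _ hD₁).inter (ho _ hD₂),
    ⟨hy₁, hy₂⟩, _, rfl, isAffineOpen_inf_fst_snd hA₁ hA₂⟩

/-- The torsion point topology has a basis of open sets that are affine open subschemes of `χ`. -/
lemma exists_isAffineOpen_of_isOpen {V : Set (ChiTP E)} (hV : IsOpen V) {y : ChiTP E}
    (hy : y ∈ V) :
    ∃ W ⊆ V, IsOpen W ∧ y ∈ W ∧ ∃ W' : (chi E).Opens, (W' : Set (chi E)) = W ∧ IsAffineOpen W' := by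
  have := isSeparated_chi (E := E)
  induction hV with
  | basic U hU =>
    obtain ⟨W, hW, hyW, W', rfl, hW'⟩ := exists_isOpen_and_isAffineOpen y
    obtain ⟨π, S, hS, hD, hA⟩ := exists_eq_preimage_of_mem_generatingClosed hU
    have hUS : U = π.left ⁻¹' Sᶜ := (compl_compl U).symm.trans (congrArg compl hD)
    refine ⟨(W' : Set (chi E)) ∩ U, Set.inter_subset_right,
      hW.inter (isOpen_generateFrom_of_mem hU), ⟨hyW, hy⟩, ?_⟩
    rcases S.eq_empty_or_nonempty with rfl | hne
    · refine ⟨W', ?_, hW'⟩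
      rw [hUS, Set.compl_empty, Set.preimage_univ]
      exact (Set.inter_univ _).symm
    · exact ⟨W' ⊓ π.left ⁻¹ᵁ ⟨Sᶜ, hS.isOpen_compl⟩, by rw [hUS]; rfl,
        isAffineOpen_inf_preimage π.left E.hom hW' (hA hne)⟩
  | univ =>
    obtain ⟨W, hW, hyW, h⟩ := exists_isOpen_and_isAffineOpen y
    exact ⟨W, Set.subset_univ _, hW, hyW, h⟩
  | inter U₁ U₂ _ _ ih₁ ih₂ =>
    obtain ⟨W₁, hWU₁, hW₁, hy₁, W₁', rfl, hA₁⟩ := ih₁ hy.1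
    obtain ⟨W₂, hWU₂, hW₂, hy₂, W₂', rfl, hA₂⟩ := ih₂ hy.2
    exact ⟨_, Set.inter_subset_inter hWU₁ hWU₂, hW₁.inter hW₂, ⟨hy₁, hy₂⟩, W₁' ⊓ W₂', rfl,
      hA₁.inf hA₂⟩
  | sUnion 𝒰 _ ih =>
    obtain ⟨U, hU, hyU⟩ := hy
    obtain ⟨W, hWU, h⟩ := ih U hU hyU
    exact ⟨W, hWU.trans (Set.subset_sUnion_of_mem hU), h⟩

lemma exists_isAffineOpen_map_changeTop (h : Continuous (idFun E)) (V : Opens (chiTP E))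
    (y : chiTP E) (hy : y ∈ V) :
    ∃ W ≤ V, y ∈ W ∧ IsAffineOpen (X := chi E) ((Opens.map (changeTop E h)).obj W) := by
  obtain ⟨W, hWV, hW, hyW, W', hWW', hA⟩ := exists_isAffineOpen_of_isOpen V.isOpen hy
  have hW'' : W' = (Opens.map (changeTop E h)).obj ⟨W, hW⟩ := Opens.ext hWW'
  exact ⟨⟨W, hW⟩, hWV, hyW, hW'' ▸ hA⟩

end AffineBasis

end TPTopology

end

theorem mainTheorem5 (E : Over (Spec (.of ℂ))) [GrpObj E] [IsProper E.hom]
    [SmoothOfRelativeDimension 1 E.hom] [GeometricallyIntegral E.hom] :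
    ∃ hφ : Continuous (TPTopology.idFun E),
      (∀ S : ShortComplex (TPTopology.chi E).Modules,
        TPTopology.isQCoh _ S.X₁ → TPTopology.isQCoh _ S.X₂ → TPTopology.isQCoh _ S.X₃ →
        S.ShortExact →
        (S.map (TPTopology.toAbSheaf (TPTopology.chi E) ⋙
          TopCat.Sheaf.pushforward AddCommGrpCat.{0}
            (TPTopology.changeTop E hφ))).ShortExact) ∧
      ∀ n : ℕ, Nonempty
        ((TPTopology.isQCoh (TPTopology.chi E)).ι ⋙
            TPTopology.toAbSheaf (TPTopology.chi E) ⋙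
            TPTopology.cohomology (TPTopology.chiZar E) n ≅
          (TPTopology.isQCoh (TPTopology.chi E)).ι ⋙
            TPTopology.toAbSheaf (TPTopology.chi E) ⋙
            TopCat.Sheaf.pushforward AddCommGrpCat.{0} (TPTopology.changeTop E hφ) ⋙
            TPTopology.cohomology (TPTopology.chiTP E) n) := by
  have : IsIntegral E.left := GeometricallyIntegral.isIntegral_of_subsingleton E.hom
  have := isCommMonObj_of_isProper_of_geometricallyIntegral E
  have hφ := TPTopology.continuous_idFun E
  have haff := TPTopology.exists_isAffineOpen_map_changeTop hφ
  exact ⟨hφ, fun S h₁ _ _ hS => TPTopology.shortExact_map_pushforward_of_isQCoh _ haff hS h₁,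
    TPTopology.nonempty_cohomology_iso_of_isQCoh _ haff⟩
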